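/- **Definitions.** A matrix $K\in\mathbb{R}^{N\times N}$ is *magnitude-symmetric* if $|K_{i,j}|=|K_{j,i}|$ for all $i,j$. Let $\mathcal{K}_N$ be the set of magnitude-symmetric $K\in\mathbb{R}^{N\times N}$ such that, whenever $i,j,k,\ell\in[N]=\{1,\dots,N\}$ are distinct and $K_{i,j}K_{j,k}K_{k,\ell}K_{\ell,i}\neq 0$, one has (i) $|K_{i,j}K_{k,\ell}|\neq|K_{j,k}K_{\ell,i}|$, and (ii) for all $\phi_1,\phi_2,\phi_3\in\{-1,1\}$, $$\phi_1K_{i,j}K_{j,k}K_{k,\ell}K_{\ell,i}+\phi_2K_{i,j}K_{j,\ell}K_{\ell,k}K_{k,i}+\phi_3K_{i,k}K_{k,j}K_{j,\ell}K_{\ell,i}\neq 0 .$$ For $S\subseteq[N]$ write $\Delta_S(K)=\det\,(K_{i,j})_{i,j\in S}$, the principal minor of order $|S|$ (with $\Delta_\emptyset(K)=1$). The *charged sparsity graph* $G=([N],E,\epsilon)$ of a magnitude-symmetric matrix $K$ has an edge $\{i,j\}$ whenever $i\ne j$ and $K_{i,j}\neq0$, with charge $\epsilon(\{i,j\})=\operatorname{sgn}(K_{i,j}K_{j,i})\in\{-1,+1\}$;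 a subgraph $H$ is *positive* if $\epsilon(H):=\prod_{e\in E(H)}\epsilon(e)=+1$. A *cycle* is a subgraph all of whose vertices have even degree in it, and a *simple cycle* is a connected subgraph all of whose vertices have degree two in it. For a subgraph $H$ of $G$, let $\mathcal{C}^+(H)\subseteq \mathrm{GF}(2)^{E}$ be the space of incidence vectors of the positive cycles of $H$. A graph is *two-connected* if it has at least two vertices, is connected, and remains connected after the removal of any one vertex; a *block* of $G$ is a maximal two-connected subgraph. The *simple cycle sparsity* of $\mathcal{C}^+(H)$, for a block $H$, is the smallest $\ell$ such that the incidence vectors of positive simple cycles of $H$ with at most $\ell$ edges span $\mathcal{C}^+(H)$; it is set to $2$ if $H$ has exactly two vertices. The *simple cycle sparsity* $\ell_+$ of $\mathcal{C}^+(G)$ is the maximum of the simple cycle sparsities of $\mathcal{C}^+(H)$ over all blocks $H$ of $G$, and is set to $2$ if $G$ has no blocks. **Theorem.** Let $K\in\mathcal{K}_N$ have charged sparsity graph $G$, and suppose that the simple cycle sparsity $\ell_+$ of $\mathcal{C}^+(G)$ satisfies $\ell_+\ge 3$. Then 1. any $K'\in\mathcal{K}_N$ with $\Delta_S(K)=\Delta_S(K')$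 for all $S\subseteq[N]$ with $|S|\le\ell_+$ satisfies $\Delta_S(K)=\Delta_S(K')$ for all $S\subseteq[N]$; and 2. there exists $\hat K\in\mathcal{K}_N$ with $\Delta_S(\hat K)=\Delta_S(K)$ for all $S\subseteq[N]$ with $|S|<\ell_+$, but $\Delta_S(\hat K)\neq\Delta_S(K)$ for some $S\subseteq[N]$ with $|S|=\ell_+$. -/

import Mathlib

/-- `K` is magnitude-symmetric: opposing entries have equal absolute value. -/
def IsMagnitudeSymmetric {V : Type*} (K : Matrix V V ℝ) : Prop :=
  ∀ i j, |K i j| = |K j i|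

/-- The genericity condition on four-cycles. -/
def IsGenericOnFourCycles {V : Type*} (K : Matrix V V ℝ) : Prop :=
  ∀ i j k l : V, i ≠ j → i ≠ k → i ≠ l → j ≠ k → j ≠ l → k ≠ l →
    K i j * K j k * K k l * K l i ≠ 0 →
      |K i j * K k l| ≠ |K j k * K l i| ∧
      ∀ φ₁ φ₂ φ₃ : ℝ, (φ₁ = 1 ∨ φ₁ = -1) → (φ₂ = 1 ∨ φ₂ = -1) → (φ₃ = 1 ∨ φ₃ = -1) →
        φ₁ * (K i j * K j k * K k l * K l i) + φ₂ * (K i j * K j l * K l k * K k i)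
          + φ₃ * (K i k * K k j * K j l * K l i) ≠ 0

/-- The class `𝒦_N` of generic magnitude-symmetric real `N × N` matrices. -/
def genericMagnitudeSymmetric (N : ℕ) : Set (Matrix (Fin N) (Fin N) ℝ) :=
  {K | IsMagnitudeSymmetric K ∧ IsGenericOnFourCycles K}

/-- The principal minor `Δ_S(K) = det (K_{i,j})_{i,j ∈ S}` (equal to `1` for `S = ∅`). -/
noncomputable def principalMinor {N : ℕ} (K : Matrix (Fin N) (Fin N) ℝ) (S : Finset (Fin N)) : ℝ :=
  (K.submatrix (fun i : S => (i : Fin N)) (fun i : S => (i : Fin N))).det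

/-- A charged graph: a simple graph, every edge of which has a charge `+1` or `-1`.
The values of `charge` on pairs that are not edges play no role. -/
structure ChargedGraph (V : Type*) where
  graph : SimpleGraph V
  charge : Sym2 V → ℤ
  charge_eq : ∀ e ∈ graph.edgeSet, charge e = 1 ∨ charge e = -1

/-- The charged sparsity graph `G_K` of a magnitude-symmetric matrix: `{i,j}` is an edge when
`i ≠ j` and `K i j ≠ 0`, and its charge is `sgn (K i j * K j i)`. -/
noncomputable def chargedSparsityGraph {V : Type*} (K : Matrix V V ℝ)
    (hK : IsMagnitudeSymmetric K) : ChargedGraph V where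
  graph :=
    { Adj := fun i j => i ≠ j ∧ |K i j| ≠ 0
      symm := ⟨fun i j h => ⟨h.1.symm, by rw [hK j i]; exact h.2⟩⟩
      loopless := ⟨fun _ h => h.1 rfl⟩ }
  charge := Sym2.lift ⟨fun i j => ((SignType.sign (K i j * K j i) : SignType) : ℤ),
    fun i j => congrArg (fun x : ℝ => ((SignType.sign x : SignType) : ℤ)) (mul_comm (K i j) (K j i))⟩
  charge_eq := by
    intro e
    induction e using Sym2.ind with
    | _ i j =>
      intro h
      have h1 : |K i j| ≠ 0 := h.2
      have h2 : |K j i| ≠ 0 := by rw [hK j i]; exact h1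
      have h3 : K i j * K j i ≠ 0 := mul_ne_zero (abs_ne_zero.mp h1) (abs_ne_zero.mp h2)
      rcases lt_or_gt_of_ne h3 with h4 | h4
      · right; simp [sign_neg h4]
      · left; simp [sign_pos h4]

namespace ChargedGraph

variable {V : Type*}

/-- The incidence vector `χ_H ∈ GF(2)^{E(G)}` of a subgraph `H` of `G`. -/
noncomputable def incidenceVector {G : SimpleGraph V} (H : G.Subgraph) : G.edgeSet → ZMod 2 :=
  Set.indicator {e | (e : Sym2 V) ∈ H.edgeSet} 1

/-- A cycle: a subgraph all of whose vertices have even degree (possibly not connected). -/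
def IsEvenSubgraph {G : SimpleGraph V} (C : G.Subgraph) : Prop :=
  ∀ v ∈ C.verts, Even (C.neighborSet v).ncard

/-- A simple cycle: a connected subgraph all of whose vertices have degree two. -/
def IsSimpleCycle {G : SimpleGraph V} (C : G.Subgraph) : Prop :=
  C.Connected ∧ ∀ v ∈ C.verts, (C.neighborSet v).ncard = 2

/-- A two-connected subgraph: it has at least two vertices, is connected, and has no articulation
point, i.e. it stays connected when any one of its vertices is removed. -/
def IsTwoConnected {G : SimpleGraph V} (H : G.Subgraph) : Prop :=
  H.verts.Nontrivial ∧ H.Connected ∧ ∀ v ∈ H.verts, (H.deleteVerts {v}).Connected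

/-- A block: a maximal two-connected subgraph. -/
def IsBlock {G : SimpleGraph V} (H : G.Subgraph) : Prop :=
  Maximal IsTwoConnected H

variable [Finite V]

/-- The charge `ε(H)` of a subgraph: the product of the charges of its edges. -/
noncomputable def subgraphCharge (G : ChargedGraph V) (H : G.graph.Subgraph) : ℤ :=
  ∏ e ∈ H.edgeSet.toFinite.toFinset, G.charge e

/-- `𝒞⁺(H)`: the incidence vectors of the positive cycles of the subgraph `H`. -/
def positiveCycleSpace (G : ChargedGraph V) (H : G.graph.Subgraph) :
    Set (G.graph.edgeSet → ZMod 2) :=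
  {x | ∃ C : G.graph.Subgraph, C ≤ H ∧ IsEvenSubgraph C ∧ G.subgraphCharge C = 1 ∧
    x = incidenceVector C}

/-- The incidence vectors of the positive simple cycles of `H` with at most `l` edges. -/
def shortPositiveSimpleCycles (G : ChargedGraph V) (H : G.graph.Subgraph) (l : ℕ) :
    Set (G.graph.edgeSet → ZMod 2) :=
  {x | ∃ C : G.graph.Subgraph, C ≤ H ∧ IsSimpleCycle C ∧ G.subgraphCharge C = 1 ∧
    C.edgeSet.ncard ≤ l ∧ x = incidenceVector C}

open Classical in
/-- The simple cycle sparsity of `𝒞⁺(H)` for a two-connected subgraph `H`: the least `l` for which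
the positive simple cycles with at most `l` edges span `𝒞⁺(H)`; by convention it is `2` when `H` is
a trivial block, i.e. has exactly two vertices. -/
noncomputable def blockSparsity (G : ChargedGraph V) (H : G.graph.Subgraph) : ℕ :=
  if H.verts.ncard = 2 then 2
  else sInf {l : ℕ | (Submodule.span (ZMod 2) (G.shortPositiveSimpleCycles H l) :
    Set (G.graph.edgeSet → ZMod 2)) = G.positiveCycleSpace H}

open Classical in
/-- The simple cycle sparsity `ℓ₊` of `𝒞⁺(G)`: the maximum over the blocks `H` of `G` of the simple
cycle sparsity of `𝒞⁺(H)`, and `2` if `G` has no blocks. (A two-connected `G` is its only block.) -/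
noncomputable def simpleCycleSparsity (G : ChargedGraph V) : ℕ :=
  if ∃ H : G.graph.Subgraph, IsBlock H then
    sSup {n : ℕ | ∃ H : G.graph.Subgraph, IsBlock H ∧ n = G.blockSparsity H}
  else 2

end ChargedGraph

/-! Magnitude-symmetric matrices with equal principal minors of order at most two differ by a
symmetric table `t` of signs (`exists_isSwitching`), so the question is which sign changes preserve
which minors. In the expansion of a minor over permutations, reversing an orbit of negative charge
negates the term, so permutations with such an orbit cancel in pairs. Hence a `t` whose product is
one along every positive simple cycle with at most `#S` edges preserves the minor on `S`
(`IsSwitching.principalMinor_eq_of_simpleCycles`).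

The converse, one cycle length at a time, is where genericity enters
(`IsSwitching.edgeProd_eq_one`). If `t` is trivial on all shorter positive cycles, the change of the
minor is, up to sign, twice the sum of the weights of the positive Hamiltonian cycles on which `t`
has product -1. It must be shown that this sum is nonzero as soon as one of its terms is. Fix such a
term. Each chord splits the cycle into two negative cycles: two positive ones would be shorter, and
their `t`-signs would multiply to -1. The same comparison forces two crossing chords to join the
ends of two edges of the cycle. Without crossing chords, the given cycle and its inverse are the
only Hamiltonian cycles of nonzero weight, and they have equal weight. Four vertices are treated by
hand. Otherwise a crossing pair yields an edge cut consisting of exactly four edges, which form a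
four-cycle. A Hamiltonian cycle crosses it along one of its two perfect matchings, and reversing one
side exchanges the matchings with a fixed ratio of weights. So the sum is a multiple of the same sum
for the matrix with one matching deleted, and condition (i) says that the factor is nonzero.
Induction on the number of nonzero entries concludes (`IsGenericSystem.sum_weight_ne_zero`).

The link with sparsity is linear duality over GF(2). In a two-connected graph the positive simple
cycles span the positive cycle space (`span_shortPositiveSimpleCycles`): a labelling killing them
becomes a coboundary after possibly adding the charge, which is proved by growing a potential along
ears. For claim 1, induction on length makes `t` trivial on positive simple cycles with at most ℓ₊
edges, hence on all of them (`edgeProd_eq_one_of_short`). For claim 2, a functional that kills the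
shorter positive cycles of an extremal block, but not one with ℓ₊ edges, defines the sign change
(`exists_sign_short`). -/

namespace MagnitudeSymmetric

open Equiv Equiv.Perm Finset ChargedGraph

/-! ### Reversing one orbit of a permutation -/

section ReverseOrbit

variable {V : Type*} [Fintype V] [DecidableEq V]

/-- The permutation `σ` with its orbit through `i` traversed backwards. -/
def reverseOrbit (σ : Perm V) (i : V) : Perm V :=
  σ * (σ.cycleOf i)⁻¹ * (σ.cycleOf i)⁻¹

theorem reverseOrbit_apply (σ : Perm V) (i x : V) :
    reverseOrbit σ i x = if SameCycle σ i x then σ⁻¹ x else σ x := by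
  have key : ∀ y, (σ.cycleOf i)⁻¹ y = if SameCycle σ i y then σ⁻¹ y else y := by
    intro y
    rw [cycleOf_inv, cycleOf_apply]
    simp [sameCycle_inv]
  simp only [reverseOrbit, Perm.mul_apply]
  by_cases h : SameCycle σ i x
  · have h' : SameCycle σ i (σ⁻¹ x) := sameCycle_symm_apply_right.2 h
    rw [key x, if_pos h, key, if_pos h', if_pos h]
    simp
  · rw [key x, if_neg h, key, if_neg h, if_neg h]

theorem reverseOrbit_sign (σ : Perm V) (i : V) : sign (reverseOrbit σ i) = sign σ := by
  simp [reverseOrbit, mul_assoc]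

theorem sameCycle_of_forall_sameCycle_apply {σ τ : Perm V}
    (h : ∀ x, SameCycle σ x (τ x)) {a b : V} (hab : SameCycle τ a b) : SameCycle σ a b := by
  obtain ⟨n, -, rfl⟩ := hab.exists_pow_eq'
  induction n with
  | zero => exact SameCycle.refl _ _
  | succ n ih =>
    rw [pow_succ', Perm.mul_apply]
    exact (ih ⟨n, by simp⟩).trans (h _)

theorem sameCycle_reverseOrbit (σ : Perm V) (i a b : V) :
    SameCycle (reverseOrbit σ i) a b ↔ SameCycle σ a b := by
  constructor
  · refine fun h => sameCycle_of_forall_sameCycle_apply (fun x => ?_) h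
    rw [reverseOrbit_apply]
    split_ifs
    · exact sameCycle_symm_apply_right.2 (SameCycle.refl _ _)
    · exact sameCycle_apply_right.2 (SameCycle.refl _ _)
  · intro h
    refine sameCycle_of_forall_sameCycle_apply (fun x => ?_) h
    by_cases hx : SameCycle σ i x
    · have : reverseOrbit σ i (σ x) = x := by
        rw [reverseOrbit_apply, if_pos (sameCycle_apply_right.2 hx)]; simp
      have h2 : SameCycle (reverseOrbit σ i) (σ x) (reverseOrbit σ i (σ x)) :=
        sameCycle_apply_right.2 (SameCycle.refl _ _)
      rw [this] at h2
      exact h2.symm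
    · have : reverseOrbit σ i x = σ x := by rw [reverseOrbit_apply, if_neg hx]
      rw [← this]
      exact sameCycle_apply_right.2 (SameCycle.refl _ _)

theorem reverseOrbit_reverseOrbit (σ : Perm V) (i : V) :
    reverseOrbit (reverseOrbit σ i) i = σ := by
  ext x
  rw [reverseOrbit_apply]
  simp only [sameCycle_reverseOrbit]
  split_ifs with h
  · rw [Perm.inv_eq_iff_eq, reverseOrbit_apply, if_pos (sameCycle_apply_right.2 h)]
    simp
  · rw [reverseOrbit_apply, if_neg h]

open Classical in
theorem prod_orbit_inv (σ : Perm V) (i : V) (g : V → V → ℝ) :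
    ∏ x with SameCycle σ i x, g x (σ⁻¹ x) = ∏ x with SameCycle σ i x, g (σ x) x := by
  symm
  refine Finset.prod_bij (fun x _ => σ x) ?_ ?_ ?_ ?_
  · intro x hx
    simpa using hx
  · intro x _ y _ h
    exact σ.injective h
  · intro y hy
    exact ⟨σ⁻¹ y, by simpa using hy, by simp⟩
  · intro x _
    simp

open Classical in
theorem prod_reverseOrbit (σ : Perm V) (i : V) (g : V → V → ℝ) :
    ∏ x, g x (reverseOrbit σ i x) =
      (∏ x with SameCycle σ i x, g (σ x) x) * ∏ x with ¬ SameCycle σ i x, g x (σ x) := by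
  rw [← prod_orbit_inv σ i g, ← Finset.prod_filter_mul_prod_filter_not univ (SameCycle σ i)]
  congr 1
  · refine Finset.prod_congr rfl fun x hx => ?_
    rw [reverseOrbit_apply, if_pos (by simpa using hx)]
  · refine Finset.prod_congr rfl fun x hx => ?_
    rw [reverseOrbit_apply, if_neg (by simpa using hx)]

end ReverseOrbit

/-! ### Sign tables and the effect of a sign change on a determinant -/

/-- A symmetric table of signs. -/
structure IsSymmSign {V : Type*} (e : V → V → ℝ) : Prop where
  eq_or : ∀ x y, e x y = 1 ∨ e x y = -1
  symm : ∀ x y, e x y = e y x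

namespace IsSymmSign

variable {V : Type*} {e : V → V → ℝ}

theorem mul_self (he : IsSymmSign e) (x y : V) : e x y * e x y = 1 := by
  rcases he.eq_or x y with h | h <;> simp [h]

theorem mul_symm (he : IsSymmSign e) (x y : V) : e x y * e y x = 1 := by
  rw [he.symm y x, he.mul_self]

theorem prod_eq_or {ι : Type*} (he : IsSymmSign e) (s : Finset ι) (a b : ι → V) :
    ∏ i ∈ s, e (a i) (b i) = 1 ∨ ∏ i ∈ s, e (a i) (b i) = -1 := by
  classical
  induction s using Finset.induction_on with
  | empty => simp
  | insert i s hi ih =>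
    rw [prod_insert hi]
    rcases ih with h | h <;> rcases he.eq_or (a i) (b i) with h' | h' <;> simp [h, h']

end IsSymmSign

/-- Every cycle with at least three and fewer than `k` vertices on which `M` does not vanish and
whose `e`-sign is positive has positive `s`-sign. -/
def PositiveCyclesBelow {V : Type*} (M e s : V → V → ℝ) (k : ℕ) : Prop :=
  ∀ (c : Perm V) (P : Finset V), c.IsCycleOn P → 3 ≤ #P → #P < k →
    (∀ v ∈ P, M v (c v) ≠ 0) → ∏ v ∈ P, e v (c v) = 1 → ∏ v ∈ P, s v (c v) = 1

section CycleExpansion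

variable {V : Type*} [Fintype V] [DecidableEq V] {M e s : V → V → ℝ}

/-- The product of the entries of `M` along the permutation `σ`. -/
noncomputable def weight (M : V → V → ℝ) (σ : Perm V) : ℝ := ∏ v, M v (σ v)

open Classical in
/-- The full cycles with positive `e`-sign and negative `s`-sign. -/
noncomputable def flippedFullCycles (e s : V → V → ℝ) : Finset (Perm V) :=
  {σ | σ.IsCycleOn (univ : Finset V) ∧ weight e σ = 1 ∧ weight s σ = -1}

open Classical in
theorem isCycleOn_orbit (σ : Perm V) (i : V) :
    σ.IsCycleOn (({x | SameCycle σ i x} : Finset V) : Set V) := by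
  refine ⟨⟨fun x hx => by simpa using hx, σ.injective.injOn, fun y hy => ?_⟩, fun x hx y hy => ?_⟩
  · exact ⟨σ⁻¹ y, by simpa using hy, by simp⟩
  · exact (show SameCycle σ i x by simpa using hx).symm.trans (by simpa using hy)

open Classical in
/-- The vertices lying on an orbit of `σ` with negative sign. -/
noncomputable def negativePoints (e : V → V → ℝ) (σ : Perm V) : Finset V :=
  {i | ∏ x with SameCycle σ i x, e x (σ x) = -1}

-- Reversal keeps the orbits as sets, and `e` is symmetric, so orbit signs do not change. A choice
-- of orbit that depends only on this set is therefore stable under reversal, which makes the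
-- cancellation an involution.
open Classical in
theorem negativePoints_reverseOrbit (he : IsSymmSign e) (σ : Perm V) (i : V) :
    negativePoints e (reverseOrbit σ i) = negativePoints e σ := by
  ext j
  simp only [negativePoints, mem_filter, mem_univ, true_and, sameCycle_reverseOrbit]
  by_cases hij : SameCycle σ i j
  · have h1 : ∏ x with SameCycle σ j x, e x (reverseOrbit σ i x)
        = ∏ x with SameCycle σ j x, e x (σ⁻¹ x) := by
      refine Finset.prod_congr rfl fun x hx => ?_
      rw [reverseOrbit_apply, if_pos (hij.trans (by simpa using hx))]
    rw [h1, prod_orbit_inv]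
    simp only [he.symm (σ _) _]
  · have h1 : ∏ x with SameCycle σ j x, e x (reverseOrbit σ i x)
        = ∏ x with SameCycle σ j x, e x (σ x) := by
      refine Finset.prod_congr rfl fun x hx => ?_
      rw [reverseOrbit_apply, if_neg fun h => hij (h.trans (SameCycle.symm (by simpa using hx)))]
    rw [h1]

-- Every entry along the orbit is transposed and so picks up its sign `e`. Reversing a negative
-- orbit thus negates the weight, while the sign of the permutation is unchanged.
open Classical in
theorem weight_reverseOrbit (hM : ∀ x y, M y x = e x y * M x y) (σ : Perm V) (i : V) :
    weight M (reverseOrbit σ i) = (∏ x with SameCycle σ i x, e x (σ x)) * weight M σ := by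
  rw [weight, prod_reverseOrbit, weight,
    ← Finset.prod_filter_mul_prod_filter_not univ (SameCycle σ i), ← mul_assoc, ← prod_mul_distrib]
  congr 1
  exact Finset.prod_congr rfl fun x _ => hM _ _

open Classical in
theorem weight_sign_reverseOrbit (hs : IsSymmSign s) (σ : Perm V) (i : V) :
    weight s (reverseOrbit σ i) = weight s σ := by
  rw [weight, prod_reverseOrbit, weight,
    ← Finset.prod_filter_mul_prod_filter_not univ (SameCycle σ i)]
  congr 1
  exact Finset.prod_congr rfl fun x _ => hs.symm _ _

theorem det_sub_det_eq_sum (M s : V → V → ℝ) :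
    (Matrix.of M).det - (Matrix.of fun x y => s x y * M x y).det =
      ∑ σ : Perm V, ((sign σ : ℤ) : ℝ) * weight M σ * (1 - weight s σ) := by
  -- `Matrix.det_apply'` multiplies the entries at `(σ v, v)`; transposing turns them into those of
  -- `weight`.
  rw [← Matrix.det_transpose, ← Matrix.det_transpose (Matrix.of fun x y => s x y * M x y),
    Matrix.det_apply', Matrix.det_apply', ← sum_sub_distrib]
  refine sum_congr rfl fun σ _ => ?_
  simp only [Matrix.transpose_apply, Matrix.of_apply, weight, prod_mul_distrib]
  ring

open Classical in
/-- Permutations with a negative orbit cancel in pairs. -/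
theorem det_sub_det_eq_sum_positive (he : IsSymmSign e) (hs : IsSymmSign s)
    (hM : ∀ x y, M y x = e x y * M x y) :
    (Matrix.of M).det - (Matrix.of fun x y => s x y * M x y).det =
      ∑ σ : Perm V with negativePoints e σ = ∅,
        ((sign σ : ℤ) : ℝ) * weight M σ * (1 - weight s σ) := by
  rw [det_sub_det_eq_sum, ← Finset.sum_filter_add_sum_filter_not univ
    (fun σ : Perm V => negativePoints e σ = ∅), add_eq_left]
  -- The orbit to reverse is selected from the set of negative points alone, not from `σ`, so that
  -- `σ` and its partner select the same one. The default `d` is never reached when the set is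
  -- nonempty.
  let pick : Finset V → V → V := fun N d => if h : N.Nonempty then h.choose else d
  rcases isEmpty_or_nonempty V with hV | ⟨⟨d⟩⟩
  · exact Finset.sum_eq_zero fun σ hσ => absurd (Finset.eq_empty_of_isEmpty _) (mem_filter.1 hσ).2
  have hpick : ∀ σ : Perm V, negativePoints e σ ≠ ∅ →
      ∏ x with SameCycle σ (pick (negativePoints e σ) d) x, e x (σ x) = -1 := by
    intro σ hσ
    have h := nonempty_iff_ne_empty.2 hσ
    have h1 : pick (negativePoints e σ) d ∈ negativePoints e σ := by
      simp only [pick, dif_pos h]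
      exact h.choose_spec
    simp only [negativePoints, mem_filter, mem_univ, true_and] at h1 ⊢
    exact h1
  have hcancel : ∀ σ : Perm V, negativePoints e σ ≠ ∅ →
      ((sign σ : ℤ) : ℝ) * weight M σ * (1 - weight s σ) +
        ((sign (reverseOrbit σ (pick (negativePoints e σ) d)) : ℤ) : ℝ) *
          weight M (reverseOrbit σ (pick (negativePoints e σ) d)) *
          (1 - weight s (reverseOrbit σ (pick (negativePoints e σ) d))) = 0 := by
    intro σ hσ
    rw [reverseOrbit_sign, weight_reverseOrbit hM, weight_sign_reverseOrbit hs, hpick σ hσ]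
    ring
  refine Finset.sum_involution (fun σ _ => reverseOrbit σ (pick (negativePoints e σ) d)) ?_ ?_ ?_ ?_
  · intro σ hσ
    exact hcancel σ (by simpa using hσ)
  · intro σ hσ h0 h
    have := hcancel σ (by simpa using hσ)
    rw [h] at this
    exact h0 (by linarith)
  · intro σ hσ
    simpa [negativePoints_reverseOrbit he] using hσ
  · intro σ hσ
    simp only [negativePoints_reverseOrbit he]
    exact reverseOrbit_reverseOrbit _ _

open Classical in
theorem prod_eq_one_of_orbits {f : V → ℝ} (σ : Perm V)
    (h : ∀ i, ∏ x with SameCycle σ i x, f x = 1) : ∏ x, f x = 1 := by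
  rw [Finset.prod_partition (SameCycle.setoid σ)]
  refine Finset.prod_eq_one fun q hq => ?_
  obtain ⟨i, -, rfl⟩ := mem_image.1 hq
  rw [← h i]
  refine Finset.prod_congr ?_ fun _ _ => rfl
  ext y
  simp only [mem_filter, mem_univ, true_and]
  exact Quotient.eq.trans ⟨fun h => SameCycle.symm h, fun h => SameCycle.symm h⟩

/-- Fixed points carry sign one and a transposition uses the same symmetric sign twice, which is why
`PositiveCyclesBelow` only needs to speak of three or more vertices. -/
theorem prod_cycleOn_eq_one_of_card_le_two (hs : IsSymmSign s) (hs1 : ∀ x, s x x = 1)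
    {c : Perm V} {P : Finset V} (hc : c.IsCycleOn P) (hP : #P ≤ 2) : ∏ v ∈ P, s v (c v) = 1 := by
  interval_cases h : #P
  · simp [card_eq_zero.1 h]
  · obtain ⟨a, rfl⟩ := card_eq_one.1 h
    have : c a = a := by simpa [isCycleOn_singleton] using hc
    simp [this, hs1]
  · obtain ⟨a, b, hab, rfl⟩ := card_eq_two.1 h
    have hnt : ((({a, b} : Finset V)) : Set V).Nontrivial := ⟨a, by simp, b, by simp, hab⟩
    have ha : c a ∈ ((({a, b} : Finset V)) : Set V) := hc.1.mapsTo (by simp)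
    have hb : c b ∈ ((({a, b} : Finset V)) : Set V) := hc.1.mapsTo (by simp)
    have ha' : c a = b := by
      have := hc.apply_ne hnt (a := a) (by simp)
      simp at ha; tauto
    have hb' : c b = a := by
      have := hc.apply_ne hnt (a := b) (by simp)
      simp at hb; tauto
    rw [prod_pair hab, ha', hb', hs.mul_symm]

open Classical in
theorem weight_eq_one_of_orbits_lt (hs : IsSymmSign s) (he : IsSymmSign e) (hs1 : ∀ x, s x x = 1)
    {k : ℕ} (hshort : PositiveCyclesBelow M e s k) {σ : Perm V} (hneg : negativePoints e σ = ∅)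
    (hw : weight M σ ≠ 0) (hcard : ∀ i, #({x | SameCycle σ i x} : Finset V) < k) :
    weight s σ = 1 := by
  refine prod_eq_one_of_orbits σ fun i => ?_
  rcases le_or_gt #({x | SameCycle σ i x} : Finset V) 2 with h2 | h2
  · exact prod_cycleOn_eq_one_of_card_le_two hs hs1 (isCycleOn_orbit σ i) h2
  · refine hshort σ _ (isCycleOn_orbit σ i) h2 (hcard i) ?_ ?_
    · intro v _
      exact prod_ne_zero_iff.1 hw v (mem_univ v)
    · rcases he.prod_eq_or ({x | SameCycle σ i x} : Finset V) id σ with h | h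
      · exact h
      · have : i ∈ negativePoints e σ := by simpa [negativePoints] using h
        simp [hneg] at this

/-- If all positive cycles have positive `s`-sign, the sign change `s` preserves the determinant. -/
theorem det_eq_of_positiveCycles (he : IsSymmSign e) (hs : IsSymmSign s) (hs1 : ∀ x, s x x = 1)
    (hM : ∀ x y, M y x = e x y * M x y)
    (hshort : PositiveCyclesBelow M e s (Fintype.card V + 1)) :
    (Matrix.of M).det = (Matrix.of fun x y => s x y * M x y).det := by
  classical
  rw [← sub_eq_zero, det_sub_det_eq_sum_positive he hs hM]
  refine Finset.sum_eq_zero fun σ hσ => ?_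
  by_cases hw : weight M σ = 0
  · simp [hw]
  · rw [weight_eq_one_of_orbits_lt hs he hs1 hshort (by simpa using hσ) hw
      fun i => Nat.lt_succ_of_le (card_le_univ _)]
    simp

theorem sign_of_isCycleOn_univ (hV : 2 ≤ Fintype.card V) {σ : Perm V}
    (hσ : σ.IsCycleOn (univ : Finset V)) : sign σ = -(-1) ^ Fintype.card V := by
  have : Nontrivial V := Fintype.one_lt_card_iff_nontrivial.1 hV
  have hne : ∀ x, σ x ≠ x := fun x => hσ.apply_ne (by simpa using Set.nontrivial_univ) (by simp)
  have hc : σ.IsCycle := by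
    obtain ⟨x⟩ := (inferInstance : Nonempty V)
    exact ⟨x, hne x, fun y _ => hσ.2 (by simp) (by simp)⟩
  rw [hc.sign]
  congr 3
  ext x
  simpa using hne x

/-- If all shorter positive cycles have positive `s`-sign, the change of the determinant comes from
the flipped full cycles. -/
theorem det_sub_det_eq_flippedFullCycles (he : IsSymmSign e) (hs : IsSymmSign s)
    (hs1 : ∀ x, s x x = 1) (hM : ∀ x y, M y x = e x y * M x y) (hV : 2 ≤ Fintype.card V)
    (hshort : PositiveCyclesBelow M e s (Fintype.card V)) :
    (Matrix.of M).det - (Matrix.of fun x y => s x y * M x y).det =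
      -(-1) ^ Fintype.card V * 2 * ∑ σ ∈ flippedFullCycles e s, weight M σ := by
  classical
  have : Nonempty V := Fintype.card_pos_iff.1 (by omega)
  rw [det_sub_det_eq_sum_positive he hs hM, mul_sum]
  symm
  refine Finset.sum_subset_zero_on_sdiff ?_ ?_ ?_
  · intro σ hσ
    simp only [flippedFullCycles, mem_filter, mem_univ, true_and] at hσ ⊢
    simp only [negativePoints, filter_eq_empty_iff]
    intro i _ h
    have hall : ({x | SameCycle σ i x} : Finset V) = univ := by
      ext y
      simpa using hσ.1.2 (by simp) (by simp)
    rw [hall] at h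
    have := hσ.2.1
    rw [weight, h] at this
    norm_num at this
  · intro σ hσ
    simp only [mem_sdiff, mem_filter, mem_univ, true_and, flippedFullCycles] at hσ
    obtain ⟨hneg, hσ⟩ := hσ
    by_cases hw : weight M σ = 0
    · simp [hw]
    suffices weight s σ = 1 by simp [this]
    by_cases hfull : σ.IsCycleOn (univ : Finset V)
    · have he1 : weight e σ = 1 := by
        rcases he.prod_eq_or univ id σ with h | h
        · exact h
        · obtain ⟨i⟩ := this
          have hall : ({x | SameCycle σ i x} : Finset V) = univ := by
            ext y
            simpa using hfull.2 (by simp) (by simp)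
          have : i ∈ negativePoints e σ := by
            simp only [negativePoints, mem_filter, mem_univ, true_and, hall]
            exact h
          simp [hneg] at this
      rcases hs.prod_eq_or univ id σ with h | h
      · exact h
      · exact absurd ⟨hfull, he1, h⟩ hσ
    · refine weight_eq_one_of_orbits_lt hs he hs1 hshort hneg hw fun i => ?_
      refine lt_of_le_of_ne (card_le_univ _) fun h => hfull ?_
      rw [← (card_eq_iff_eq_univ _).1 h]
      exact isCycleOn_orbit σ i
  · intro σ hσ
    simp only [flippedFullCycles, mem_filter, mem_univ, true_and] at hσ
    rw [sign_of_isCycleOn_univ hV hσ.1, hσ.2.2]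
    push_cast
    ring

end CycleExpansion


/-! ### Cycles as closed sequences of vertices -/

section Sequences

variable {V : Type*} [DecidableEq V] {M e s : V → V → ℝ} {k : ℕ}

theorem exists_isCycleOn_of_closed_sequence (f : ℕ → V) (n : ℕ)
    (hinj : ∀ i j, i < j → j < n → f i ≠ f j) (hclosed : f n = f 0) :
    ∃ c : Perm V, c.IsCycleOn (((range n).image f : Finset V) : Set V) ∧
      ∀ i < n, c (f i) = f (i + 1) := by
  have hnd : ((List.range n).map f).Nodup := by
    refine List.Nodup.map_on ?_ List.nodup_range
    intro i hi j hj hij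
    rw [List.mem_range] at hi hj
    by_contra hne
    rcases lt_or_gt_of_ne hne with h | h
    · exact hinj i j h hj hij
    · exact hinj j i h hi hij.symm
  refine ⟨((List.range n).map f).formPerm, ?_, ?_⟩
  · convert hnd.isCycleOn_formPerm using 1
    ext v
    simp
  · intro i hi
    have h := List.formPerm_apply_getElem _ hnd i (by simpa using hi)
    simp only [List.getElem_map, List.getElem_range, List.length_map, List.length_range] at h
    rw [h]
    rcases Nat.lt_or_ge (i + 1) n with h1 | h1
    · rw [Nat.mod_eq_of_lt h1]
    · have : i + 1 = n := by omega
      rw [this, Nat.mod_self, hclosed]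

theorem PositiveCyclesBelow.of_sequence (h : PositiveCyclesBelow M e s k) {f : ℕ → V} {n : ℕ}
    (hinj : ∀ i j, i < j → j < n → f i ≠ f j) (hclosed : f n = f 0) (hn3 : 3 ≤ n) (hnk : n < k)
    (hM : ∀ i < n, M (f i) (f (i + 1)) ≠ 0) (he : ∏ i ∈ range n, e (f i) (f (i + 1)) = 1) :
    ∏ i ∈ range n, s (f i) (f (i + 1)) = 1 := by
  obtain ⟨c, hc, hcf⟩ := exists_isCycleOn_of_closed_sequence f n hinj hclosed
  have hinj' : Set.InjOn f (range n : Finset ℕ) := by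
    intro i hi j hj hij
    simp only [coe_range, Set.mem_Iio] at hi hj
    by_contra hne
    rcases lt_or_gt_of_ne hne with h | h
    · exact hinj i j h hj hij
    · exact hinj j i h hi hij.symm
  have hprod : ∀ g : V → V → ℝ, ∏ v ∈ (range n).image f, g v (c v) =
      ∏ i ∈ range n, g (f i) (f (i + 1)) := by
    intro g
    rw [prod_image hinj']
    exact prod_congr rfl fun i hi => by rw [hcf i (mem_range.1 hi)]
  have hcard : #((range n).image f) = n := by rw [card_image_of_injOn hinj', card_range]
  rw [← hprod] at he ⊢
  refine h c _ hc (by omega) (by omega) ?_ he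
  intro v hv
  obtain ⟨i, hi, rfl⟩ := mem_image.1 hv
  rw [hcf i (mem_range.1 hi)]
  exact hM i (mem_range.1 hi)

end Sequences

/-! ### Gauging signs along a sequence -/

/-- The partial product of `e` along the sequence `p`. -/
noncomputable def pathSign {V : Type*} (e : V → V → ℝ) (p : ℕ → V) (n : ℕ) : ℝ :=
  ∏ t ∈ range n, e (p t) (p (t + 1))

/-- The table `e` normalized so as to be trivial along the sequence `p`. -/
noncomputable def gauged {V : Type*} (e : V → V → ℝ) (p : ℕ → V) (i j : ℕ) : ℝ :=
  pathSign e p i * pathSign e p j * e (p i) (p j)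

section PathSign

variable {V : Type*} {e : V → V → ℝ} {p : ℕ → V} {k : ℕ}

theorem pathSign_eq_or (he : IsSymmSign e) (p : ℕ → V) (n : ℕ) :
    pathSign e p n = 1 ∨ pathSign e p n = -1 :=
  he.prod_eq_or _ _ _

theorem pathSign_mul_self (he : IsSymmSign e) (p : ℕ → V) (n : ℕ) :
    pathSign e p n * pathSign e p n = 1 := by
  rcases pathSign_eq_or he p n with h | h <;> simp [h]

theorem prod_arc (he : IsSymmSign e) (p : ℕ → V) (a m : ℕ) :
    ∏ t ∈ range m, e (p (a + t)) (p (a + t + 1)) = pathSign e p a * pathSign e p (a + m) := by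
  have : pathSign e p (a + m) =
      pathSign e p a * ∏ t ∈ range m, e (p (a + t)) (p (a + t + 1)) := prod_range_add _ _ _
  rw [this, ← mul_assoc, pathSign_mul_self he, one_mul]

theorem prod_arc_reverse (he : IsSymmSign e) (p : ℕ → V) (a m : ℕ) :
    ∏ t ∈ range m, e (p (a + m - t)) (p (a + m - (t + 1))) =
      pathSign e p a * pathSign e p (a + m) := by
  rw [← prod_arc he, ← prod_range_reflect]
  refine prod_congr rfl fun t ht => ?_
  have := mem_range.1 ht
  rw [he.symm]
  congr 2 <;> omega

theorem gauged_symm (he : IsSymmSign e) (p : ℕ → V) (i j : ℕ) :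
    gauged e p i j = gauged e p j i := by
  rw [gauged, gauged, he.symm (p i)]
  ring

theorem gauged_eq_or (he : IsSymmSign e) (p : ℕ → V) (i j : ℕ) :
    gauged e p i j = 1 ∨ gauged e p i j = -1 := by
  rw [gauged]
  rcases pathSign_eq_or he p i with h | h <;> rcases pathSign_eq_or he p j with h' | h' <;>
    rcases he.eq_or (p i) (p j) with h'' | h'' <;> simp [h, h', h'']

theorem gauged_succ (he : IsSymmSign e) (p : ℕ → V) (i : ℕ) : gauged e p i (i + 1) = 1 := by
  have h : pathSign e p (i + 1) = pathSign e p i * e (p i) (p (i + 1)) := prod_range_succ _ _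
  rw [gauged, h]
  linear_combination e (p i) (p (i + 1)) * e (p i) (p (i + 1)) * pathSign_mul_self he p i +
    he.mul_self (p i) (p (i + 1))

theorem pathSign_add_period (hper : ∀ i, p (i + k) = p i) (n : ℕ) :
    pathSign e p (n + k) = pathSign e p k * pathSign e p n := by
  rw [add_comm, pathSign, prod_range_add]
  congr 1
  refine prod_congr rfl fun t _ => ?_
  rw [add_comm k t, hper, add_right_comm, hper]

theorem gauged_add_period (hper : ∀ i, p (i + k) = p i) (i j : ℕ) :
    gauged e p (i + k) j = pathSign e p k * gauged e p i j := by
  rw [gauged, gauged, pathSign_add_period hper, hper]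
  ring

end PathSign

/-! ### Chords of a flipped cycle -/

/-- `p` enumerates periodically a cycle of length `k` on which `M` does not vanish, with positive
`e`-sign and negative `s`-sign, while all shorter positive cycles have positive `s`-sign. -/
structure IsFlippedCycle {V : Type*} (M e s : V → V → ℝ) (k : ℕ) (p : ℕ → V) : Prop where
  three_le : 3 ≤ k
  sign_e : IsSymmSign e
  sign_s : IsSymmSign s
  entry_symm : ∀ x y, M y x = e x y * M x y
  short : PositiveCyclesBelow M e s k
  periodic : ∀ i, p (i + k) = p i
  inj : ∀ i j, i < j → j < i + k → p i ≠ p j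
  surj : ∀ v, ∃ i < k, p i = v
  adj : ∀ i, M (p i) (p (i + 1)) ≠ 0
  positive : pathSign e p k = 1
  flipped : pathSign s p k = -1

namespace IsFlippedCycle

variable {V : Type*} {M e s : V → V → ℝ} {k : ℕ} {p : ℕ → V}

theorem entry_ne_zero_symm (h : IsFlippedCycle M e s k p) {x y : V} (hxy : M x y ≠ 0) :
    M y x ≠ 0 := by
  rw [h.entry_symm x y]
  refine mul_ne_zero ?_ hxy
  rcases h.sign_e.eq_or x y with h | h <;> simp [h]

theorem gauged_e_add (h : IsFlippedCycle M e s k p) (i j : ℕ) :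
    gauged e p (i + k) j = gauged e p i j := by
  rw [gauged_add_period h.periodic, h.positive, one_mul]

/-- Going once around the cycle costs a sign for `s` but none for `e`. This monodromy is what
contradicts the forbidden chord patterns below. -/
theorem gauged_s_add (h : IsFlippedCycle M e s k p) (i j : ℕ) :
    gauged s p (i + k) j = -gauged s p i j := by
  rw [gauged_add_period h.periodic, h.flipped, neg_one_mul]

/-- The cycle through the arcs from `a` to `a + m` and from `c + r` back to `c`. -/
theorem twoArcCycle (h : IsFlippedCycle M e s k p) (a m c r : ℕ) (hac : a + m < c)
    (hca : c + r < a + k) (h3 : 3 ≤ m + r + 2) (hk : m + r + 2 < k)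
    (h1 : M (p (a + m)) (p (c + r)) ≠ 0) (h2 : M (p c) (p a) ≠ 0)
    (he : gauged e p (a + m) (c + r) * gauged e p c a = 1) :
    gauged s p (a + m) (c + r) * gauged s p c a = 1 := by
  classical
  let f : ℕ → V := fun i =>
    if i ≤ m then p (a + i) else if i ≤ m + 1 + r then p (c + r - (i - (m + 1))) else p a
  have hprod : ∀ g : V → V → ℝ, IsSymmSign g →
      ∏ i ∈ range (m + r + 2), g (f i) (f (i + 1)) =
        gauged g p (a + m) (c + r) * gauged g p c a := by
    intro g hg
    have e1 : m + r + 2 = m + 1 + r + 1 := by omega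
    rw [e1, prod_range_succ, prod_range_add, prod_range_succ]
    have p1 : ∏ i ∈ range m, g (f i) (f (i + 1)) = pathSign g p a * pathSign g p (a + m) := by
      rw [← prod_arc hg]
      refine prod_congr rfl fun i hi => ?_
      have := mem_range.1 hi
      simp only [f, if_pos (show i ≤ m by omega), if_pos (show i + 1 ≤ m by omega), add_assoc]
    have p2 : g (f m) (f (m + 1)) = g (p (a + m)) (p (c + r)) := by
      simp [f]
    have p3 : ∏ t ∈ range r, g (f (m + 1 + t)) (f (m + 1 + t + 1)) =
        pathSign g p c * pathSign g p (c + r) := by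
      rw [← prod_arc_reverse hg]
      refine prod_congr rfl fun i hi => ?_
      have := mem_range.1 hi
      have q1 : f (m + 1 + i) = p (c + r - i) := by
        simp only [f, if_neg (show ¬ m + 1 + i ≤ m by omega),
          if_pos (show m + 1 + i ≤ m + 1 + r by omega)]
        congr 2; omega
      have q2 : f (m + 1 + i + 1) = p (c + r - (i + 1)) := by
        simp only [f, if_neg (show ¬ m + 1 + i + 1 ≤ m by omega),
          if_pos (show m + 1 + i + 1 ≤ m + 1 + r by omega)]
        congr 2; omega
      rw [q1, q2]
    have p4 : g (f (m + 1 + r)) (f (m + 1 + r + 1)) = g (p c) (p a) := by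
      have q1 : f (m + 1 + r) = p c := by
        simp only [f, if_neg (show ¬ m + 1 + r ≤ m by omega), le_refl, if_true]
        congr 1; omega
      have q2 : f (m + 1 + r + 1) = p a := by
        simp only [f, if_neg (show ¬ m + 1 + r + 1 ≤ m by omega),
          if_neg (show ¬ m + 1 + r + 1 ≤ m + 1 + r by omega)]
      rw [q1, q2]
    rw [p1, p2, p3, p4, gauged, gauged]
    ring
  rw [← hprod s h.sign_s]
  rw [← hprod e h.sign_e] at he
  have hidx : ∀ i < m + r + 2, ∃ q, f i = p q ∧
      ((i ≤ m ∧ q = a + i) ∨ (m < i ∧ q + i = c + r + m + 1)) := by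
    intro i hi
    rcases le_or_gt i m with him | him
    · exact ⟨a + i, by simp only [f, if_pos him], Or.inl ⟨him, rfl⟩⟩
    · refine ⟨c + r - (i - (m + 1)), ?_, Or.inr ⟨him, by omega⟩⟩
      simp only [f, if_neg (not_le.2 him), if_pos (show i ≤ m + 1 + r by omega)]
  refine h.short.of_sequence ?_ ?_ h3 hk ?_ he
  · intro i j hij hj hfij
    obtain ⟨q, hq, hq'⟩ := hidx i (by omega)
    obtain ⟨q2, hq2, hq2'⟩ := hidx j hj
    rw [hq, hq2] at hfij
    rcases lt_trichotomy q q2 with hlt | heq | hlt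
    · exact h.inj q q2 hlt (by omega) hfij
    · omega
    · exact h.inj q2 q hlt (by omega) hfij.symm
  · simp only [f, if_neg (show ¬ m + r + 2 ≤ m by omega),
      if_neg (show ¬ m + r + 2 ≤ m + 1 + r by omega), Nat.zero_le, if_true, add_zero]
  · intro i hi
    rcases lt_or_ge i m with him | him
    · simp only [f, if_pos him.le, if_pos (show i + 1 ≤ m by omega)]
      exact h.adj (a + i)
    rcases eq_or_lt_of_le him with rfl | him
    · simpa [f] using h1
    rcases eq_or_lt_of_le (show i ≤ m + 1 + r by omega) with rfl | hi2
    · have q1 : f (m + 1 + r) = p c := by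
        simp only [f, if_neg (show ¬ m + 1 + r ≤ m by omega), le_refl, if_true]
        congr 1; omega
      have q2 : f (m + 1 + r + 1) = p a := by
        simp only [f, if_neg (show ¬ m + 1 + r + 1 ≤ m by omega),
          if_neg (show ¬ m + 1 + r + 1 ≤ m + 1 + r by omega)]
      rw [q1, q2]
      exact h2
    · simp only [f, if_neg (show ¬ i ≤ m by omega), if_neg (show ¬ i + 1 ≤ m by omega),
        if_pos (show i ≤ m + 1 + r by omega), if_pos (show i + 1 ≤ m + 1 + r by omega)]
      have q1 : c + r - (i - (m + 1)) = c + r - (i + 1 - (m + 1)) + 1 := by omega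
      rw [q1]
      exact h.entry_ne_zero_symm (h.adj _)

theorem twoArcCycle' (h : IsFlippedCycle M e s k p) {a b c d : ℕ} (hab : a ≤ b) (hbc : b < c)
    (hcd : c ≤ d) (hda : d < a + k) (h3 : a + c < b + d + 2)
    (hk : b + d + 2 < a + c + k) (h1 : M (p b) (p d) ≠ 0) (h2 : M (p c) (p a) ≠ 0)
    (he : gauged e p b d * gauged e p c a = 1) : gauged s p b d * gauged s p c a = 1 := by
  obtain ⟨m, rfl⟩ := Nat.exists_eq_add_of_le hab
  obtain ⟨r, rfl⟩ := Nat.exists_eq_add_of_le hcd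
  -- With both arcs reduced to points the two chords coincide, so the product is a square and no
  -- cycle is needed.
  rcases Nat.lt_or_ge (m + r) 1 with h0 | h0
  · obtain ⟨rfl, rfl⟩ : m = 0 ∧ r = 0 := by omega
    rw [Nat.add_zero, Nat.add_zero, gauged_symm h.sign_s p c a]
    rcases gauged_eq_or h.sign_s p a c with h | h <;> simp [h]
  · exact h.twoArcCycle a m c r hbc hda (by omega) (by omega) h1 h2 he

/-- A chord splits the cycle into two negative cycles. -/
theorem gauged_chord (h : IsFlippedCycle M e s k p) {a c : ℕ} (h1 : a + 2 ≤ c)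
    (h2 : c + 2 ≤ a + k) (hM : M (p a) (p c) ≠ 0) : gauged e p a c = -1 := by
  rcases gauged_eq_or h.sign_e p a c with he | he
  swap
  · exact he
  exfalso
  have h3 := h.three_le
  -- The cycle closed by the chord and one arc is shorter than `k`, so if it is positive its
  -- `s`-sign is one. Applied to both arcs, this gives the chord the same gauged sign twice,
  -- although one of the arcs passes the period and should negate it.
  have key : ∀ a c, a + 2 ≤ c → c + 2 ≤ a + k → M (p a) (p c) ≠ 0 → gauged e p a c = 1 →
      gauged s p a c = 1 := by
    intro a c h1 h2 hM he
    obtain ⟨c, rfl⟩ : ∃ b, c = b + 1 := ⟨c - 1, by omega⟩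
    have := h.twoArcCycle' (a := a) (b := c) (c := c + 1) (d := c + 1) (by omega) (by omega) le_rfl
      (by omega) (by omega) (by omega) (h.adj c) (h.entry_ne_zero_symm hM)
      (by rw [gauged_succ h.sign_e, one_mul, gauged_symm h.sign_e, he])
    rwa [gauged_succ h.sign_s, one_mul, gauged_symm h.sign_s] at this
  have k1 := key a c h1 h2 hM he
  have k2 := key c (a + k) (by omega) (by omega)
    (by rw [h.periodic]; exact h.entry_ne_zero_symm hM)
    (by rw [gauged_symm h.sign_e, h.gauged_e_add, he])
  rw [gauged_symm h.sign_s, h.gauged_s_add, k1] at k2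
  norm_num at k2

/-- The two chords together with the arcs from `a` to `b` and from `c` to `d` form a cycle. Both
chords have gauged charge -1, so it is positive, and `hk` says that it misses a vertex of the long
cycle. -/
theorem gauged_s_crossing (h : IsFlippedCycle M e s k p) {a b c d : ℕ} (hab : a < b) (hbc : b < c)
    (hcd : c < d) (hda : d < a + k) (h1 : M (p a) (p c) ≠ 0) (h2 : M (p b) (p d) ≠ 0)
    (hk : b + d + 2 < a + c + k) : gauged s p a c = gauged s p b d := by
  have := h.twoArcCycle' hab.le hbc hcd.le hda (by omega) hk h2 (h.entry_ne_zero_symm h1)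
    (by rw [h.gauged_chord (by omega) (by omega) h2, gauged_symm h.sign_e,
          h.gauged_chord (by omega) (by omega) h1]; norm_num)
  rw [gauged_symm h.sign_s p c a] at this
  rcases gauged_eq_or h.sign_s p a c with h | h <;> rw [h] at this ⊢ <;> linarith

/-- Two crossing chords join the ends of two edges of the cycle. -/
theorem crossing (h : IsFlippedCycle M e s k p) {a b c d : ℕ} (hab : a < b) (hbc : b < c)
    (hcd : c < d) (hda : d < a + k) (h1 : M (p a) (p c) ≠ 0) (h2 : M (p b) (p d) ≠ 0) :
    (b = a + 1 ∧ d = c + 1) ∨ (c = b + 1 ∧ d + 1 = a + k) := by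
  by_contra hcon
  -- The chords can be joined by either pair of opposite arcs. Each alternative of the conclusion is
  -- the case in which one of the two resulting cycles misses no vertex. If neither holds, both are
  -- short, and they demand opposite relations between the gauged signs, since the second passes the
  -- period.
  have k1 := h.gauged_s_crossing hab hbc hcd hda h1 h2 (by omega)
  have k2 := h.gauged_s_crossing hbc hcd hda (by omega) h2
    (by rw [h.periodic]; exact h.entry_ne_zero_symm h1) (by omega)
  rw [gauged_symm h.sign_s p c, h.gauged_s_add, k1] at k2
  rcases gauged_eq_or h.sign_s p b d with h | h <;> rw [h] at k2 <;> norm_num at k2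

/-- The crossings make the gauged signs of all three chords equal. But the outer two chords replace
four consecutive edges, giving a shorter positive cycle that passes the period; its sign forces
those two chords to differ. -/
theorem not_three_short_chords (h : IsFlippedCycle M e s k p) (hk : 5 ≤ k) (a : ℕ)
    (h1 : M (p a) (p (a + 2)) ≠ 0) (h2 : M (p (a + 1)) (p (a + 3)) ≠ 0)
    (h3 : M (p (a + 2)) (p (a + 4)) ≠ 0) : False := by
  have k1 := h.gauged_s_crossing (a := a) (b := a + 1) (c := a + 2) (d := a + 3) (by omega)
    (by omega) (by omega) (by omega) h1 h2 (by omega)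
  have k2 := h.gauged_s_crossing (a := a + 1) (b := a + 2) (c := a + 3) (d := a + 4) (by omega)
    (by omega) (by omega) (by omega) h2 h3 (by omega)
  have e1 := h.gauged_chord (a := a) (c := a + 2) (by omega) (by omega) h1
  have e3 := h.gauged_chord (a := a + 2) (c := a + 4) (by omega) (by omega) h3
  have p2 : p (a + k + 2) = p (a + 2) := by rw [add_right_comm, h.periodic]
  have hg2 : ∀ j, gauged s p (a + k + 2) j = -gauged s p (a + 2) j := fun j => by
    rw [add_right_comm, h.gauged_s_add]
  have hg3 : ∀ j, gauged e p (a + k + 2) j = gauged e p (a + 2) j := fun j => by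
    rw [add_right_comm, h.gauged_e_add]
  have k3 := h.twoArcCycle' (a := a + 4) (b := a + k) (c := a + k + 2) (d := a + k + 2) (by omega)
    (by omega) le_rfl (by omega) (by omega) (by omega) (by rw [p2, h.periodic]; exact h1)
    (by rw [p2]; exact h3)
    (by rw [gauged_symm h.sign_e p (a + k), hg3, hg3, gauged_symm h.sign_e, h.gauged_e_add, e1, e3]
        norm_num)
  rw [gauged_symm h.sign_s p (a + k), hg2, hg2, gauged_symm h.sign_s, h.gauged_s_add, k1, k2] at k3
  rcases gauged_eq_or h.sign_s p (a + 2) (a + 4) with h | h <;> rw [h] at k3 <;> norm_num at k3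

/-- Successive crossings propagate the gauged sign from one diameter to the next; after half a turn
the first diameter reappears with the opposite sign. -/
theorem not_three_diameters (h : IsFlippedCycle M e s k p) (hk : k = 6)
    (h1 : M (p 0) (p 3) ≠ 0) (h2 : M (p 1) (p 4) ≠ 0) (h3 : M (p 2) (p 5) ≠ 0) : False := by
  have k1 := h.gauged_s_crossing (a := 0) (b := 1) (c := 3) (d := 4) (by omega)
    (by omega) (by omega) (by omega) h1 h2 (by omega)
  have k2 := h.gauged_s_crossing (a := 1) (b := 2) (c := 4) (d := 5) (by omega)
    (by omega) (by omega) (by omega) h2 h3 (by omega)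
  have p6 : p 6 = p 0 := by have := h.periodic 0; rwa [hk] at this
  have k3 := h.gauged_s_crossing (a := 2) (b := 3) (c := 5) (d := 6) (by omega)
    (by omega) (by omega) (by omega) h3 (by rw [p6]; exact h.entry_ne_zero_symm h1) (by omega)
  have k4 := h.gauged_s_add 0 3
  rw [hk] at k4
  rw [gauged_symm h.sign_s p 3, k4, ← k2, ← k1] at k3
  rcases gauged_eq_or h.sign_s p 0 3 with h | h <;> rw [h] at k3 <;> norm_num at k3

/-- The edges between the two sides of a pair of crossing chords. -/
theorem edges_across (h : IsFlippedCycle M e s k p) (hk : 5 ≤ k) {c : ℕ} (hc : 2 ≤ c)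
    (hck : c + 1 < k) (h1 : M (p 0) (p c) ≠ 0) (h2 : M (p 1) (p (c + 1)) ≠ 0) {u v : ℕ}
    (hu : 1 ≤ u) (huc : u ≤ c) (hcv : c < v) (hv : v ≤ k) (huv : M (p u) (p v) ≠ 0) :
    (u = 1 ∨ u = c) ∧ (v = c + 1 ∨ v = k) := by
  have p0 : p k = p 0 := by have := h.periodic 0; rwa [zero_add] at this
  have p1 : p (k + 1) = p 1 := by have := h.periodic 1; rwa [add_comm] at this
  have p2 : p (k + 2) = p 2 := by have := h.periodic 2; rwa [add_comm] at this
  -- A further edge between the two sides would cross one of the given chords, and by `crossing` it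
  -- would have to lie right next to it. Each possibility completes three consecutive short chords
  -- or, for `k = 6`, the three diameters.
  by_contra hcon
  rcases eq_or_lt_of_le huc with rfl | huc
  · have hv' : u + 1 < v ∧ v < k := by omega
    have := h.crossing (a := 1) (b := u) (c := u + 1) (d := v) (by omega) (by omega) (by omega)
      (by omega) h2 huv
    obtain ⟨rfl, rfl⟩ : u = 2 ∧ v = 4 := by omega
    exact h.not_three_short_chords hk 0 h1 h2 huv
  rcases eq_or_lt_of_le hv with rfl | hv
  · have := h.crossing (a := 1) (b := u) (c := c + 1) (d := v) (by omega) (by omega) (by omega)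
      (by omega) h2 huv
    obtain ⟨rfl, rfl⟩ : u = 2 ∧ v = c + 2 := by omega
    refine h.not_three_short_chords hk c ?_ ?_ ?_
    · rw [p0]; exact h.entry_ne_zero_symm h1
    · rw [show c + 3 = c + 2 + 1 by omega, p1]; exact h.entry_ne_zero_symm h2
    · rw [show c + 4 = c + 2 + 2 by omega, p2]; exact h.entry_ne_zero_symm huv
  · have := h.crossing (a := 0) (b := u) (c := c) (d := v) (by omega) (by omega) (by omega)
      (by omega) h1 huv
    obtain ⟨rfl, rfl⟩ : c = u + 1 ∧ k = v + 1 := by omega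
    rcases eq_or_lt_of_le hu with rfl | hu
    · refine h.not_three_short_chords hk v ?_ ?_ ?_
      · rw [show v + 2 = v + 1 + 1 by omega, p1]; exact h.entry_ne_zero_symm huv
      · rw [p0, show v + 3 = v + 1 + 2 by omega, p2]; exact h1
      · rw [show v + 2 = v + 1 + 1 by omega, p1, show v + 4 = 3 + (v + 1) by omega, h.periodic]
        exact h2
    · rcases eq_or_lt_of_le (Nat.succ_le_of_lt hcv) with rfl | hcv
      · refine h.not_three_short_chords hk u huv ?_ ?_
        · rw [show u + 3 = u + 1 + 1 + 1 by omega, p0]; exact h.entry_ne_zero_symm h1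
        · rw [show u + 4 = u + 1 + 1 + 1 + 1 by omega, p1]; exact h.entry_ne_zero_symm h2
      · have := h.crossing (a := 1) (b := u) (c := u + 1 + 1) (d := v) (by omega) (by omega)
          (by omega) (by omega) h2 huv
        obtain ⟨rfl, rfl⟩ : u = 2 ∧ v = 5 := by omega
        exact h.not_three_diameters rfl h1 h2 huv

end IsFlippedCycle


/-! ### Hamiltonian cycles when no chords cross -/

section FullCycles

variable {V : Type*} [Fintype V] [DecidableEq V] {M e s : V → V → ℝ}

theorem mem_of_closed {σ : Perm V} (hσ : σ.IsCycleOn (univ : Finset V)) {A : Set V}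
    (hne : A.Nonempty) (hA : ∀ v ∈ A, σ v ∈ A) (v : V) : v ∈ A := by
  obtain ⟨a, ha⟩ := hne
  obtain ⟨n, -, rfl⟩ := hσ.exists_pow_eq (mem_univ a) (mem_univ v)
  induction n with
  | zero => exact ha
  | succ n ih =>
    rw [pow_succ', Perm.mul_apply]
    exact hA _ ih

theorem exists_exit {σ : Perm V} (hσ : σ.IsCycleOn (univ : Finset V)) {A : Set V}
    (hne : A.Nonempty) {v : V} (hv : v ∉ A) : ∃ u ∈ A, σ u ∉ A := by
  by_contra! h
  exact hv (mem_of_closed hσ hne h v)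

theorem pow_apply_ne_of_lt {σ : Perm V} (hσ : σ.IsCycleOn (univ : Finset V)) (v : V) {n : ℕ}
    (hn : ¬ Fintype.card V ∣ n) : (σ ^ n) v ≠ v := fun h =>
  hn ((hσ.pow_apply_eq (mem_univ v)).1 h)

theorem pow_apply_inj {σ : Perm V} (hσ : σ.IsCycleOn (univ : Finset V)) (v : V) {i j : ℕ}
    (hij : i < j) (hj : j < i + Fintype.card V) : (σ ^ i) v ≠ (σ ^ j) v := by
  intro h
  rw [hσ.pow_apply_eq_pow_apply (mem_univ v)] at h
  have := Nat.le_of_dvd (by omega) ((Nat.modEq_iff_dvd' hij.le).1 h)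
  rw [card_univ] at this
  omega

theorem pow_add_card_apply {σ : Perm V} (hσ : σ.IsCycleOn (univ : Finset V)) (v : V) (i : ℕ) :
    (σ ^ (i + Fintype.card V)) v = (σ ^ i) v := by
  rw [pow_add, Perm.mul_apply]
  congr 1
  exact hσ.pow_card_apply (mem_univ v)

theorem weight_eq_prod_range {σ : Perm V} (hσ : σ.IsCycleOn (univ : Finset V)) (v : V)
    (g : V → V → ℝ) :
    weight g σ = ∏ i ∈ range (Fintype.card V), g ((σ ^ i) v) ((σ ^ (i + 1)) v) := by
  symm
  refine Finset.prod_bij (fun i _ => (σ ^ i) v) (fun _ _ => mem_univ _) ?_ ?_ ?_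
  · intro i hi j hj hij
    rw [mem_range] at hi hj
    by_contra hne
    rcases lt_or_gt_of_ne hne with h | h
    · exact pow_apply_inj hσ v h (by omega) hij
    · exact pow_apply_inj hσ v h (by omega) hij.symm
  · intro b _
    obtain ⟨n, hn, hb⟩ := hσ.exists_pow_eq (mem_univ v) (mem_univ b)
    exact ⟨n, by simpa using hn, hb⟩
  · intro i _
    rw [pow_succ', Perm.mul_apply]

theorem mem_flippedFullCycles {σ : Perm V} : σ ∈ flippedFullCycles e s ↔
    σ.IsCycleOn (univ : Finset V) ∧ weight e σ = 1 ∧ weight s σ = -1 := by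
  simp [flippedFullCycles]

/-- The standing assumptions on the matrix `M`, the charges `e` and the sign change `s`. -/
structure IsGenericSystem (M e s : V → V → ℝ) : Prop where
  sign_e : IsSymmSign e
  sign_s : IsSymmSign s
  entry_symm : ∀ x y, M y x = e x y * M x y
  short : PositiveCyclesBelow M e s (Fintype.card V)
  generic : ∀ i j k l : V, i ≠ j → i ≠ k → i ≠ l → j ≠ k → j ≠ l → k ≠ l →
    M i j * M j k * M k l * M l i ≠ 0 → |M i j * M k l| ≠ |M j k * M l i|
  three_le : 3 ≤ Fintype.card V

theorem IsGenericSystem.isFlippedCycle (h : IsGenericSystem M e s) {σ : Perm V}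
    (hσ : σ ∈ flippedFullCycles e s) (hw : weight M σ ≠ 0) (v : V) :
    IsFlippedCycle M e s (Fintype.card V) (fun i => (σ ^ i) v) := by
  obtain ⟨hσ, he, hs⟩ := mem_flippedFullCycles.1 hσ
  refine ⟨h.three_le, h.sign_e, h.sign_s, h.entry_symm, h.short, pow_add_card_apply hσ v,
    fun i j => pow_apply_inj hσ v, ?_, ?_, ?_, ?_⟩
  · intro u
    obtain ⟨n, hn, hb⟩ := hσ.exists_pow_eq (mem_univ v) (mem_univ u)
    exact ⟨n, by simpa using hn, hb⟩
  · intro i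
    simp only [pow_succ', Perm.mul_apply]
    exact prod_ne_zero_iff.1 hw _ (mem_univ _)
  · rw [pathSign, ← weight_eq_prod_range hσ, he]
  · rw [pathSign, ← weight_eq_prod_range hσ, hs]

theorem weight_inv (hM : ∀ x y, M y x = e x y * M x y) (σ : Perm V) :
    weight M σ⁻¹ = weight e σ * weight M σ := by
  rw [weight, weight, weight, ← prod_mul_distrib, ← Equiv.prod_comp σ]
  refine prod_congr rfl fun v _ => ?_
  rw [← hM]
  simp

/-- Without crossing chords, a full cycle through edges is the given one or its inverse. -/
theorem IsFlippedCycle.full_cycle_unique {k : ℕ} {p : ℕ → V} (h : IsFlippedCycle M e s k p)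
    (hk : k = Fintype.card V)
    (hnc : ∀ a b c d, a < b → b < c → c < d → d < a + k → M (p a) (p c) ≠ 0 →
      M (p b) (p d) = 0) {σ τ : Perm V} (hσ : ∀ i, σ (p i) = p (i + 1))
    (hτ : τ.IsCycleOn (univ : Finset V)) (hw : weight M τ ≠ 0) : τ = σ ∨ τ = σ⁻¹ := by
  have h3 := h.three_le
  have hadj : ∀ v, M v (τ v) ≠ 0 := fun v => prod_ne_zero_iff.1 hw _ (mem_univ _)
  have hrep : ∀ a v, ∃ c, a ≤ c ∧ c < a + k ∧ p c = v := by
    intro a v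
    induction a with
    | zero =>
      obtain ⟨c, hc, hv⟩ := h.surj v
      exact ⟨c, by omega, by omega, hv⟩
    | succ a ih =>
      obtain ⟨c, hc1, hc2, hv⟩ := ih
      rcases eq_or_lt_of_le hc1 with rfl | hlt
      · exact ⟨a + k, by omega, by omega, by rw [h.periodic, hv]⟩
      · exact ⟨c, by omega, by omega, hv⟩
  have hτ1 : ∀ v, τ v ≠ v := fun v => pow_apply_ne_of_lt hτ v (n := 1) (by
    intro hd; have := Nat.le_of_dvd one_pos hd; omega)
  have hτ2 : ∀ v, τ (τ v) ≠ v := fun v => pow_apply_ne_of_lt hτ v (n := 2) (by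
    intro hd; have := Nat.le_of_dvd two_pos hd; omega)
  have hstep : ∀ a, τ (p a) = p (a + 1) ∨ τ (p a) = p (a + k - 1) := by
    intro a
    obtain ⟨c, hac, hck, hc⟩ := hrep a (τ (p a))
    have hac : a < c := lt_of_le_of_ne hac fun heq => hτ1 (p a) (by rw [← hc, heq])
    by_cases h1 : c = a + 1
    · left; rw [← hc, h1]
    by_cases h2 : c = a + k - 1
    · right; rw [← hc, h2]
    exfalso
    have hMac : M (p a) (p c) ≠ 0 := by rw [hc]; exact hadj _
    -- Suppose that `τ` jumps along the chord from `p a` to `p c`. No edge crosses this chord, so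
    -- `τ` can leave either open arc only through its ends. Since `p c` is already the image of `p
    -- a`, both arcs must be left towards `p a`, which contradicts injectivity.
    have harc : ∀ A : Set ℕ, A.Nonempty → (∀ i ∈ A, a < i ∧ i < a + k) →
        (∀ i ∈ A, ∀ j, a < j → j < a + k → j ≠ c → j ∉ A → M (p i) (p j) = 0) → c ∉ A →
        ∃ i ∈ A, τ (p i) = p a := by
      intro A hA hA1 hA2 hcA
      obtain ⟨i0, hi0⟩ := hA
      obtain ⟨u, ⟨i, hi, rfl⟩, hu⟩ := exists_exit hτ (A := p '' A) ⟨p i0, i0, hi0, rfl⟩ (v := p a)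
        (by rintro ⟨j, hj, hja⟩
            exact h.inj a j (hA1 j hj).1 (hA1 j hj).2 hja.symm)
      obtain ⟨j, hj1, hj2, hj⟩ := hrep a (τ (p i))
      refine ⟨i, hi, ?_⟩
      rcases eq_or_lt_of_le hj1 with rfl | hj1
      · exact hj.symm
      exfalso
      by_cases hjc : j = c
      · subst hjc
        rw [hj] at hc
        have := τ.injective hc
        exact h.inj a i (hA1 i hi).1 (hA1 i hi).2 this.symm
      · refine hadj (p i) ?_
        rw [← hj]
        exact hA2 i hi j hj1 hj2 hjc fun hjA => hu ⟨j, hjA, hj⟩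
    obtain ⟨i, hi, hia⟩ := harc {i | a < i ∧ i < c} ⟨a + 1, by simp; omega⟩
      (fun i hi => ⟨hi.1, by have := hi.2; omega⟩)
      (fun i hi j hj1 hj2 hjc hjA => hnc a i c j hi.1 hi.2
        (by simp only [Set.mem_ofPred_eq] at hjA; omega) hj2 hMac) (by simp)
    obtain ⟨j, hj, hja⟩ := harc {i | c < i ∧ i < a + k} ⟨c + 1, by simp; omega⟩
      (fun i hi => ⟨by have := hi.1; omega, hi.2⟩)
      (fun i hi j hj1 hj2 hjc hjA => by
        have := hnc a j c i hj1 (by simp only [Set.mem_ofPred_eq] at hjA; omega) hi.1 hi.2 hMac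
        rw [h.entry_symm, this, mul_zero]) (by simp)
    have := τ.injective (hia.trans hja.symm)
    simp only [Set.mem_ofPred_eq] at hi hj
    exact h.inj i j (by omega) (by omega) this
  -- A backward step right after a forward one would give an orbit of length two, so a direction
  -- once taken persists.
  have hforward : ∀ a, τ (p a) = p (a + 1) → ∀ n, τ (p (a + n)) = p (a + n + 1) := by
    intro a ha n
    induction n with
    | zero => exact ha
    | succ n ih =>
      rcases hstep (a + n + 1) with h1 | h1
      · exact h1
      · exfalso
        refine hτ2 (p (a + n)) ?_
        rw [ih, h1, show a + n + 1 + k - 1 = a + n + k by omega, h.periodic]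
  by_cases h0 : τ (p 0) = p 1
  · left
    ext v
    obtain ⟨i, -, rfl⟩ := h.surj v
    rw [hσ]
    have := hforward 0 h0 i
    rwa [zero_add] at this
  · right
    have hmul : ∀ a, τ (p (a + 1)) = p a := by
      intro a
      rcases hstep (a + 1) with h1 | h1
      · exfalso
        have hpk : ∀ n, p (n * k) = p 0 := by
          intro n
          induction n with
          | zero => simp
          | succ n ih => rw [Nat.succ_mul, h.periodic, ih]
        have hpk1 : ∀ n, p (n * k + 1) = p 1 := by
          intro n
          induction n with
          | zero => simp
          | succ n ih => rw [Nat.succ_mul, add_right_comm, h.periodic, ih]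
        -- A forward step anywhere would persist up to the index `(a + 1) * k`, which is again the
        -- vertex `p 0`.
        have hle : a + 1 ≤ (a + 1) * k := Nat.le_mul_of_pos_right _ (by omega)
        have := hforward (a + 1) h1 ((a + 1) * k - (a + 1))
        rw [show a + 1 + ((a + 1) * k - (a + 1)) = (a + 1) * k by omega, hpk, hpk1] at this
        exact h0 this
      · rw [h1, show a + 1 + k - 1 = a + k by omega, h.periodic]
    rw [eq_inv_iff_mul_eq_one]
    ext v
    obtain ⟨i, -, rfl⟩ := h.surj v
    rw [Perm.mul_apply, hσ, hmul, Perm.one_apply]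

/-- All nonzero terms belong to `σ` or its inverse, and these have the same weight because the
`e`-sign is one. The sum is thus a positive multiple of `weight M σ`. -/
theorem IsGenericSystem.sum_ne_zero_of_no_crossing (h : IsGenericSystem M e s) {σ : Perm V}
    (hσ : σ ∈ flippedFullCycles e s) (hw : weight M σ ≠ 0) (v : V)
    (hnc : ∀ a b c d, a < b → b < c → c < d → d < a + Fintype.card V →
      M ((σ ^ a) v) ((σ ^ c) v) ≠ 0 → M ((σ ^ b) v) ((σ ^ d) v) = 0) :
    ∑ τ ∈ flippedFullCycles e s, weight M τ ≠ 0 := by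
  classical
  have hkey : ∀ τ ∈ flippedFullCycles e s,
      weight M τ = (if weight M τ = 0 then 0 else 1) * weight M σ := by
    intro τ hτ
    split_ifs with h0
    · rw [h0, zero_mul]
    · rw [one_mul]
      rcases (h.isFlippedCycle hσ hw v).full_cycle_unique rfl hnc (σ := σ) (τ := τ)
        (fun i => by rw [pow_succ', Perm.mul_apply]) (mem_flippedFullCycles.1 hτ).1 h0 with rfl | rfl
      · rfl
      · rw [weight_inv h.entry_symm, (mem_flippedFullCycles.1 hσ).2.1, one_mul]
  rw [sum_congr rfl hkey, ← sum_mul]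
  refine mul_ne_zero (ne_of_gt ?_) hw
  refine sum_pos' (fun τ _ => by split_ifs <;> norm_num) ⟨σ, hσ, by simp [hw]⟩

end FullCycles

/-! ### Four vertices with both diagonals -/

section FourVertices

variable {V : Type*} [Fintype V] [DecidableEq V] {M e s : V → V → ℝ}

/-- A decidable form of being a full cycle, so that the six of them can be enumerated by evaluation.
-/
theorem isCycleOn_univ_fin_four (σ : Perm (Fin 4)) :
    σ.IsCycleOn ((univ : Finset (Fin 4)) : Set (Fin 4)) ↔ ∀ i, ∃ n < 4, (σ ^ n) 0 = i := by
  constructor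
  · intro h i
    exact h.exists_pow_eq (mem_univ 0) (mem_univ i)
  · intro h
    refine ⟨by simpa using σ.bijective, fun i _ j _ => ?_⟩
    obtain ⟨n, -, rfl⟩ := h i
    obtain ⟨m, -, rfl⟩ := h j
    exact (SameCycle.refl σ 0).pow_left.pow_right

/-- The `4`-cycle `0 → a → b → c → 0`. -/
def fourCycle (a b c : Fin 4) : Perm (Fin 4) := swap 0 c * swap 0 b * swap 0 a

theorem filter_full_cycles_fin_four :
    ({σ | ∀ i, ∃ n < 4, (σ ^ n) 0 = i} : Finset (Perm (Fin 4))) =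
      {fourCycle 1 2 3, fourCycle 3 2 1, fourCycle 1 3 2, fourCycle 2 3 1, fourCycle 2 1 3,
        fourCycle 3 1 2} := by
  decide +kernel

theorem sum_full_cycles_fin_four (f : Perm (Fin 4) → ℝ) :
    ∑ σ : Perm (Fin 4) with ∀ i, ∃ n < 4, (σ ^ n) 0 = i, f σ =
      f (fourCycle 1 2 3) + f (fourCycle 3 2 1) + f (fourCycle 1 3 2) + f (fourCycle 2 3 1) +
        f (fourCycle 2 1 3) + f (fourCycle 3 1 2) := by
  rw [filter_full_cycles_fin_four]
  rw [sum_insert (by decide), sum_insert (by decide), sum_insert (by decide),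
    sum_insert (by decide), sum_insert (by decide), sum_singleton]
  ring

end FourVertices


section FourVertices

variable {V : Type*} [Fintype V] [DecidableEq V] {M e s : V → V → ℝ}

theorem isCycleOn_univ_permCongr {W : Type*} [Fintype W] (q : W ≃ V) (σ : Perm W) :
    (q.permCongr σ).IsCycleOn ((univ : Finset V) : Set V) ↔
      σ.IsCycleOn ((univ : Finset W) : Set W) := by
  have hpow : ∀ (n : ℤ) x, ((q.permCongr σ) ^ n) (q x) = q ((σ ^ n) x) := by
    intro n x
    have := map_zpow q.permCongrHom σ n
    change q.permCongr (σ ^ n) = (q.permCongr σ) ^ n at this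
    rw [← this]
    simp [Equiv.permCongr_apply]
  constructor
  · intro h
    refine ⟨by simp, fun i _ j _ => ?_⟩
    obtain ⟨n, hn⟩ := h.2 (mem_univ (q i)) (mem_univ (q j))
    exact ⟨n, q.injective (by rw [← hpow, hn])⟩
  · intro h
    refine ⟨by simp, fun i _ j _ => ?_⟩
    obtain ⟨n, hn⟩ := h.2 (mem_univ (q.symm i)) (mem_univ (q.symm j))
    refine ⟨n, ?_⟩
    have := hpow n (q.symm i)
    rwa [hn, q.apply_symm_apply, q.apply_symm_apply] at this

theorem weight_permCongr {W : Type*} [Fintype W] (q : W ≃ V) (g : V → V → ℝ) (σ : Perm W) :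
    weight g (q.permCongr σ) = weight (fun i j => g (q i) (q j)) σ := by
  rw [weight, weight, ← Equiv.prod_comp q]
  simp [Equiv.permCongr_apply]

open Classical in
theorem sum_flippedFullCycles_congr {W : Type*} [Fintype W] (q : W ≃ V) :
    ∑ σ ∈ flippedFullCycles e s, weight M σ =
      ∑ σ : Perm W with σ.IsCycleOn ((univ : Finset W) : Set W),
        if weight (fun i j => e (q i) (q j)) σ = 1 ∧ weight (fun i j => s (q i) (q j)) σ = -1
        then weight (fun i j => M (q i) (q j)) σ else 0 := by
  rw [← sum_filter, filter_filter]
  symm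
  refine sum_equiv q.permCongr ?_ ?_
  · intro σ
    rw [mem_flippedFullCycles, isCycleOn_univ_permCongr, weight_permCongr, weight_permCongr]
    simp
  · intro σ _
    rw [weight_permCongr]

theorem weight_fourCycle (g : Fin 4 → Fin 4 → ℝ) :
    weight g (fourCycle 1 2 3) = g 0 1 * g 1 2 * g 2 3 * g 3 0 ∧
    weight g (fourCycle 3 2 1) = g 0 3 * g 1 0 * g 2 1 * g 3 2 ∧
    weight g (fourCycle 1 3 2) = g 0 1 * g 1 3 * g 2 0 * g 3 2 ∧
    weight g (fourCycle 2 3 1) = g 0 2 * g 1 0 * g 2 3 * g 3 1 ∧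
    weight g (fourCycle 2 1 3) = g 0 2 * g 1 3 * g 2 1 * g 3 0 ∧
    weight g (fourCycle 3 1 2) = g 0 3 * g 1 2 * g 2 0 * g 3 1 := by
  refine ⟨?_, ?_, ?_, ?_, ?_, ?_⟩ <;> rw [weight, Fin.prod_univ_four] <;> rfl

theorem four_sum_ne_zero {m e s : Fin 4 → Fin 4 → ℝ} (he : IsSymmSign e) (hs : IsSymmSign s)
    (hm : ∀ x y, m y x = e x y * m x y) (hm0 : ∀ x y, x ≠ y → m x y ≠ 0)
    (hgen : ∀ i j k l, i ≠ j → i ≠ k → i ≠ l → j ≠ k → j ≠ l → k ≠ l →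
      |m i j * m k l| ≠ |m j k * m l i|)
    (he1 : weight e (fourCycle 1 2 3) = 1) (hs1 : weight s (fourCycle 1 2 3) = -1) :
    (∑ σ : Perm (Fin 4) with ∀ i, ∃ n < 4, (σ ^ n) 0 = i,
      if weight e σ = 1 ∧ weight s σ = -1 then weight m σ else 0) ≠ 0 := by
  classical
  -- Inverse cycles contribute equally, which leaves three terms, each counted twice.
  have hrev : ∀ {σ τ : Perm (Fin 4)}, σ⁻¹ = τ →
      (if weight e τ = 1 ∧ weight s τ = -1 then weight m τ else 0) =
        if weight e σ = 1 ∧ weight s σ = -1 then weight m σ else 0 := by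
    rintro σ _ rfl
    have h1 : weight e σ⁻¹ = weight e σ := by
      rw [weight_inv (e := fun _ _ => 1) (fun x y => by rw [one_mul, he.symm])]
      simp [weight]
    have h2 : weight s σ⁻¹ = weight s σ := by
      rw [weight_inv (e := fun _ _ => 1) (fun x y => by rw [one_mul, hs.symm])]
      simp [weight]
    rw [h1, h2, weight_inv hm]
    split_ifs with h
    · rw [h.1, one_mul]
    · rfl
  rw [sum_full_cycles_fin_four, hrev (σ := fourCycle 1 2 3) (τ := fourCycle 3 2 1) (by decide),
    hrev (σ := fourCycle 1 3 2) (τ := fourCycle 2 3 1) (by decide),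
    hrev (σ := fourCycle 2 1 3) (τ := fourCycle 3 1 2) (by decide)]
  -- Each of the six edges of the complete graph lies on exactly two of its three Hamiltonian
  -- cycles.
  have hprod : ∀ {g : Fin 4 → Fin 4 → ℝ}, IsSymmSign g → weight g (fourCycle 1 2 3) *
      weight g (fourCycle 1 3 2) * weight g (fourCycle 2 1 3) = 1 := by
    intro g hg
    obtain ⟨h1, -, h2, -, h3, -⟩ := weight_fourCycle g
    rw [h1, h2, h3, hg.symm 3 0, hg.symm 2 0, hg.symm 3 2, hg.symm 2 1]
    have q1 := hg.mul_self 0 1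
    have q2 := hg.mul_self 0 2
    have q3 := hg.mul_self 0 3
    have q4 := hg.mul_self 1 2
    have q5 := hg.mul_self 1 3
    have q6 := hg.mul_self 2 3
    calc _ = (g 0 1 * g 0 1) * (g 0 2 * g 0 2) * (g 0 3 * g 0 3) * (g 1 2 * g 1 2) *
          (g 1 3 * g 1 3) * (g 2 3 * g 2 3) := by ring
      _ = 1 := by rw [q1, q2, q3, q4, q5, q6]; norm_num
  have habs : ∀ x y, |m y x| = |m x y| := by
    intro x y
    rw [hm, abs_mul]
    rcases he.eq_or x y with h | h <;> simp [h]
  have hE := hprod he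
  have hS := hprod hs
  rw [he1, one_mul] at hE
  rw [hs1] at hS
  obtain ⟨w1, -, w2, -, w3, -⟩ := weight_fourCycle m
  have hW1 : weight m (fourCycle 1 2 3) ≠ 0 := by
    rw [w1]
    refine mul_ne_zero (mul_ne_zero (mul_ne_zero ?_ ?_) ?_) ?_ <;> exact hm0 _ _ (by decide)
  -- The two cycles share the edges 01 and 23. Cancelling them from an equality of absolute values
  -- leaves exactly what `hgen` forbids; `h13` is the same with the shared edges 12 and 03.
  have h12 : weight m (fourCycle 1 2 3) + weight m (fourCycle 1 3 2) ≠ 0 := by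
    intro h0
    have h1 := hgen 1 2 0 3 (by decide) (by decide) (by decide) (by decide) (by decide) (by decide)
    rw [w1, w2, add_eq_zero_iff_eq_neg] at h0
    have h2 := congrArg abs h0
    rw [abs_neg] at h2
    simp only [abs_mul] at h1 h2
    rw [habs 0 3, habs 2 3] at h2
    rw [habs 1 3] at h1
    have p1 := abs_pos.2 (hm0 0 1 (by decide))
    have p2 := abs_pos.2 (hm0 2 3 (by decide))
    refine h1 (mul_left_cancel₀ (mul_pos p1 p2).ne' ?_)
    linear_combination h2
  have h13 : weight m (fourCycle 1 2 3) + weight m (fourCycle 2 1 3) ≠ 0 := by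
    intro h0
    have h1 := hgen 0 1 3 2 (by decide) (by decide) (by decide) (by decide) (by decide) (by decide)
    rw [w1, w3, add_eq_zero_iff_eq_neg] at h0
    have h2 := congrArg abs h0
    rw [abs_neg] at h2
    simp only [abs_mul] at h1 h2
    rw [habs 1 2] at h2
    rw [habs 2 3, habs 0 2] at h1
    have p1 := abs_pos.2 (hm0 1 2 (by decide))
    have p2 := abs_pos.2 (hm0 3 0 (by decide))
    refine h1 (mul_left_cancel₀ (mul_pos p1 p2).ne' ?_)
    linear_combination h2
  -- By the product relations, the other two cycles have equal `e`-signs and opposite `s`-signs. So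
  -- the first cycle is flipped either alone or together with exactly one of the others.
  rcases he.prod_eq_or univ id (fourCycle 1 3 2) with hE2 | hE2 <;>
    rcases hs.prod_eq_or univ id (fourCycle 1 3 2) with hS2 | hS2 <;>
    change weight e (fourCycle 1 3 2) = _ at hE2 <;>
    change weight s (fourCycle 1 3 2) = _ at hS2 <;>
    rw [hE2] at hE <;> rw [hS2] at hS
  · have hE3 : weight e (fourCycle 2 1 3) = 1 := by linarith
    have hS3 : weight s (fourCycle 2 1 3) = -1 := by linarith
    rw [he1, hs1, hE2, hS2, hE3, hS3]
    norm_num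
    intro h; apply h13; linarith
  · have hS3 : weight s (fourCycle 2 1 3) = 1 := by linarith
    rw [he1, hs1, hE2, hS2, hS3]
    norm_num
    intro h; apply h12; linarith
  · have hE3 : weight e (fourCycle 2 1 3) = -1 := by linarith
    rw [he1, hs1, hE2, hE3]
    norm_num
    exact hW1
  · have hE3 : weight e (fourCycle 2 1 3) = -1 := by linarith
    rw [he1, hs1, hE2, hE3]
    norm_num
    exact hW1

/-- Numbering the vertices along `σ` transports the problem to `Fin 4`, where the four edges of `σ`
and the two given diagonals make all off-diagonal entries nonzero. -/
theorem IsGenericSystem.sum_ne_zero_of_card_eq_four (h : IsGenericSystem M e s)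
    (hV : Fintype.card V = 4) {σ : Perm V} (hσ : σ ∈ flippedFullCycles e s)
    (hw : weight M σ ≠ 0) (v : V) (h02 : M v ((σ ^ 2) v) ≠ 0)
    (h13 : M (σ v) ((σ ^ 3) v) ≠ 0) : ∑ τ ∈ flippedFullCycles e s, weight M τ ≠ 0 := by
  classical
  have hfc := h.isFlippedCycle hσ hw v
  have hfull := (mem_flippedFullCycles.1 hσ).1
  have hinj : Function.Injective fun i : Fin 4 => (σ ^ (i : ℕ)) v := by
    intro i j hij
    by_contra hne
    rcases lt_or_gt_of_ne hne with hlt | hlt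
    · exact hfc.inj i j hlt (by omega) hij
    · exact hfc.inj j i hlt (by omega) hij.symm
  let q : Fin 4 ≃ V := Equiv.ofBijective _
    ((Fintype.bijective_iff_injective_and_card _).2 ⟨hinj, by simp [hV]⟩)
  have hq : ∀ i : Fin 4, q i = (σ ^ (i : ℕ)) v := fun i => rfl
  have hσq : ∀ g : V → V → ℝ, weight (fun i j => g (q i) (q j)) (fourCycle 1 2 3) = weight g σ := by
    intro g
    have h4 : (σ ^ 4) v = v := by simpa [hV] using hfull.pow_card_apply (mem_univ v)
    rw [weight_eq_prod_range hfull v, hV, (weight_fourCycle _).1]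
    simp only [prod_range_succ, prod_range_zero, one_mul, hq, h4]
    rfl
  have hsig : ∀ {g : V → V → ℝ}, IsSymmSign g → IsSymmSign fun i j => g (q i) (q j) :=
    fun hg => ⟨fun x y => hg.eq_or _ _, fun x y => hg.symm _ _⟩
  have hadj := fun i => hfc.adj i
  have h40 : (σ ^ (3 + 1)) v = v := by simpa [hV] using hfull.pow_card_apply (mem_univ v)
  have hlt : ∀ i j : Fin 4, i < j → M (q i) (q j) ≠ 0 := by
    intro i j hij
    rw [hq, hq]
    fin_cases i <;> fin_cases j <;> try exact absurd hij (by decide)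
    · exact hadj 0
    · exact h02
    · refine h.isFlippedCycle hσ hw v |>.entry_ne_zero_symm ?_
      have := hadj 3
      simp only [h40] at this
      exact this
    · exact hadj 1
    · exact h13
    · exact hadj 2
  have hm0 : ∀ i j : Fin 4, i ≠ j → M (q i) (q j) ≠ 0 := by
    intro i j hij
    rcases lt_or_gt_of_ne hij with hl | hl
    · exact hlt i j hl
    · exact hfc.entry_ne_zero_symm (hlt j i hl)
  rw [sum_flippedFullCycles_congr q]
  simp only [isCycleOn_univ_fin_four]
  convert four_sum_ne_zero (hsig h.sign_e) (hsig h.sign_s) (m := fun i j => M (q i) (q j))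
    (fun x y => h.entry_symm _ _) hm0 ?_ ?_ ?_ using 1
  · congr!
  · intro i j k l a b c d f g
    refine h.generic _ _ _ _ (q.injective.ne a) (q.injective.ne b) (q.injective.ne c)
      (q.injective.ne d) (q.injective.ne f) (q.injective.ne g) ?_
    exact mul_ne_zero (mul_ne_zero (mul_ne_zero (hm0 _ _ a) (hm0 _ _ d)) (hm0 _ _ g))
      (hm0 _ _ c.symm)
  · rw [hσq, (mem_flippedFullCycles.1 hσ).2.1]
  · rw [hσq, (mem_flippedFullCycles.1 hσ).2.2]

end FourVertices


/-! ### Cuts by four edges and reconnection of Hamiltonian cycles -/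

variable {V : Type*} [Fintype V] [DecidableEq V] {M e s : V → V → ℝ}

theorem inv_apply_apply {α : Type*} (σ : Perm α) (v : α) : σ⁻¹ (σ v) = v := σ.symm_apply_apply v

theorem apply_inv_apply {α : Type*} (σ : Perm α) (v : α) : σ (σ⁻¹ v) = v := σ.apply_symm_apply v

/-- The edges between `A` and its complement join each of `x`, `y` to each of `z`, `w`, and form a
positive cycle with trivial sign change. -/
structure IsCrossingCut (M e s : V → V → ℝ) (A : Finset V) (x y z w : V) : Prop where
  hx : x ∈ A
  hy : y ∈ A
  hz : z ∉ A
  hw : w ∉ A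
  xy : x ≠ y
  zw : z ≠ w
  across : ∀ u ∈ A, ∀ v ∉ A, M u v ≠ 0 → (u = x ∨ u = y) ∧ (v = z ∨ v = w)
  xz : M x z ≠ 0
  xw : M x w ≠ 0
  yz : M y z ≠ 0
  yw : M y w ≠ 0
  prod_e : e x z * e y w * (e x w * e y z) = 1
  prod_s : s x z * s y w * (s x w * s y z) = 1

namespace IsCrossingCut

variable {A : Finset V} {x y z w : V}

theorem swap_left (h : IsCrossingCut M e s A x y z w) : IsCrossingCut M e s A y x z w :=
  ⟨h.hy, h.hx, h.hz, h.hw, h.xy.symm, h.zw, fun u hu v hv huv => ⟨(h.across u hu v hv huv).1.symm,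
    (h.across u hu v hv huv).2⟩, h.yz, h.yw, h.xz, h.xw, by rw [← h.prod_e]; ring,
    by rw [← h.prod_s]; ring⟩

theorem swap_right (h : IsCrossingCut M e s A x y z w) : IsCrossingCut M e s A x y w z :=
  ⟨h.hx, h.hy, h.hw, h.hz, h.xy, h.zw.symm, fun u hu v hv huv => ⟨(h.across u hu v hv huv).1,
    (h.across u hu v hv huv).2.symm⟩, h.xw, h.xz, h.yw, h.yz, by rw [← h.prod_e]; ring,
    by rw [← h.prod_s]; ring⟩

end IsCrossingCut

/-- The full cycle `σ` leaves `A` only along `x → z` and enters it only along `w → y`. -/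
structure CrossesAlong (σ : Perm V) (A : Finset V) (x y z w : V) : Prop where
  full : σ.IsCycleOn (univ : Finset V)
  out : σ x = z
  into : σ w = y
  stay : ∀ v ∈ A, v ≠ x → σ v ∈ A
  stay' : ∀ v ∉ A, v ≠ w → σ v ∉ A

/-- After `x → z`, re-entry along `z → x` would close an orbit of length two. Re-entry along `z → y`
or `w → x` forces the remaining cut edges to be used as well, and then `x → z → y → w → x` closes
up, which is impossible with five or more vertices. Only `w → y` remains. -/
theorem IsCrossingCut.exists_crossesAlong_aux {A : Finset V} {x y z w : V}
    (h : IsCrossingCut M e s A x y z w) (hM : ∀ x y, M x y ≠ 0 → M y x ≠ 0)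
    (hV : 5 ≤ Fintype.card V) {σ : Perm V}
    (hσ : σ.IsCycleOn (univ : Finset V)) (hwt : weight M σ ≠ 0) (hout : σ x = z) :
    CrossesAlong σ A x y z w := by
  have hadj : ∀ v, M v (σ v) ≠ 0 := fun v => prod_ne_zero_iff.1 hwt _ (mem_univ _)
  have hσ2 : ∀ v, σ (σ v) ≠ v := fun v => pow_apply_ne_of_lt hσ v (n := 2) (by
    intro hd; have := Nat.le_of_dvd two_pos hd; omega)
  have hσ4 : ∀ v, σ (σ (σ (σ v))) ≠ v := fun v => pow_apply_ne_of_lt hσ v (n := 4) (by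
    intro hd; have := Nat.le_of_dvd (by norm_num) hd; omega)
  have hexit : ∀ u ∈ A, σ u ∉ A → (u = x ∨ u = y) ∧ (σ u = z ∨ σ u = w) := fun u hu hu' =>
    h.across u hu _ hu' (hadj u)
  have henter : ∀ u ∉ A, σ u ∈ A → (u = z ∨ u = w) ∧ (σ u = x ∨ σ u = y) := fun u hu hu' =>
    (h.across _ hu' u hu (hM _ _ (hadj u))).symm
  have hyexit : ∀ {u}, σ u = x → u ∉ A → σ y = w := by
    intro u hu huA
    obtain ⟨v, ⟨hvA, hvx⟩, hv⟩ := exists_exit hσ (A := {v | v ∈ A ∧ v ≠ x})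
      ⟨y, h.hy, h.xy.symm⟩ (v := x) (fun hx => hx.2 rfl)
    have hvA' : σ v ∉ A := by
      intro hcon
      have hvx' : σ v = x := by
        by_contra hne
        exact hv ⟨hcon, hne⟩
      rw [← hu] at hvx'
      exact huA (σ.injective hvx' ▸ hvA)
    obtain ⟨h1, h2⟩ := hexit v hvA hvA'
    rcases h1 with rfl | rfl
    · exact absurd rfl hvx
    rcases h2 with h2 | h2
    · rw [← hout] at h2
      exact absurd (σ.injective h2) h.xy.symm
    · exact h2
  have hentry : ∀ u ∉ A, σ u ∈ A → u = w ∧ σ u = y := by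
    intro u hu hu'
    obtain ⟨h1, h2⟩ := henter u hu hu'
    rcases h1 with rfl | rfl <;> rcases h2 with h2 | h2
    · exact absurd (by rw [hout, h2]) (hσ2 x)
    · exfalso
      obtain ⟨v, ⟨hvA, hvx⟩, hv⟩ := exists_exit hσ (A := {v | v ∉ A ∧ v ≠ u})
        ⟨w, h.hw, h.zw.symm⟩ (v := u) (fun hx => hx.2 rfl)
      have hvA' : σ v ∈ A := by
        by_contra hcon
        have hvx' : σ v = u := by
          by_contra hne
          exact hv ⟨hcon, hne⟩
        rw [← hout] at hvx'
        exact hvA (σ.injective hvx' ▸ h.hx)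
      obtain ⟨h3, h4⟩ := henter v hvA hvA'
      rcases h3 with rfl | rfl
      · exact hvx rfl
      rcases h4 with h4 | h4
      · have h5 := hyexit h4 hvA
        exact hσ4 x (by rw [hout, h2, h5, h4])
      · rw [← h2] at h4
        exact hvx (σ.injective h4)
    · exfalso
      have h5 := hyexit h2 hu
      obtain ⟨v, ⟨hvA, hvx⟩, hv⟩ := exists_exit hσ (A := {v | v ∉ A ∧ v ≠ u})
        ⟨z, h.hz, h.zw⟩ (v := u) (fun hx => hx.2 rfl)
      have hvA' : σ v ∈ A := by
        by_contra hcon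
        have hvx' : σ v = u := by
          by_contra hne
          exact hv ⟨hcon, hne⟩
        rw [← h5] at hvx'
        exact hvA (σ.injective hvx' ▸ h.hy)
      obtain ⟨h3, h4⟩ := henter v hvA hvA'
      rcases h3 with rfl | rfl
      · rcases h4 with h4 | h4
        · rw [← h2] at h4
          exact hvx (σ.injective h4)
        · exact hσ4 x (by rw [hout, h4, h5, h2])
      · exact hvx rfl
    · exact ⟨rfl, h2⟩
  obtain ⟨u, hu, hu'⟩ := exists_exit hσ (A := {v | v ∉ A}) ⟨z, h.hz⟩ (v := x)
    (fun hx => hx h.hx)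
  obtain ⟨rfl, huy⟩ := hentry u hu (by simpa using hu')
  refine ⟨hσ, hout, huy, fun v hv hvx => ?_, fun v hv hvw hcon => hvw (hentry v hv hcon).1⟩
  by_contra hcon
  obtain ⟨h1, h2⟩ := hexit v hv hcon
  rcases h1 with rfl | rfl
  · exact hvx rfl
  rcases h2 with h2 | h2
  · rw [← hout] at h2
    exact hvx (σ.injective h2)
  · exact hσ2 u (by rw [huy, h2])

theorem IsCrossingCut.exists_crossesAlong {A : Finset V} {x y z w : V}
    (h : IsCrossingCut M e s A x y z w) (hM : ∀ x y, M x y ≠ 0 → M y x ≠ 0)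
    (hV : 5 ≤ Fintype.card V) {σ : Perm V}
    (hσ : σ.IsCycleOn (univ : Finset V)) (hwt : weight M σ ≠ 0) :
    CrossesAlong σ A x y z w ∨ CrossesAlong σ A y x z w ∨ CrossesAlong σ A x y w z ∨
      CrossesAlong σ A y x w z := by
  obtain ⟨v, hv, hv'⟩ := exists_exit hσ (A := {v | v ∈ A}) ⟨x, h.hx⟩ (v := z) h.hz
  obtain ⟨h1, h2⟩ := h.across v hv _ hv' (prod_ne_zero_iff.1 hwt _ (mem_univ _))
  rcases h1 with rfl | rfl <;> rcases h2 with h2 | h2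
  · exact Or.inl (h.exists_crossesAlong_aux hM hV hσ hwt h2)
  · exact Or.inr (Or.inr (Or.inl (h.swap_right.exists_crossesAlong_aux hM hV hσ hwt h2)))
  · exact Or.inr (Or.inl (h.swap_left.exists_crossesAlong_aux hM hV hσ hwt h2))
  · exact Or.inr (Or.inr (Or.inr (h.swap_left.swap_right.exists_crossesAlong_aux hM hV hσ hwt h2)))

/-- Reverse the part of `σ` outside of `A`, reconnecting it through `z` and `w`. -/
def reverseOutsideFun (A : Finset V) (z w : V) (σ : Perm V) (v : V) : V :=
  if v ∈ A then swap z w (σ v) else if σ⁻¹ v ∉ A then σ⁻¹ v else σ (swap z w v)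

open Classical in
/-- Reverse the part of `σ` outside of `A`, reconnecting it through `z` and `w`. -/
noncomputable def reverseOutside (A : Finset V) (z w : V) (σ : Perm V) : Perm V :=
  if h : Function.Bijective (reverseOutsideFun A z w σ) then Equiv.ofBijective _ h else σ

/-- The definition does not see the order of `z` and `w`. Since reconnection exchanges their roles,
this allows the same operation to be its own inverse. -/
theorem reverseOutside_comm (A : Finset V) (z w : V) (σ : Perm V) :
    reverseOutside A z w σ = reverseOutside A w z σ := by
  have : reverseOutsideFun A z w σ = reverseOutsideFun A w z σ := by
    funext v
    simp only [reverseOutsideFun, swap_comm]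
  simp only [reverseOutside, this]

namespace CrossesAlong

variable {A : Finset V} {x y z w : V} {σ : Perm V}

/-- The position at which the cycle, started at `x`, reaches `w`. -/
theorem exists_position (h : CrossesAlong σ A x y z w) (hx : x ∈ A) (hy : y ∈ A) (hz : z ∉ A)
    (hw : w ∉ A) (hxy : x ≠ y) (hzw : z ≠ w) :
    ∃ m, 2 ≤ m ∧ m + 2 ≤ Fintype.card V ∧ (σ ^ m) x = w ∧
      (∀ i, 1 ≤ i → i ≤ m → (σ ^ i) x ∉ A) ∧
      ∀ i, m < i → i ≤ Fintype.card V → (σ ^ i) x ∈ A := by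
  have hV : 0 < Fintype.card V := Fintype.card_pos_iff.2 ⟨x⟩
  obtain ⟨m, hm, hmw⟩ := h.full.exists_pow_eq (mem_univ x) (mem_univ w)
  rw [card_univ] at hm
  have hsucc : ∀ i, (σ ^ (i + 1)) x = σ ((σ ^ i) x) := fun i => by
    rw [pow_succ', Perm.mul_apply]
  have hinj : ∀ i j, i < j → j < i + Fintype.card V → (σ ^ i) x ≠ (σ ^ j) x :=
    fun i j => pow_apply_inj h.full x
  have hout : ∀ i, 1 ≤ i → i ≤ m → (σ ^ i) x ∉ A := by
    intro i hi
    induction i, hi using Nat.le_induction with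
    | base => intro _; simpa [h.out] using hz
    | succ i hi ih =>
      intro him
      rw [hsucc]
      refine h.stay' _ (ih (by omega)) fun hcon => ?_
      rw [← hmw] at hcon
      exact hinj i m (by omega) (by omega) hcon
  have hin : ∀ i, m < i → i ≤ Fintype.card V → (σ ^ i) x ∈ A := by
    intro i hi
    induction i, hi using Nat.le_induction with
    | base => intro _; rw [hsucc, hmw, h.into]; exact hy
    | succ i hi ih =>
      intro him
      rw [hsucc]
      refine h.stay _ (ih (by omega)) fun hcon => ?_
      refine hinj 0 i (by omega) (by omega) ?_
      rw [hcon]; rfl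
  have hm0 : m ≠ 0 := by
    rintro rfl
    exact hw (hmw ▸ hx)
  have hm1 : m ≠ 1 := by
    rintro rfl
    refine hzw ?_
    rw [← hmw, pow_one, h.out]
  have hmk : m + 1 ≠ Fintype.card V := by
    intro hk
    have h1 : (σ ^ (m + 1)) x = x := by
      rw [hk]; exact h.full.pow_card_apply (mem_univ x)
    rw [hsucc, hmw, h.into] at h1
    exact hxy h1.symm
  exact ⟨m, by omega, by omega, hmw, hout, hin⟩

/-- The sequence of vertices of the reconnected cycle. -/
theorem reverseOutside_spec (h : CrossesAlong σ A x y z w) (hx : x ∈ A) (hz : z ∉ A)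
    {m : ℕ} (hm2 : 1 ≤ m) (hmk : m + 1 ≤ Fintype.card V)
    (hmw : (σ ^ m) x = w) (hout : ∀ i, 1 ≤ i → i ≤ m → (σ ^ i) x ∉ A)
    (hin : ∀ i, m < i → i ≤ Fintype.card V → (σ ^ i) x ∈ A) :
    (∀ v, reverseOutside A z w σ v = reverseOutsideFun A z w σ v) ∧
      (reverseOutside A z w σ).IsCycleOn (univ : Finset V) ∧
      ∀ i ≤ Fintype.card V, ((reverseOutside A z w σ) ^ i) x =
        if 1 ≤ i ∧ i ≤ m then (σ ^ (m + 1 - i)) x else (σ ^ i) x := by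
  have hw : w ∉ A := hmw ▸ hout m hm2 le_rfl
  have hsucc : ∀ i, (σ ^ (i + 1)) x = σ ((σ ^ i) x) := fun i => by
    rw [pow_succ', Perm.mul_apply]
  have hpred : ∀ i, σ⁻¹ ((σ ^ (i + 1)) x) = (σ ^ i) x := fun i => by
    rw [hsucc, inv_apply_apply]
  have hfix : ∀ v ∈ A, swap z w v = v := fun v hv =>
    swap_apply_of_ne_of_ne (fun h => hz (h ▸ hv)) (fun h => hw (h ▸ hv))
  -- Positions 1 to `m` are the stretch outside `A`, from `z` to `w`. The new cycle traverses it
  -- backwards and leaves all other positions unchanged.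
  let p' : ℕ → V := fun i => if 1 ≤ i ∧ i ≤ m then (σ ^ (m + 1 - i)) x else (σ ^ i) x
  have hp0 : p' 0 = x := by simp [p']
  have hp1 : ∀ i, 1 ≤ i → i ≤ m → p' i = (σ ^ (m + 1 - i)) x := fun i h1 h2 => if_pos ⟨h1, h2⟩
  have hp2 : ∀ i, m < i → p' i = (σ ^ i) x := fun i h1 => if_neg (by omega)
  have hstep : ∀ i < Fintype.card V, reverseOutsideFun A z w σ (p' i) = p' (i + 1) := by
    intro i hi
    rcases Nat.eq_zero_or_pos i with rfl | hi0
    · rw [hp0, reverseOutsideFun, if_pos hx, h.out, swap_apply_left, hp1 _ (by omega) (by omega),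
        ← hmw]
      rfl
    rcases lt_or_ge i m with him | him
    · rw [hp1 i hi0 him.le, hp1 (i + 1) (by omega) (by omega), reverseOutsideFun,
        if_neg (hout _ (by omega) (by omega))]
      have : m + 1 - i = (m + 1 - (i + 1)) + 1 := by omega
      rw [this, hpred, if_pos (hout _ (by omega) (by omega))]
    rcases eq_or_lt_of_le him with rfl | him
    · have h1 : p' m = z := by
        rw [hp1 m hi0 le_rfl, show m + 1 - m = 1 by omega, pow_one, h.out]
      have h2 : σ⁻¹ z = x := by rw [← h.out, inv_apply_apply]
      rw [h1, reverseOutsideFun, if_neg hz, h2, if_neg (not_not.2 hx), swap_apply_left,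
        hp2 _ (by omega), hsucc, hmw]
    · have h1 : (σ ^ i) x ∈ A := hin i him hi.le
      have h2 : σ ((σ ^ i) x) ∈ A := by rw [← hsucc]; exact hin _ (by omega) hi
      rw [hp2 i him, hp2 _ (by omega), reverseOutsideFun, if_pos h1, hfix _ h2, hsucc]
  have hpk : p' (Fintype.card V) = x := by
    rw [hp2 _ (by omega)]
    exact h.full.pow_card_apply (mem_univ x)
  have hsurj' : ∀ v, ∃ i < Fintype.card V, p' i = v := by
    intro v
    obtain ⟨j, hj, rfl⟩ := h.full.exists_pow_eq (mem_univ x) (mem_univ v)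
    rw [card_univ] at hj
    by_cases hjm : 1 ≤ j ∧ j ≤ m
    · refine ⟨m + 1 - j, by omega, ?_⟩
      rw [hp1 _ (by omega) (by omega), show m + 1 - (m + 1 - j) = j by omega]
    · exact ⟨j, hj, if_neg hjm⟩
  have hbij : Function.Bijective (reverseOutsideFun A z w σ) := by
    refine Function.Surjective.bijective_of_finite fun v => ?_
    obtain ⟨i, hi, rfl⟩ := hsurj' v
    rcases Nat.eq_zero_or_pos i with rfl | hi0
    · refine ⟨p' (Fintype.card V - 1), ?_⟩
      rw [hstep _ (by omega), Nat.sub_add_cancel (by omega), hpk, hp0]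
    · refine ⟨p' (i - 1), ?_⟩
      rw [hstep _ (by omega), Nat.sub_add_cancel (by omega)]
  have happ : ∀ v, reverseOutside A z w σ v = reverseOutsideFun A z w σ v := by
    intro v
    rw [reverseOutside, dif_pos hbij]
    rfl
  have hpow : ∀ i ≤ Fintype.card V, ((reverseOutside A z w σ) ^ i) x = p' i := by
    intro i
    induction i with
    | zero => intro _; rw [hp0]; rfl
    | succ i ih =>
      intro hi
      rw [pow_succ', Perm.mul_apply, ih (by omega), happ, hstep i (by omega)]
  refine ⟨happ, ⟨by simp, fun a _ b _ => ?_⟩, hpow⟩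
  obtain ⟨i, hi, rfl⟩ := hsurj' a
  obtain ⟨j, hj, rfl⟩ := hsurj' b
  rw [← hpow i hi.le, ← hpow j hj.le]
  exact (SameCycle.refl _ x).pow_left.pow_right

/-- The matching `x → z`, `w → y` becomes `x → w`, `z → y`, and a second reversal of the outer
stretch undoes the first. -/
theorem reverseOutside_crossesAlong (h : CrossesAlong σ A x y z w) (hx : x ∈ A) (hy : y ∈ A)
    (hz : z ∉ A) (hw : w ∉ A) (hxy : x ≠ y) (hzw : z ≠ w) :
    CrossesAlong (reverseOutside A z w σ) A x y w z ∧
      reverseOutside A z w (reverseOutside A z w σ) = σ := by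
  have hfix : ∀ v ∈ A, swap z w v = v := fun v hv =>
    swap_apply_of_ne_of_ne (fun h => hz (h ▸ hv)) (fun h => hw (h ▸ hv))
  have hinvz : σ⁻¹ z = x := by rw [← h.out, inv_apply_apply]
  have happ : ∀ {σ : Perm V} {z w : V}, CrossesAlong σ A x y z w → z ∉ A → w ∉ A → z ≠ w →
      (∀ v, reverseOutside A z w σ v = reverseOutsideFun A z w σ v) ∧
      (reverseOutside A z w σ).IsCycleOn (univ : Finset V) := by
    intro σ z w h hz hw hzw
    obtain ⟨m, hm2, hmk, hmw, hout, hin⟩ := h.exists_position hx hy hz hw hxy hzw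
    obtain ⟨h1, h2, -⟩ := h.reverseOutside_spec hx hz (by omega) (by omega) hmw hout hin
    exact ⟨h1, h2⟩
  obtain ⟨h1, h2⟩ := happ h hz hw hzw
  have hinvA : ∀ v ∉ A, v ≠ z → σ⁻¹ v ∉ A := by
    intro v hv hvz hcon
    by_cases hvx : σ⁻¹ v = x
    · exact hvz (by rw [← h.out, ← hvx, apply_inv_apply])
    · have := h.stay _ hcon hvx
      rw [apply_inv_apply] at this
      exact hv this
  have hA : ∀ v ∈ A, reverseOutside A z w σ v = swap z w (σ v) := fun v hv => by
    rw [h1, reverseOutsideFun, if_pos hv]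
  have hB : ∀ v ∉ A, v ≠ z → reverseOutside A z w σ v = σ⁻¹ v := fun v hv hvz => by
    rw [h1, reverseOutsideFun, if_neg hv, if_pos (hinvA v hv hvz)]
  have hZ : reverseOutside A z w σ z = y := by
    rw [h1, reverseOutsideFun, if_neg hz, hinvz, if_neg (not_not.2 hx), swap_apply_left, h.into]
  have hX : reverseOutside A z w σ x = w := by rw [hA x hx, h.out, swap_apply_left]
  have hC : CrossesAlong (reverseOutside A z w σ) A x y w z := by
    refine ⟨h2, hX, hZ, fun v hv hvx => ?_, fun v hv hvz => ?_⟩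
    · rw [hA v hv, hfix _ (h.stay v hv hvx)]
      exact h.stay v hv hvx
    · rw [hB v hv hvz]
      exact hinvA v hv hvz
  refine ⟨hC, ?_⟩
  obtain ⟨h3, -⟩ := happ hC hw hz hzw.symm
  rw [reverseOutside_comm]
  ext v
  rw [h3, reverseOutsideFun]
  by_cases hv : v ∈ A
  · rw [if_pos hv, hA v hv, swap_comm, swap_apply_self]
  rw [if_neg hv]
  by_cases hvw : v = w
  · subst hvw
    have : (reverseOutside A z v σ)⁻¹ v = x := by rw [Perm.inv_eq_iff_eq, hX]
    rw [this, if_neg (not_not.2 hx), swap_apply_left, hZ, h.into]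
  · have hσv : σ v ∉ A := h.stay' v hv hvw
    have hσz : σ v ≠ z := fun hcon => by
      rw [← h.out] at hcon
      exact hv (σ.injective hcon ▸ hx)
    have : (reverseOutside A z w σ)⁻¹ v = σ v := by
      rw [Perm.inv_eq_iff_eq, hB _ hσv hσz, inv_apply_apply]
    rw [this, if_pos hσv]

/-- Comparison of products along a cycle and its reconnection. -/
theorem weight_reverseOutside (h : CrossesAlong σ A x y z w) (hx : x ∈ A) (hz : z ∉ A)
    {m r : ℕ} (hk : Fintype.card V = m + 2 + r)
    (hmw : (σ ^ (m + 1)) x = w) (hout : ∀ i, 1 ≤ i → i ≤ m + 1 → (σ ^ i) x ∉ A)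
    (hin : ∀ i, m + 1 < i → i ≤ Fintype.card V → (σ ^ i) x ∈ A) (g : V → V → ℝ) :
    ∃ R, weight g σ =
        (∏ i ∈ range m, g ((σ ^ (i + 1)) x) ((σ ^ (i + 2)) x)) * g x z * g w y * R ∧
      weight g (reverseOutside A z w σ) =
        (∏ i ∈ range m, g ((σ ^ (i + 2)) x) ((σ ^ (i + 1)) x)) * g x w * g z y * R := by
  obtain ⟨-, hfull, hpow⟩ := h.reverseOutside_spec hx hz (by omega) (by omega) hmw hout hin
  have hsucc : ∀ i, (σ ^ (i + 1)) x = σ ((σ ^ i) x) := fun i => by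
    rw [pow_succ', Perm.mul_apply]
  have hz1 : (σ ^ 1) x = z := h.out
  have hy1 : (σ ^ (m + 2)) x = y := by rw [hsucc, hmw, h.into]
  refine ⟨∏ i ∈ range r, g ((σ ^ (m + 2 + i)) x) ((σ ^ (m + 2 + i + 1)) x), ?_, ?_⟩
  · rw [weight_eq_prod_range h.full x, hk, prod_range_add, prod_range_succ, prod_range_succ', hmw,
      hy1]
    simp only [zero_add, hz1, pow_zero, Perm.one_apply, add_assoc, Nat.reduceAdd]
  · rw [weight_eq_prod_range hfull x, hk, prod_range_add, prod_range_succ, prod_range_succ']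
    congr 1
    · have p0 : ((reverseOutside A z w σ) ^ 0) x = x := rfl
      have p1 : ((reverseOutside A z w σ) ^ (0 + 1)) x = w := by
        rw [hpow _ (by omega), if_pos (by omega), ← hmw]
        rfl
      have p2 : ((reverseOutside A z w σ) ^ (m + 1)) x = z := by
        rw [hpow _ (by omega), if_pos (by omega), show m + 1 + 1 - (m + 1) = 1 by omega, hz1]
      have p3 : ((reverseOutside A z w σ) ^ (m + 1 + 1)) x = y := by
        rw [hpow _ (by omega), if_neg (by omega), hy1]
      rw [p0, p1, p2, p3, ← prod_range_reflect]
      congr 2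
      refine prod_congr rfl fun i hi => ?_
      have := mem_range.1 hi
      rw [hpow _ (by omega), hpow _ (by omega), if_pos (by omega), if_pos (by omega)]
      congr 3 <;> omega
    · refine prod_congr rfl fun i hi => ?_
      have := mem_range.1 hi
      rw [hpow _ (by omega), hpow _ (by omega), if_neg (by omega), if_neg (by omega)]

end CrossesAlong

/-- Reconnecting a flipped full cycle gives a flipped full cycle, with a fixed ratio of weights. -/
theorem IsGenericSystem.reverseOutside_mem (hg : IsGenericSystem M e s) {A : Finset V}
    {x y z w : V} (hc : IsCrossingCut M e s A x y z w) {σ : Perm V}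
    (h : CrossesAlong σ A x y z w) (hσ : σ ∈ flippedFullCycles e s) (hw : weight M σ ≠ 0) :
    reverseOutside A z w σ ∈ flippedFullCycles e s ∧
      weight M (reverseOutside A z w σ) * (M z x * M w y) = -(weight M σ * (M w x * M z y)) := by
  obtain ⟨m', hm2, hmk, hmw, hout, hin⟩ :=
    h.exists_position hc.hx hc.hy hc.hz hc.hw hc.xy hc.zw
  obtain ⟨m, rfl⟩ : ∃ m, m' = m + 1 := ⟨m' - 1, by omega⟩
  obtain ⟨r, hk⟩ : ∃ r, Fintype.card V = m + 2 + r := ⟨Fintype.card V - (m + 2), by omega⟩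
  obtain ⟨-, hfull, -⟩ := h.reverseOutside_spec hc.hx hc.hz (by omega) (by omega) hmw hout hin
  have key := fun g => h.weight_reverseOutside hc.hx hc.hz hk hmw hout hin g
  -- The two cycles differ, up to orientation, only in the four edges of the cut, so the quotient of
  -- their signs is the sign of that four-cycle.
  have hsign : ∀ {g : V → V → ℝ}, IsSymmSign g → g x z * g y w * (g x w * g y z) = 1 →
      weight g (reverseOutside A z w σ) = weight g σ := by
    intro g hgs hg1
    obtain ⟨R, h1, h2⟩ := key g
    have h3 : ∏ i ∈ range m, g ((σ ^ (i + 2)) x) ((σ ^ (i + 1)) x) =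
        ∏ i ∈ range m, g ((σ ^ (i + 1)) x) ((σ ^ (i + 2)) x) :=
      prod_congr rfl fun i _ => hgs.symm _ _
    rw [h3] at h2
    rw [h1, h2, hgs.symm z y, hgs.symm w y]
    have hq : g x w * g y z = g x z * g y w := by
      rcases hgs.eq_or x z with a | a <;> rcases hgs.eq_or y w with b | b <;>
        rw [a, b] at hg1 ⊢ <;> linarith
    linear_combination (∏ i ∈ range m, g ((σ ^ (i + 1)) x) ((σ ^ (i + 2)) x)) * R * hq
  obtain ⟨hσ1, hσ2, hσ3⟩ := mem_flippedFullCycles.1 hσ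
  refine ⟨mem_flippedFullCycles.2 ⟨hfull, by rw [hsign hg.sign_e hc.prod_e, hσ2],
    by rw [hsign hg.sign_s hc.prod_s, hσ3]⟩, ?_⟩
  obtain ⟨R, h1, h2⟩ := key M
  have h3 : ∏ i ∈ range m, M ((σ ^ (i + 2)) x) ((σ ^ (i + 1)) x) =
      (∏ i ∈ range m, e ((σ ^ (i + 1)) x) ((σ ^ (i + 2)) x)) *
        ∏ i ∈ range m, M ((σ ^ (i + 1)) x) ((σ ^ (i + 2)) x) := by
    rw [← prod_mul_distrib]
    exact prod_congr rfl fun i _ => hg.entry_symm _ _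
  -- The edge from `x` to `w` is a chord of `σ`, hence cuts off a negative cycle. This evaluates the
  -- charge picked up by the reversed stretch and is the origin of the minus sign in the ratio.
  have h4 := (hg.isFlippedCycle hσ hw x).gauged_chord (a := 0) (c := m + 1) (by omega) (by omega)
    (by simp only [hmw]; exact hc.xw)
  have hz1 : (σ ^ (0 + 1)) x = z := h.out
  rw [gauged, pathSign, pathSign, prod_range_zero, one_mul, prod_range_succ', hmw] at h4
  simp only [hz1, pow_zero, Perm.one_apply, add_assoc, Nat.reduceAdd] at h4
  have h5 : (∏ i ∈ range m, e ((σ ^ (i + 1)) x) ((σ ^ (i + 2)) x)) * e x z = -e x w := by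
    rcases hg.sign_e.eq_or x w with h | h <;> rw [h] at h4 ⊢ <;> linarith
  rw [h1, h2, h3, hg.entry_symm x z, hg.entry_symm x w]
  linear_combination (∏ i ∈ range m, M ((σ ^ (i + 1)) x) ((σ ^ (i + 2)) x)) * M x w * M z y * R *
    M x z * M w y * h5


/-! ### Deleting a crossing pair, and non-cancellation of the weights -/

variable {V : Type*} [Fintype V] [DecidableEq V] {M e s : V → V → ℝ}

/-- A pair of crossing chords can be brought into standard position by a rotation. -/
theorem IsFlippedCycle.exists_standard_crossing {k : ℕ} {p : ℕ → V}
    (h : IsFlippedCycle M e s k p) {a b c d : ℕ} (hab : a < b) (hbc : b < c)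
    (hcd : c < d) (hda : d < a + k) (h1 : M (p a) (p c) ≠ 0) (h2 : M (p b) (p d) ≠ 0) :
    ∃ a c, 2 ≤ c ∧ c + 1 < k ∧ M (p a) (p (a + c)) ≠ 0 ∧ M (p (a + 1)) (p (a + (c + 1))) ≠ 0 := by
  rcases h.crossing hab hbc hcd hda h1 h2 with ⟨rfl, rfl⟩ | ⟨rfl, h4⟩
  · refine ⟨a, c - a, by omega, by omega, ?_, ?_⟩
    · rwa [show a + (c - a) = c by omega]
    · rwa [show a + (c - a + 1) = c + 1 by omega]
  · refine ⟨b, d - b, by omega, by omega, ?_, ?_⟩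
    · rwa [show b + (d - b) = d by omega]
    · rw [show b + (d - b + 1) = a + k by omega, h.periodic]
      exact h.entry_ne_zero_symm h1

/-- The cut separates the arc from `σ v` to `(σ ^ c) v` from the rest. `edges_across` leaves two
edges of the cycle and the two chords; the former have gauged sign one and the latter equal gauged
signs, so the four-cycle has trivial signs. -/
theorem IsGenericSystem.exists_crossingCut (h : IsGenericSystem M e s) (hk : 5 ≤ Fintype.card V)
    {σ : Perm V} (hσ : σ ∈ flippedFullCycles e s) (hw : weight M σ ≠ 0) (v : V) {c : ℕ}
    (hc : 2 ≤ c) (hck : c + 1 < Fintype.card V) (h1 : M v ((σ ^ c) v) ≠ 0)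
    (h2 : M (σ v) ((σ ^ (c + 1)) v) ≠ 0) :
    ∃ A x y z w, IsCrossingCut M e s A x y z w ∧ σ w = x ∧ σ y = z := by
  have hf := h.isFlippedCycle hσ hw v
  set p : ℕ → V := fun i => (σ ^ i) v with hp
  have h1' : M (p 0) (p c) ≠ 0 := h1
  have h2' : M (p 1) (p (c + 1)) ≠ 0 := h2
  have hpk : p (Fintype.card V) = p 0 := by have := hf.periodic 0; rwa [zero_add] at this
  have hnot : ∀ j, c < j → j ≤ Fintype.card V → p j ∉ (Icc 1 c).image p := by
    intro j hj hjk hmem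
    obtain ⟨i, hi, hij⟩ := mem_image.1 hmem
    rw [mem_Icc] at hi
    exact hf.inj i j (by omega) (by omega) hij
  have hprod : ∀ {g : V → V → ℝ}, IsSymmSign g → gauged g p 1 (c + 1) = gauged g p 0 c →
      g (p 1) (p (c + 1)) * g (p c) (p 0) * (g (p 1) (p 0) * g (p c) (p (c + 1))) = 1 := by
    intro g hg heq
    have q1 := gauged_succ hg p 0
    have q2 := gauged_succ hg p c
    have q3 := gauged_eq_or hg p 0 c
    rw [zero_add] at q1
    have d1 := pathSign_mul_self hg p 0
    have d2 := pathSign_mul_self hg p 1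
    have d3 := pathSign_mul_self hg p c
    have d4 := pathSign_mul_self hg p (c + 1)
    -- Each of the four vertices lies on two of the edges, so its path sign enters squared and the
    -- gauge drops out.
    have key : gauged g p 1 (c + 1) * gauged g p 0 c * (gauged g p 0 1 * gauged g p c (c + 1)) =
        1 := by
      rw [q1, q2, heq]
      rcases q3 with h | h <;> rw [h] <;> norm_num
    rw [← key, hg.symm (p c) (p 0), hg.symm (p 1) (p 0)]
    simp only [gauged]
    calc _ = 1 * 1 * (1 * 1) * (g (p 1) (p (c + 1)) * g (p 0) (p c) *
          (g (p 0) (p 1) * g (p c) (p (c + 1)))) := by ring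
      _ = (pathSign g p 0 * pathSign g p 0) * (pathSign g p 1 * pathSign g p 1) *
          ((pathSign g p c * pathSign g p c) * (pathSign g p (c + 1) * pathSign g p (c + 1))) *
          (g (p 1) (p (c + 1)) * g (p 0) (p c) *
          (g (p 0) (p 1) * g (p c) (p (c + 1)))) := by rw [d1, d2, d3, d4]
      _ = _ := by ring
  refine ⟨(Icc 1 c).image p, p 1, p c, p (c + 1), p 0, ⟨?_, ?_, ?_, ?_, ?_, ?_, ?_, h2', ?_, ?_, ?_,
    ?_, ?_⟩, rfl, ?_⟩
  · exact mem_image_of_mem _ (mem_Icc.2 ⟨le_rfl, by omega⟩)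
  · exact mem_image_of_mem _ (mem_Icc.2 ⟨by omega, le_rfl⟩)
  · exact hnot _ (by omega) (by omega)
  · rw [← hpk]; exact hnot _ (by omega) le_rfl
  · exact hf.inj 1 c (by omega) (by omega)
  · rw [← hpk]; exact hf.inj (c + 1) _ (by omega) (by omega)
  · intro u hu u' hu' huu'
    obtain ⟨i, hi, rfl⟩ := mem_image.1 hu
    rw [mem_Icc] at hi
    obtain ⟨j, hj, hjk, rfl⟩ : ∃ j, c < j ∧ j ≤ Fintype.card V ∧ p j = u' := by
      obtain ⟨j, hj, rfl⟩ := hf.surj u'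
      rcases Nat.eq_zero_or_pos j with rfl | hj0
      · exact ⟨Fintype.card V, by omega, le_rfl, hpk⟩
      · refine ⟨j, ?_, hj.le, rfl⟩
        by_contra hcon
        exact hu' (mem_image_of_mem _ (mem_Icc.2 ⟨hj0, by omega⟩))
    obtain ⟨a1, a2⟩ := hf.edges_across hk hc hck h1' h2' hi.1 hi.2 hj hjk huu'
    refine ⟨by rcases a1 with rfl | rfl <;> simp, ?_⟩
    rcases a2 with rfl | rfl
    · exact Or.inl rfl
    · exact Or.inr hpk
  · exact hf.entry_ne_zero_symm (hf.adj 0)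
  · exact hf.adj c
  · exact hf.entry_ne_zero_symm h1'
  · refine hprod h.sign_e ?_
    rw [hf.gauged_chord (by omega) (by omega) h1', hf.gauged_chord (by omega) (by omega) h2']
  · exact hprod h.sign_s
      (hf.gauged_s_crossing (by omega) (by omega) (by omega) (by omega) h1' h2' (by omega)).symm
  · simp only [hp, pow_succ', Perm.mul_apply]

/-- The matrix `M` with the entries at `{x, z}` and `{y, w}` deleted. -/
def deletePairs (M : V → V → ℝ) (x y z w u v : V) : ℝ :=
  if (u = x ∧ v = z) ∨ (u = z ∧ v = x) ∨ (u = y ∧ v = w) ∨ (u = w ∧ v = y) then 0 else M u v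

theorem deletePairs_eq_or (M : V → V → ℝ) (x y z w u v : V) :
    deletePairs M x y z w u v = 0 ∨ deletePairs M x y z w u v = M u v := by
  rw [deletePairs]
  split_ifs <;> simp

theorem deletePairs_of_ne_zero {x y z w u v : V} (h : deletePairs M x y z w u v ≠ 0) :
    deletePairs M x y z w u v = M u v :=
  (deletePairs_eq_or M x y z w u v).resolve_left h

/-- The hypotheses concern only cycles with nonzero entries, and deletion can only remove such
cycles. The tables `e` and `s` are kept, so the set of flipped cycles does not move. -/
theorem IsGenericSystem.deletePairs (h : IsGenericSystem M e s) (x y z w : V) :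
    IsGenericSystem (deletePairs M x y z w) e s := by
  refine ⟨h.sign_e, h.sign_s, fun u v => ?_, ?_, ?_, h.three_le⟩
  · simp only [MagnitudeSymmetric.deletePairs]
    rw [h.entry_symm u v]
    by_cases hc : (u = x ∧ v = z) ∨ (u = z ∧ v = x) ∨ (u = y ∧ v = w) ∨ (u = w ∧ v = y)
    · rw [if_pos hc, if_pos (by tauto), mul_zero]
    · rw [if_neg hc, if_neg (by tauto)]
  · intro c P hc h3 hk hne he
    refine h.short c P hc h3 hk (fun v hv => ?_) he
    rw [← deletePairs_of_ne_zero (hne v hv)]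
    exact hne v hv
  · intro i j k l a b c d f g hne
    have h1 := left_ne_zero_of_mul (left_ne_zero_of_mul (left_ne_zero_of_mul hne))
    have h2 := right_ne_zero_of_mul (left_ne_zero_of_mul (left_ne_zero_of_mul hne))
    have h3 := right_ne_zero_of_mul (left_ne_zero_of_mul hne)
    have h4 := right_ne_zero_of_mul hne
    rw [deletePairs_of_ne_zero h1, deletePairs_of_ne_zero h2, deletePairs_of_ne_zero h3,
      deletePairs_of_ne_zero h4] at hne ⊢
    exact h.generic i j k l a b c d f g hne

theorem IsGenericSystem.entry_ne_zero_symm (h : IsGenericSystem M e s) (x y : V)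
    (hxy : M x y ≠ 0) : M y x ≠ 0 := by
  rw [h.entry_symm x y]
  refine mul_ne_zero ?_ hxy
  rcases h.sign_e.eq_or x y with h | h <;> simp [h]

theorem weight_deletePairs_eq_zero {x y z w : V} {σ : Perm V} (h : σ x = z ∨ σ z = x) :
    weight (deletePairs M x y z w) σ = 0 := by
  rcases h with h | h
  · exact prod_eq_zero (mem_univ x) (by simp [deletePairs, h])
  · exact prod_eq_zero (mem_univ z) (by simp [deletePairs, h])

theorem weight_deletePairs_eq {x y z w : V} {σ : Perm V} (h1 : σ x ≠ z) (h2 : σ z ≠ x)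
    (h3 : σ y ≠ w) (h4 : σ w ≠ y) : weight (deletePairs M x y z w) σ = weight M σ := by
  refine prod_congr rfl fun v _ => if_neg ?_
  rintro (⟨rfl, h⟩ | ⟨rfl, h⟩ | ⟨rfl, h⟩ | ⟨rfl, h⟩) <;> contradiction

/-- Reconnection exchanges the flipped full cycles through the edge `{x, z}` and the others. -/
theorem IsGenericSystem.reverseOutside_exchange (hg : IsGenericSystem M e s)
    (hV : 5 ≤ Fintype.card V) {A : Finset V} {x y z w : V} (hc : IsCrossingCut M e s A x y z w)
    {σ : Perm V} (hσ : σ ∈ flippedFullCycles e s) (hw : weight M σ ≠ 0) :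
    reverseOutside A z w σ ∈ flippedFullCycles e s ∧ weight M (reverseOutside A z w σ) ≠ 0 ∧
      reverseOutside A z w (reverseOutside A z w σ) = σ ∧
      (((σ x = z ∨ σ z = x) ∧
        ¬(reverseOutside A z w σ x = z ∨ reverseOutside A z w σ z = x)) ∨
      (¬(σ x = z ∨ σ z = x) ∧ (reverseOutside A z w σ x = z ∨ reverseOutside A z w σ z = x) ∧
        weight (MagnitudeSymmetric.deletePairs M x y z w) σ = weight M σ ∧
        weight M (reverseOutside A z w σ) * (M w x * M z y) =
          -(weight M σ * (M z x * M w y)))) := by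
  have hs := hg.entry_ne_zero_symm
  have hne : ∀ {x y z w : V}, IsCrossingCut M e s A x y z w →
      weight M (reverseOutside A z w σ) * (M z x * M w y) = -(weight M σ * (M w x * M z y)) →
      weight M (reverseOutside A z w σ) ≠ 0 := by
    intro x y z w hc h h0
    rw [h0, zero_mul, eq_comm, neg_eq_zero] at h
    exact mul_ne_zero hw (mul_ne_zero (hs _ _ hc.xw) (hs _ _ hc.yz)) h
  have hinj := σ.injective
  rcases hc.exists_crossesAlong hs hV (mem_flippedFullCycles.1 hσ).1 hw with h | h | h | h
  · obtain ⟨h1, h2⟩ := hg.reverseOutside_mem hc h hσ hw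
    obtain ⟨h3, h4⟩ := h.reverseOutside_crossesAlong hc.hx hc.hy hc.hz hc.hw hc.xy hc.zw
    refine ⟨h1, hne hc h2, h4, Or.inl ⟨Or.inl h.out, ?_⟩⟩
    rintro (h5 | h5)
    · exact hc.zw (h5.symm.trans h3.out)
    · exact hc.xy (h5.symm.trans h3.into)
  · have hc' := hc.swap_left
    obtain ⟨h1, h2⟩ := hg.reverseOutside_mem hc' h hσ hw
    obtain ⟨h3, h4⟩ := h.reverseOutside_crossesAlong hc'.hx hc'.hy hc'.hz hc'.hw hc'.xy hc'.zw
    have n1 : σ x ≠ z := fun h5 => hc.xy (hinj (h5.trans h.out.symm))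
    have n2 : σ z ≠ x := fun h5 => hc.zw (hinj (h5.trans h.into.symm))
    refine ⟨h1, hne hc' h2, h4, Or.inr ⟨not_or.2 ⟨n1, n2⟩, Or.inr h3.into, ?_, ?_⟩⟩
    · exact weight_deletePairs_eq n1 n2 (by rw [h.out]; exact hc.zw) (by rw [h.into]; exact hc.xy)
    · linear_combination h2
  · have hc' := hc.swap_right
    obtain ⟨h1, h2⟩ := hg.reverseOutside_mem hc' h hσ hw
    obtain ⟨h3, h4⟩ := h.reverseOutside_crossesAlong hc'.hx hc'.hy hc'.hz hc'.hw hc'.xy hc'.zw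
    have n1 : σ x ≠ z := fun h5 => hc.zw (h5.symm.trans h.out)
    have n2 : σ z ≠ x := fun h5 => hc.xy (h5.symm.trans h.into)
    rw [reverseOutside_comm A z w, reverseOutside_comm A z w]
    refine ⟨h1, hne hc' h2, h4, Or.inr ⟨not_or.2 ⟨n1, n2⟩, Or.inl h3.out, ?_, ?_⟩⟩
    · exact weight_deletePairs_eq n1 n2 (fun h5 => hc.xy (hinj (h.out.trans h5.symm)))
        (fun h5 => hc.zw (hinj (h.into.trans h5.symm)))
    · linear_combination h2
  · have hc' := hc.swap_left.swap_right
    obtain ⟨h1, h2⟩ := hg.reverseOutside_mem hc' h hσ hw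
    obtain ⟨h3, h4⟩ := h.reverseOutside_crossesAlong hc'.hx hc'.hy hc'.hz hc'.hw hc'.xy hc'.zw
    rw [reverseOutside_comm A z w, reverseOutside_comm A z w]
    refine ⟨h1, hne hc' h2, h4, Or.inl ⟨Or.inr h.into, ?_⟩⟩
    rintro (h5 | h5)
    · exact hc.xy ((reverseOutside A w z σ).injective (h5.trans h3.out.symm))
    · exact hc.zw ((reverseOutside A w z σ).injective (h5.trans h3.into.symm))

/-- Split the sum according to whether a cycle uses the edge between `x` and `z`. Reconnection
matches the two halves with a fixed ratio, and the half avoiding that edge is the sum for the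
deleted matrix. Stated without division. -/
theorem IsGenericSystem.sum_eq_deletePairs (hg : IsGenericSystem M e s)
    (hV : 5 ≤ Fintype.card V) {A : Finset V} {x y z w : V} (hc : IsCrossingCut M e s A x y z w) :
    (∑ σ ∈ flippedFullCycles e s, weight M σ) * (M w x * M z y) =
      (∑ σ ∈ flippedFullCycles e s, weight (MagnitudeSymmetric.deletePairs M x y z w) σ) *
        (M w x * M z y - M z x * M w y) := by
  classical
  have hex := fun {σ : Perm V} => hg.reverseOutside_exchange hV hc (σ := σ)
  have hdel : ∑ σ ∈ flippedFullCycles e s, weight (MagnitudeSymmetric.deletePairs M x y z w) σ =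
      ∑ σ ∈ flippedFullCycles e s with ¬(σ x = z ∨ σ z = x), weight M σ := by
    rw [sum_filter]
    refine sum_congr rfl fun σ hσ => ?_
    by_cases hU : σ x = z ∨ σ z = x
    · rw [if_neg (not_not.2 hU), weight_deletePairs_eq_zero hU]
    rw [if_pos hU]
    by_cases hw : weight M σ = 0
    · rw [hw]
      obtain ⟨v, _, hv⟩ := prod_eq_zero_iff.1 hw
      refine prod_eq_zero (mem_univ v) ?_
      rcases deletePairs_eq_or M x y z w v (σ v) with h | h
      · exact h
      · rw [h, hv]
    · rcases (hex hσ hw).2.2.2 with h | h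
      · exact absurd h.1 hU
      · exact h.2.2.1
  rw [hdel, ← sum_filter_add_sum_filter_not _ (fun σ : Perm V => σ x = z ∨ σ z = x)]
  have hkey : (∑ σ ∈ flippedFullCycles e s with (σ x = z ∨ σ z = x), weight M σ) *
        (M w x * M z y) =
      (∑ σ ∈ flippedFullCycles e s with ¬(σ x = z ∨ σ z = x), weight M σ) *
        -(M z x * M w y) := by
    -- Cycles of weight zero are discarded first, since reconnection is controlled only on the
    -- others.
    rw [← sum_filter_ne_zero, ← sum_filter_ne_zero
      ({σ ∈ flippedFullCycles e s | ¬(σ x = z ∨ σ z = x)}), sum_mul, sum_mul]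
    symm
    refine sum_nbij' (reverseOutside A z w) (reverseOutside A z w) ?_ ?_ ?_ ?_ ?_
    · intro σ hσ
      simp only [mem_filter] at hσ ⊢
      obtain ⟨h1, h2, -, h3⟩ := hex hσ.1.1 hσ.2
      rcases h3 with h3 | h3
      · exact absurd h3.1 hσ.1.2
      · exact ⟨⟨h1, h3.2.1⟩, h2⟩
    · intro σ hσ
      simp only [mem_filter] at hσ ⊢
      obtain ⟨h1, h2, -, h3⟩ := hex hσ.1.1 hσ.2
      rcases h3 with h3 | h3
      · exact ⟨⟨h1, h3.2⟩, h2⟩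
      · exact absurd hσ.1.2 h3.1
    · intro σ hσ
      simp only [mem_filter] at hσ
      exact (hex hσ.1.1 hσ.2).2.2.1
    · intro σ hσ
      simp only [mem_filter] at hσ
      exact (hex hσ.1.1 hσ.2).2.2.1
    · intro σ hσ
      simp only [mem_filter] at hσ
      rcases (hex hσ.1.1 hσ.2).2.2.2 with h3 | h3
      · exact absurd h3.1 hσ.1.2
      · linear_combination -h3.2.2.2
  rw [add_mul, hkey]
  ring

/-- The weights of the flipped full cycles of a generic system do not cancel. -/
theorem IsGenericSystem.sum_weight_ne_zero {σ : Perm V} (hσ : σ ∈ flippedFullCycles e s)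
    (n : ℕ) : ∀ M : V → V → ℝ, IsGenericSystem M e s → weight M σ ≠ 0 →
      Set.ncard {q : V × V | M q.1 q.2 ≠ 0} = n → ∑ τ ∈ flippedFullCycles e s, weight M τ ≠ 0 := by
  -- The matrix varies in the induction on its number of nonzero entries, while `e`, `s`, `σ`, and
  -- hence the index set of the sum, stay fixed.
  induction n using Nat.strong_induction_on with
  | _ n ih =>
  intro M h hw hn
  have h3 := h.three_le
  obtain ⟨v⟩ : Nonempty V := Fintype.card_pos_iff.1 (by omega)
  have hf := h.isFlippedCycle hσ hw v
  by_cases hnc : ∀ a b c d, a < b → b < c → c < d → d < a + Fintype.card V →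
      M ((σ ^ a) v) ((σ ^ c) v) ≠ 0 → M ((σ ^ b) v) ((σ ^ d) v) = 0
  · exact h.sum_ne_zero_of_no_crossing hσ hw v hnc
  push Not at hnc
  obtain ⟨a, b, c, d, hab, hbc, hcd, hda, h1, h2⟩ := hnc
  obtain ⟨a, c, hc, hck, h1, h2⟩ := hf.exists_standard_crossing hab hbc hcd hda h1 h2
  have hpow : ∀ i, (σ ^ (a + i)) v = (σ ^ i) ((σ ^ a) v) := fun i => by
    rw [add_comm, pow_add, Perm.mul_apply]
  simp only [hpow] at h1 h2
  generalize (σ ^ a) v = v at h1 h2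
  rcases eq_or_lt_of_le (show 4 ≤ Fintype.card V by omega) with h4 | h5
  · obtain rfl : c = 2 := by omega
    exact h.sum_ne_zero_of_card_eq_four h4.symm hσ hw v h1 h2
  obtain ⟨A, x, y, z, w, hcut, hwx, hyz⟩ := h.exists_crossingCut h5 hσ hw v hc hck h1 h2
  -- The deleted pairs are the two chords. The cycle `σ` crosses the cut along `w → x` and `y → z`,
  -- so it survives and keeps the smaller sum from being vacuous.
  have hdel : weight (MagnitudeSymmetric.deletePairs M x y z w) σ ≠ 0 := by
    rw [weight_deletePairs_eq]
    · exact hw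
    · exact fun h6 => hcut.xy (σ.injective (h6.trans hyz.symm))
    · exact fun h6 => hcut.zw (σ.injective (h6.trans hwx.symm))
    · rw [hyz]; exact hcut.zw
    · rw [hwx]; exact hcut.xy
  have hlt : Set.ncard {q : V × V | MagnitudeSymmetric.deletePairs M x y z w q.1 q.2 ≠ 0} < n := by
    rw [← hn]
    refine Set.ncard_lt_ncard ⟨fun q hq => ?_, fun hsub => ?_⟩ (Set.toFinite _)
    · have := deletePairs_of_ne_zero hq
      exact fun h0 => hq (this.trans h0)
    · have : (x, z) ∈ {q : V × V | MagnitudeSymmetric.deletePairs M x y z w q.1 q.2 ≠ 0} :=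
        hsub hcut.xz
      exact this (by simp [MagnitudeSymmetric.deletePairs])
  have hne := ih _ hlt _ (h.deletePairs x y z w) hdel rfl
  have hsum := h.sum_eq_deletePairs h5 hcut
  intro h0
  rw [h0, zero_mul, eq_comm, mul_eq_zero] at hsum
  rcases hsum with hsum | hsum
  · exact hne hsum
  have hs := h.entry_ne_zero_symm
  have hxw : x ≠ w := fun h => hcut.hw (h ▸ hcut.hx)
  have hxz : x ≠ z := fun h => hcut.hz (h ▸ hcut.hx)
  have hyw : y ≠ w := fun h => hcut.hw (h ▸ hcut.hy)
  have hyz' : y ≠ z := fun h => hcut.hz (h ▸ hcut.hy)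
  -- The remaining factor vanishes only if the two matchings of the cut have equal products, which
  -- genericity of the four-cycle `w x z y` excludes.
  refine h.generic w x z y hxw.symm hcut.zw.symm hyw.symm hxz hcut.xy hyz'.symm
    (mul_ne_zero (mul_ne_zero (mul_ne_zero (hs _ _ hcut.xw) hcut.xz) (hs _ _ hcut.yz)) hcut.yw) ?_
  rw [sub_eq_zero.1 hsum, h.entry_symm x z, h.entry_symm y w]
  simp only [abs_mul]
  have habs : ∀ a b, |e a b| = 1 := fun a b => by
    rcases h.sign_e.eq_or a b with h | h <;> simp [h]
  rw [habs, habs, one_mul, one_mul]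

/-- If the sign change `s` preserves the determinant and is trivial on all shorter positive cycles,
then it is trivial on the positive full cycles. -/
theorem IsGenericSystem.weight_sign_eq_one (h : IsGenericSystem M e s) (hs1 : ∀ x, s x x = 1)
    (hdet : (Matrix.of M).det = (Matrix.of fun x y => s x y * M x y).det) {σ : Perm V}
    (hσ : σ.IsCycleOn (univ : Finset V)) (hw : weight M σ ≠ 0) (he : weight e σ = 1) :
    weight s σ = 1 := by
  rcases h.sign_s.prod_eq_or univ id σ with hs | hs
  · exact hs
  exfalso
  have h3 := h.three_le
  have hsum := det_sub_det_eq_flippedFullCycles h.sign_e h.sign_s hs1 h.entry_symm (by omega)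
    h.short
  rw [hdet, sub_self] at hsum
  refine IsGenericSystem.sum_weight_ne_zero (mem_flippedFullCycles.2 ⟨hσ, he, hs⟩) _ M h hw rfl ?_
  refine (mul_eq_zero.1 hsum.symm).resolve_left ?_
  exact mul_ne_zero (neg_ne_zero.2 (pow_ne_zero _ (by norm_num))) two_ne_zero


/-! ### Simple cycles as subgraphs, walks and cyclic permutations -/

section Conversion

variable {V α : Type*} {G : SimpleGraph V}

theorem isCycleOn_sq_apply_ne {c : Perm α} {P : Finset α} (hc : c.IsCycleOn P) (h3 : 3 ≤ #P)
    {x : α} (hx : x ∈ P) : c (c x) ≠ x := by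
  intro h
  have h2 : (c ^ 2) x = x := h
  have := Nat.le_of_dvd two_pos ((hc.pow_apply_eq hx).1 h2)
  omega

theorem isCycleOn_apply_mem {c : Perm α} {P : Finset α} (hc : c.IsCycleOn P) {x : α}
    (hx : x ∈ P) : c x ∈ P := hc.1.mapsTo hx

theorem isCycleOn_apply_ne {c : Perm α} {P : Finset α} (hc : c.IsCycleOn P) (h3 : 3 ≤ #P)
    {x : α} (hx : x ∈ P) : c x ≠ x := by
  intro h
  exact isCycleOn_sq_apply_ne hc h3 hx (by rw [h, h])

theorem injOn_cycle_edges {c : Perm α} {P : Finset α} (hc : c.IsCycleOn P) (h3 : 3 ≤ #P)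
    {j : α → V} (hj : Function.Injective j) :
    Set.InjOn (fun x => s(j x, j (c x))) (P : Set α) := by
  intro x hx y hy hxy
  rcases Sym2.eq_iff.1 hxy with ⟨h, -⟩ | ⟨h1, h2⟩
  · exact hj h
  · have h1 := hj h1
    have h2 := hj h2
    rw [h1] at h2
    exact absurd h2 (isCycleOn_sq_apply_ne hc h3 hy)

theorem prod_cycle_edges {R : Type*} [CommMonoid R] {c : Perm α} {P : Finset α}
    (hc : c.IsCycleOn P) (h3 : 3 ≤ #P) {j : α → V} (hj : Function.Injective j) {E : Set (Sym2 V)}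
    (hE : E = (fun x => s(j x, j (c x))) '' P) (hfin : E.Finite) (g : Sym2 V → R) :
    ∏ e ∈ hfin.toFinset, g e = ∏ x ∈ P, g s(j x, j (c x)) := by
  classical
  have : hfin.toFinset = P.image fun x => s(j x, j (c x)) := by
    ext e
    simp [hE]
  rw [this, prod_image (injOn_cycle_edges hc h3 hj)]

theorem ncard_cycle_edges {c : Perm α} {P : Finset α}
    (hc : c.IsCycleOn P) (h3 : 3 ≤ #P) {j : α → V} (hj : Function.Injective j) {E : Set (Sym2 V)}
    (hE : E = (fun x => s(j x, j (c x))) '' P) : E.ncard = #P := by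
  rw [hE, (injOn_cycle_edges hc h3 hj).ncard_image, Set.ncard_coe_finset]

/-- The subgraph traversed by a cyclic permutation. -/
theorem exists_isSimpleCycle_of_isCycleOn {c : Perm α} {P : Finset α} (hc : c.IsCycleOn P)
    (h3 : 3 ≤ #P) {j : α → V} (hj : Function.Injective j)
    (hadj : ∀ x ∈ P, G.Adj (j x) (j (c x))) :
    ∃ C : G.Subgraph, IsSimpleCycle C ∧ C.edgeSet = (fun x => s(j x, j (c x))) '' P := by
  let C : G.Subgraph :=
    { verts := j '' P
      Adj := fun a b => ∃ x ∈ P, s(j x, j (c x)) = s(a, b)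
      adj_sub := by
        rintro a b ⟨x, hx, h⟩
        rw [← SimpleGraph.mem_edgeSet, ← h]
        exact hadj x hx
      edge_vert := by
        rintro a b ⟨x, hx, h⟩
        rcases Sym2.eq_iff.1 h with ⟨rfl, -⟩ | ⟨-, rfl⟩
        · exact ⟨x, hx, rfl⟩
        · exact ⟨c x, isCycleOn_apply_mem hc hx, rfl⟩
      symm := ⟨by
        rintro a b ⟨x, hx, h⟩
        exact ⟨x, hx, h.trans Sym2.eq_swap⟩⟩ }
  have hCadj : ∀ a b, C.Adj a b ↔ ∃ x ∈ P, s(j x, j (c x)) = s(a, b) := fun a b => Iff.rfl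
  refine ⟨C, ⟨?_, ?_⟩, ?_⟩
  · rw [SimpleGraph.Subgraph.connected_iff, SimpleGraph.Subgraph.preconnected_iff]
    obtain ⟨x0, hx0⟩ : P.Nonempty := card_pos.1 (by omega)
    refine ⟨?_, ⟨j x0, x0, hx0, rfl⟩⟩
    rintro ⟨_, x, hx, rfl⟩ ⟨_, y, hy, rfl⟩
    obtain ⟨n, -, rfl⟩ := hc.exists_pow_eq hx hy
    have hpow : ∀ n, (c ^ n) x ∈ P := by
      intro n
      induction n with
      | zero => exact hx
      | succ n ih => rw [pow_succ', Perm.mul_apply]; exact isCycleOn_apply_mem hc ih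
    have : ∀ n, C.coe.Reachable ⟨j x, x, hx, rfl⟩ ⟨j ((c ^ n) x), _, hpow n, rfl⟩ := by
      intro n
      induction n with
      | zero => exact SimpleGraph.Reachable.refl _
      | succ n ih =>
        refine ih.trans (SimpleGraph.Adj.reachable ?_)
        have h1 : C.Adj (j ((c ^ n) x)) (j ((c ^ (n + 1)) x)) :=
          (hCadj _ _).2 ⟨(c ^ n) x, hpow n, by rw [pow_succ', Perm.mul_apply]⟩
        exact h1
    exact this n
  · rintro _ ⟨x, hx, rfl⟩
    have hx' : c⁻¹ x ∈ P := by
      have := (isCycleOn_inv.2 hc).1.mapsTo hx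
      exact this
    have hset : C.neighborSet (j x) = {j (c x), j (c⁻¹ x)} := by
      ext b
      rw [SimpleGraph.Subgraph.mem_neighborSet, hCadj]
      constructor
      · rintro ⟨y, hy, h⟩
        rcases Sym2.eq_iff.1 h with ⟨h1, rfl⟩ | ⟨rfl, h2⟩
        · rw [hj h1]; simp
        · right
          rw [← hj h2, inv_apply_apply]
          rfl
      · rintro (rfl | rfl)
        · exact ⟨x, hx, rfl⟩
        · exact ⟨c⁻¹ x, hx', by rw [apply_inv_apply, Sym2.eq_swap]⟩
    rw [hset, Set.ncard_pair]
    intro h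
    have h1 := hj h
    exact isCycleOn_sq_apply_ne hc h3 hx (by rw [h1, apply_inv_apply])
  · ext e
    induction e using Sym2.ind with
    | _ a b =>
      rw [SimpleGraph.Subgraph.mem_edgeSet, hCadj]
      rfl

variable [Finite V]

/-- A cyclic walk through `u` inside `C` already uses both `C`-neighbours of each of its vertices.
It therefore cannot be left along `C`, and by connectedness it is all of `C`. -/
theorem exists_walk_of_isSimpleCycle {C : G.Subgraph} (hC : IsSimpleCycle C) {u : V}
    (hu : u ∈ C.verts) : ∃ p : G.Walk u u, p.IsCycle ∧ p.toSubgraph = C := by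
  have hcyc : C.spanningCoe.IsCycles := by
    rintro v ⟨w, hw⟩
    exact hC.2 v (C.edge_vert hw)
  have hne : (C.spanningCoe.neighborSet u).Nonempty := by
    refine Set.nonempty_of_ncard_ne_zero ?_
    have : (C.spanningCoe.neighborSet u).ncard = 2 := hC.2 u hu
    omega
  obtain ⟨p, hp, -⟩ := hcyc.exists_cycle_toSubgraph_verts_eq_connectedComponentSupp
    (c := C.spanningCoe.connectedComponentMk u) rfl hne
  have hle : C.spanningCoe ≤ G := C.spanningCoe_le
  have hq : (p.mapLe hle).IsCycle := hp.mapLe hle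
  have hqadj : ∀ a b, (p.mapLe hle).toSubgraph.Adj a b → C.Adj a b := by
    intro a b hab
    rw [SimpleGraph.Walk.adj_toSubgraph_mapLe] at hab
    exact hab.adj_sub
  have hnb : ∀ v ∈ (p.mapLe hle).support,
      (p.mapLe hle).toSubgraph.neighborSet v = C.neighborSet v := by
    intro v hv
    have h2 := hq.ncard_neighborSet_toSubgraph_eq_two hv
    obtain ⟨w, hw⟩ := Set.nonempty_of_ncard_ne_zero (s := (p.mapLe hle).toSubgraph.neighborSet v)
      (by omega)
    refine Set.eq_of_subset_of_ncard_le (fun w hw => hqadj v w hw) ?_ (Set.toFinite _)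
    rw [h2, hC.2 v (C.edge_vert (hqadj v w hw))]
  have hverts : ∀ v ∈ C.verts, v ∈ (p.mapLe hle).support := by
    intro v hv
    obtain ⟨-, hw⟩ := (SimpleGraph.Subgraph.connected_iff_forall_exists_walk_subgraph C).1 hC.1
    obtain ⟨w, hw⟩ := hw hu hv
    have key : ∀ {a b : V} (w : G.Walk a b), w.toSubgraph ≤ C → a ∈ (p.mapLe hle).support →
        b ∈ (p.mapLe hle).support := by
      intro a b w
      induction w with
      | nil => exact fun _ h => h
      | @cons a d b had w ih =>
        intro hle' ha
        rw [SimpleGraph.Walk.toSubgraph, sup_le_iff] at hle'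
        refine ih hle'.2 ?_
        have h1 : C.Adj a d := hle'.1.2 (by simp)
        have h2 : d ∈ (p.mapLe hle).toSubgraph.neighborSet a := by rw [hnb a ha]; exact h1
        exact (p.mapLe hle).mem_verts_toSubgraph.1
          ((p.mapLe hle).toSubgraph.edge_vert (SimpleGraph.Subgraph.Adj.symm h2))
    exact key w hw (p.mapLe hle).start_mem_support
  refine ⟨p.mapLe hle, hq, SimpleGraph.Subgraph.ext ?_ ?_⟩
  · ext v
    rw [SimpleGraph.Walk.mem_verts_toSubgraph]
    refine ⟨fun hv => ?_, hverts v⟩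
    have h2 := hq.ncard_neighborSet_toSubgraph_eq_two hv
    obtain ⟨w, hw⟩ := Set.nonempty_of_ncard_ne_zero (s := (p.mapLe hle).toSubgraph.neighborSet v)
      (by omega)
    exact C.edge_vert (hqadj v w hw)
  · ext a b
    refine ⟨hqadj a b, fun hab => ?_⟩
    have : b ∈ (p.mapLe hle).toSubgraph.neighborSet a := by
      rw [hnb a (hverts a (C.edge_vert hab))]
      exact hab
    exact this

omit [Finite V] in
theorem isSimpleCycle_toSubgraph {u : V} {p : G.Walk u u} (hp : p.IsCycle) :
    IsSimpleCycle p.toSubgraph :=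
  ⟨p.toSubgraph_connected, fun _ hv =>
    hp.ncard_neighborSet_toSubgraph_eq_two (p.mem_verts_toSubgraph.1 hv)⟩

/-- A simple cycle is traversed by a cyclic permutation of its vertices. -/
theorem exists_perm_of_isSimpleCycle {C : G.Subgraph} (hC : IsSimpleCycle C) {S : Finset V}
    (hS : (S : Set V) = C.verts) :
    ∃ c : Perm S, c.IsCycleOn (univ : Finset S) ∧ 3 ≤ #(univ : Finset S) ∧
      C.edgeSet = (fun x : S => s((x : V), (c x : V))) '' (univ : Finset S) := by
  classical
  obtain ⟨u, hu⟩ := hC.1.nonempty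
  obtain ⟨p, hp, rfl⟩ := exists_walk_of_isSimpleCycle hC hu
  have hmem : ∀ v, v ∈ S ↔ v ∈ p.support := by
    intro v
    rw [← SimpleGraph.Walk.mem_verts_toSubgraph, ← hS, mem_coe]
  let f : ℕ → S := fun i => ⟨p.getVert i, (hmem _).2 (p.getVert_mem_support i)⟩
  have hinj : ∀ i j, i < j → j < p.length → f i ≠ f j := by
    intro i j hij hj h
    have := hp.getVert_injOn' (show i ∈ {i | i ≤ p.length - 1} by
      change i ≤ p.length - 1; omega) (show j ∈ {i | i ≤ p.length - 1} by
      change j ≤ p.length - 1; omega) (congrArg Subtype.val h)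
    omega
  have hclosed : f p.length = f 0 := by simp [f]
  obtain ⟨c, hc, hcf⟩ := exists_isCycleOn_of_closed_sequence f p.length hinj hclosed
  have h3 := hp.three_le_length
  have himg : (range p.length).image f = univ := by
    ext v
    simp only [mem_image, mem_range, mem_univ, iff_true]
    obtain ⟨i, hi, hil⟩ := SimpleGraph.Walk.mem_support_iff_exists_getVert.1 ((hmem _).1 v.2)
    rcases eq_or_lt_of_le hil with rfl | hlt
    · refine ⟨0, by omega, ?_⟩
      rw [← hclosed]
      exact Subtype.ext hi
    · exact ⟨i, hlt, Subtype.ext hi⟩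
  rw [himg] at hc
  have hcard : #((range p.length).image f) = p.length := by
    rw [card_image_of_injOn, card_range]
    intro i hi j hj hij
    simp only [coe_range, Set.mem_Iio] at hi hj
    by_contra hne
    rcases lt_or_gt_of_ne hne with h | h
    · exact hinj i j h hj hij
    · exact hinj j i h hi hij.symm
  refine ⟨c, hc, by rw [← himg, hcard]; exact h3, ?_⟩
  rw [← himg]
  ext e
  induction e using Sym2.ind with
  | _ a b =>
    rw [SimpleGraph.Subgraph.mem_edgeSet, SimpleGraph.Walk.toSubgraph_adj_iff]
    simp only [coe_image, coe_range, Set.mem_image, Set.mem_Iio, exists_exists_and_eq_and]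
    constructor
    · rintro ⟨i, h, hi⟩
      exact ⟨i, hi, by rw [hcf i hi]; exact h⟩
    · rintro ⟨i, hi, h⟩
      rw [hcf i hi] at h
      exact ⟨i, h, hi⟩

end Conversion


/-! ### Charges, sign switchings and principal minors -/

section EntrySign

variable {V : Type*} {K : Matrix V V ℝ}

open Classical in
/-- The sign relating opposing entries of a magnitude-symmetric matrix. -/
noncomputable def entrySign (K : Matrix V V ℝ) (x y : V) : ℝ := if K x y = K y x then 1 else -1

theorem isSymmSign_entrySign (K : Matrix V V ℝ) : IsSymmSign (entrySign K) := by
  refine ⟨fun x y => ?_, fun x y => ?_⟩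
  · rw [entrySign]; split_ifs <;> simp
  · simp only [entrySign, eq_comm]

theorem entry_eq_entrySign_mul (hK : IsMagnitudeSymmetric K) (x y : V) :
    K y x = entrySign K x y * K x y := by
  rw [entrySign]
  split_ifs with h
  · rw [one_mul, h]
  · rcases abs_eq_abs.1 (hK x y) with h' | h'
    · exact absurd h' h
    · rw [h']; ring

theorem charge_eq_entrySign (hK : IsMagnitudeSymmetric K) {x y : V}
    (hxy : (chargedSparsityGraph K hK).graph.Adj x y) :
    (((chargedSparsityGraph K hK).charge s(x, y) : ℤ) : ℝ) = entrySign K x y := by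
  have h0 : K x y ≠ 0 := abs_ne_zero.1 hxy.2
  have hch : (chargedSparsityGraph K hK).charge s(x, y) =
      ((SignType.sign (K x y * K y x) : SignType) : ℤ) := rfl
  rw [hch, entry_eq_entrySign_mul hK x y]
  rcases (isSymmSign_entrySign K).eq_or x y with h | h <;> rw [h]
  · have : 0 < K x y * (1 * K x y) := by
      rw [one_mul]; exact mul_self_pos.2 h0
    rw [sign_pos this]; simp
  · have : K x y * (-1 * K x y) < 0 := by
      have := mul_self_pos.2 h0
      linarith
    rw [sign_neg this]; simp

theorem adj_iff (hK : IsMagnitudeSymmetric K) {x y : V} :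
    (chargedSparsityGraph K hK).graph.Adj x y ↔ x ≠ y ∧ K x y ≠ 0 := by
  rw [← abs_ne_zero]
  rfl

end EntrySign

/-- The product of `t` over the edges of a subgraph. -/
noncomputable def edgeProd {V : Type*} [Finite V] {G : SimpleGraph V} (t : Sym2 V → ℝ)
    (C : G.Subgraph) : ℝ := ∏ e ∈ C.edgeSet.toFinite.toFinset, t e

/-- `K'` arises from `K` by changing signs according to `t`, keeping `K i j * K j i`. -/
structure IsSwitching {V : Type*} (t : Sym2 V → ℝ) (K K' : Matrix V V ℝ) : Prop where
  eq_or : ∀ e, t e = 1 ∨ t e = -1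
  diag : ∀ x, t s(x, x) = 1
  entry : ∀ x y, K' x y = t s(x, y) * K x y

section Minors

variable {N : ℕ} {K K' : Matrix (Fin N) (Fin N) ℝ} {t : Sym2 (Fin N) → ℝ}

theorem IsSwitching.isSymmSign (ht : IsSwitching t K K') (S : Finset (Fin N)) :
    IsSymmSign fun x y : S => t s((x : Fin N), (y : Fin N)) :=
  ⟨fun _ _ => ht.eq_or _, fun x y => by rw [Sym2.eq_swap]⟩

theorem isSymmSign_entrySign_restrict (K : Matrix (Fin N) (Fin N) ℝ) (S : Finset (Fin N)) :
    IsSymmSign fun x y : S => entrySign K x y :=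
  ⟨fun _ _ => (isSymmSign_entrySign K).eq_or _ _, fun _ _ => (isSymmSign_entrySign K).symm _ _⟩

theorem IsSwitching.principalMinor_eq (ht : IsSwitching t K K') (S : Finset (Fin N)) :
    principalMinor K' S =
      (Matrix.of fun x y : S => t s((x : Fin N), (y : Fin N)) * K x y).det := by
  rw [principalMinor]
  congr 1
  ext x y
  exact ht.entry _ _

theorem subgraphCharge_eq_prod (hK : IsMagnitudeSymmetric K) {S : Finset (Fin N)} {c : Perm S}
    {P : Finset S} (hc : c.IsCycleOn P) (h3 : 3 ≤ #P)
    {C : (chargedSparsityGraph K hK).graph.Subgraph}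
    (hC : C.edgeSet = (fun x : S => s((x : Fin N), (c x : Fin N))) '' P) :
    (((chargedSparsityGraph K hK).subgraphCharge C : ℤ) : ℝ) =
      ∏ x ∈ P, entrySign K x (c x) := by
  rw [subgraphCharge, prod_cycle_edges hc h3 Subtype.val_injective hC, Int.cast_prod]
  refine prod_congr rfl fun x hx => charge_eq_entrySign hK ?_
  have : s((x : Fin N), (c x : Fin N)) ∈ C.edgeSet := by
    rw [hC]; exact ⟨x, hx, rfl⟩
  exact C.adj_sub this

/-- A cyclic permutation through nonzero entries traverses a simple cycle of the sparsity graph,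
with the same length, charge and `t`-sign. -/
theorem positiveCyclesBelow_of_simpleCycles (hK : IsMagnitudeSymmetric K) {n : ℕ}
    (hshort : ∀ C : (chargedSparsityGraph K hK).graph.Subgraph, IsSimpleCycle C →
      (chargedSparsityGraph K hK).subgraphCharge C = 1 → C.edgeSet.ncard < n → edgeProd t C = 1)
    (S : Finset (Fin N)) :
    PositiveCyclesBelow (fun x y : S => K x y) (fun x y => entrySign K x y)
      (fun x y => t s((x : Fin N), (y : Fin N))) n := by
  intro c P hc h3 hn hne he
  obtain ⟨C, hC, hCE⟩ := exists_isSimpleCycle_of_isCycleOn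
    (G := (chargedSparsityGraph K hK).graph) hc h3 (j := fun x : S => (x : Fin N))
    Subtype.val_injective
    (fun x hx => (adj_iff hK).2
      ⟨fun h => isCycleOn_apply_ne hc h3 hx (Subtype.ext h).symm, hne x hx⟩)
  have h1 := hshort C hC ?_ ?_
  · rwa [edgeProd, prod_cycle_edges hc h3 Subtype.val_injective hCE] at h1
  · have := subgraphCharge_eq_prod hK hc h3 hCE
    rw [he] at this
    exact_mod_cast this
  · rwa [ncard_cycle_edges hc h3 Subtype.val_injective hCE]

/-- A sign change trivial on the positive simple cycles preserves the principal minors. -/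
theorem IsSwitching.principalMinor_eq_of_simpleCycles (ht : IsSwitching t K K')
    (hK : IsMagnitudeSymmetric K) {S : Finset (Fin N)}
    (hshort : ∀ C : (chargedSparsityGraph K hK).graph.Subgraph, IsSimpleCycle C →
      (chargedSparsityGraph K hK).subgraphCharge C = 1 → C.edgeSet.ncard ≤ #S →
        edgeProd t C = 1) :
    principalMinor K S = principalMinor K' S := by
  rw [ht.principalMinor_eq]
  refine det_eq_of_positiveCycles (M := fun x y : S => K x y)
    (isSymmSign_entrySign_restrict K S) (ht.isSymmSign S) (fun x => ht.diag _)
    (fun x y => entry_eq_entrySign_mul hK _ _) ?_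
  rw [Fintype.card_coe]
  exact positiveCyclesBelow_of_simpleCycles hK
    (fun C h1 h2 h3 => hshort C h1 h2 (Nat.lt_succ_iff.1 h3)) S

/-- For generic matrices, a sign change which is trivial on the positive simple cycles with fewer
than `n` edges and preserves the principal minor of a positive simple cycle with `n` edges is
trivial on that cycle. -/
theorem IsSwitching.edgeProd_eq_one (ht : IsSwitching t K K')
    (hK : K ∈ genericMagnitudeSymmetric N)
    {C : (chargedSparsityGraph K hK.1).graph.Subgraph} (hC : IsSimpleCycle C)
    (hC1 : (chargedSparsityGraph K hK.1).subgraphCharge C = 1)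
    (hshort : ∀ D : (chargedSparsityGraph K hK.1).graph.Subgraph, IsSimpleCycle D →
      (chargedSparsityGraph K hK.1).subgraphCharge D = 1 → D.edgeSet.ncard < C.edgeSet.ncard →
        edgeProd t D = 1)
    {S : Finset (Fin N)} (hS : (S : Set (Fin N)) = C.verts)
    (hminor : principalMinor K S = principalMinor K' S) : edgeProd t C = 1 := by
  obtain ⟨c, hc, h3, hCE⟩ := exists_perm_of_isSimpleCycle hC hS
  have hcard : C.edgeSet.ncard = Fintype.card S := ncard_cycle_edges hc h3 Subtype.val_injective hCE
  have hsys : IsGenericSystem (fun x y : S => K x y) (fun x y => entrySign K x y)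
      (fun x y => t s((x : Fin N), (y : Fin N))) := by
    refine ⟨isSymmSign_entrySign_restrict K S, ht.isSymmSign S,
      fun x y => entry_eq_entrySign_mul hK.1 _ _, ?_, ?_, h3⟩
    · rw [← hcard]
      exact positiveCyclesBelow_of_simpleCycles hK.1 hshort S
    · intro i j k l a b d f g h hne
      have hv := fun {a b : S} (hab : a ≠ b) => fun h' => hab (Subtype.ext h')
      exact (hK.2 i j k l (hv a) (hv b) (hv d) (hv f) (hv g) (hv h) hne).1
  rw [ht.principalMinor_eq] at hminor
  rw [edgeProd, prod_cycle_edges hc h3 Subtype.val_injective hCE]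
  refine hsys.weight_sign_eq_one (fun x => ht.diag _) hminor hc ?_ ?_
  · refine prod_ne_zero_iff.2 fun x _ => ?_
    have : s((x : Fin N), (c x : Fin N)) ∈ C.edgeSet := by
      rw [hCE]; exact ⟨x, by simp, rfl⟩
    exact ((adj_iff hK.1).1 (C.adj_sub this)).2
  · have := subgraphCharge_eq_prod hK.1 hc h3 hCE
    rw [hC1] at this
    rw [weight, ← this]
    norm_num

/-- The vertices of a simple cycle are as many as its edges. -/
theorem card_verts_of_isSimpleCycle {G : SimpleGraph (Fin N)} {C : G.Subgraph}
    (hC : IsSimpleCycle C) {S : Finset (Fin N)} (hS : (S : Set (Fin N)) = C.verts) :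
    #S = C.edgeSet.ncard ∧ 3 ≤ #S := by
  obtain ⟨c, hc, h3, hCE⟩ := exists_perm_of_isSimpleCycle hC hS
  have := ncard_cycle_edges hc h3 Subtype.val_injective hCE
  rw [this]
  simpa using h3

theorem principalMinor_singleton (K : Matrix (Fin N) (Fin N) ℝ) (i : Fin N) :
    principalMinor K {i} = K i i := by
  rw [principalMinor, Matrix.det_unique]
  rfl

theorem principalMinor_pair (K : Matrix (Fin N) (Fin N) ℝ) {i j : Fin N} (hij : i ≠ j) :
    principalMinor K {i, j} = K i i * K j j - K i j * K j i := by
  have hcard : Fintype.card ({i, j} : Finset (Fin N)) = 2 := by rw [Fintype.card_coe, card_pair hij]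
  let f : Fin 2 → ({i, j} : Finset (Fin N)) := ![⟨i, by simp⟩, ⟨j, by simp⟩]
  have hf : Function.Injective f := by
    intro a b hab
    have := congrArg Subtype.val hab
    fin_cases a <;> fin_cases b <;> simp [f, hij, hij.symm] at this ⊢
  let q : Fin 2 ≃ ({i, j} : Finset (Fin N)) := Equiv.ofBijective f
    ((Fintype.bijective_iff_injective_and_card _).2 ⟨hf, by rw [hcard]; simp⟩)
  rw [principalMinor, ← Matrix.det_submatrix_equiv_self q, Matrix.det_fin_two]
  rfl

/-- Magnitude-symmetric matrices with the same principal minors of order at most two differ by a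
sign change. -/
theorem exists_isSwitching (hK : IsMagnitudeSymmetric K) (hK' : IsMagnitudeSymmetric K')
    (h : ∀ S : Finset (Fin N), #S ≤ 2 → principalMinor K S = principalMinor K' S) :
    ∃ t, IsSwitching t K K' := by
  classical
  have hdiag : ∀ i, K' i i = K i i := fun i => by
    have := h {i} (by simp)
    rw [principalMinor_singleton, principalMinor_singleton] at this
    exact this.symm
  have hpair : ∀ i j, K' i j * K' j i = K i j * K j i := by
    intro i j
    by_cases hij : i = j
    · subst hij; rw [hdiag]
    · have := h {i, j} (by rw [card_pair hij])
      rw [principalMinor_pair K hij, principalMinor_pair K' hij, hdiag, hdiag] at this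
      linarith
  have habs : ∀ i j, K' i j = K i j ∨ K' i j = -K i j := by
    intro i j
    refine sq_eq_sq_iff_eq_or_eq_neg.1 ?_
    have := congrArg abs (hpair i j)
    rw [abs_mul, abs_mul, ← hK i j, ← hK' i j, abs_mul_abs_self, abs_mul_abs_self] at this
    rw [sq, sq, this]
  -- Opposing entries change sign together, because the minor of order two fixes their product. This
  -- makes the sign a function of the unordered pair.
  have hsymm : ∀ i j, K' i j = K i j → K' j i = K j i := by
    intro i j hij
    by_cases h0 : K i j = 0
    · have h1 : K j i = 0 := by
        have := hK i j
        rw [h0, abs_zero, eq_comm, abs_eq_zero] at this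
        exact this
      rcases habs j i with h2 | h2 <;> simp [h2, h1]
    · have := hpair i j
      rw [hij] at this
      exact mul_left_cancel₀ h0 this
  refine ⟨Sym2.lift ⟨fun i j => if K' i j = K i j then 1 else -1, fun i j => ?_⟩, ?_, ?_, ?_⟩
  · dsimp only
    by_cases hij : K' i j = K i j
    · rw [if_pos hij, if_pos (hsymm i j hij)]
    · rw [if_neg hij, if_neg fun hji => hij (hsymm j i hji)]
  · intro e
    induction e using Sym2.ind with
    | _ i j => simp only [Sym2.lift_mk]; split_ifs <;> simp
  · intro i
    simp [hdiag]
  · intro i j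
    simp only [Sym2.lift_mk]
    split_ifs with hij
    · rw [one_mul, hij]
    · rcases habs i j with h1 | h1
      · exact absurd h1 hij
      · rw [h1]; ring

/-- Genericity is invariant under sign changes. -/
theorem IsSwitching.mem_genericMagnitudeSymmetric (ht : IsSwitching t K K')
    (hK : K ∈ genericMagnitudeSymmetric N) : K' ∈ genericMagnitudeSymmetric N := by
  have habs : ∀ x y, |K' x y| = |K x y| := by
    intro x y
    rw [ht.entry, abs_mul]
    rcases ht.eq_or s(x, y) with h | h <;> simp [h]
  -- The signs acquired by a four-cycle are absorbed into the arbitrary signs `φ` of the genericity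
  -- condition.
  have hsign : ∀ e1 e2 e3 e4 φ, (φ = (1 : ℝ) ∨ φ = -1) →
      φ * (t e1 * t e2 * t e3 * t e4) = 1 ∨ φ * (t e1 * t e2 * t e3 * t e4) = -1 := by
    intro e1 e2 e3 e4 φ hφ
    rcases ht.eq_or e1 with h1 | h1 <;> rcases ht.eq_or e2 with h2 | h2 <;>
      rcases ht.eq_or e3 with h3 | h3 <;> rcases ht.eq_or e4 with h4 | h4 <;>
      rcases hφ with h5 | h5 <;> simp [h1, h2, h3, h4, h5]
  refine ⟨fun i j => by rw [habs, habs, hK.1], ?_⟩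
  intro i j k l a b c d f g hne
  have hne' : K i j * K j k * K k l * K l i ≠ 0 := by
    rw [← abs_ne_zero] at hne ⊢
    simpa only [abs_mul, habs] using hne
  obtain ⟨h1, h2⟩ := hK.2 i j k l a b c d f g hne'
  refine ⟨by simpa only [abs_mul, habs] using h1, ?_⟩
  intro φ₁ φ₂ φ₃ hφ₁ hφ₂ hφ₃ h0
  refine h2 _ _ _ (hsign s(i, j) s(j, k) s(k, l) s(l, i) φ₁ hφ₁)
    (hsign s(i, j) s(j, l) s(l, k) s(k, i) φ₂ hφ₂)
    (hsign s(i, k) s(k, j) s(j, l) s(l, i) φ₃ hφ₃) ?_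
  rw [← h0]
  simp only [ht.entry]
  ring

end Minors


/-! ### Two-connectedness and blocks -/

section Blocks

variable {V : Type*} {G : SimpleGraph V}

theorem IsTwoConnected.connected_deleteVerts {H : G.Subgraph} (hH : IsTwoConnected H) (v : V) :
    (H.deleteVerts {v}).Connected := by
  by_cases hv : v ∈ H.verts
  · exact hH.2.2 v hv
  · refine hH.2.1.mono ⟨fun x hx => ⟨hx, ?_⟩, fun x y hxy => ?_⟩ ?_
    · rintro rfl; exact hv hx
    · rw [SimpleGraph.Subgraph.deleteVerts_adj]
      exact ⟨H.edge_vert hxy, fun h => hv (h ▸ H.edge_vert hxy), H.edge_vert hxy.symm,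
        fun h => hv (h ▸ H.edge_vert hxy.symm), hxy⟩
    · rw [SimpleGraph.Subgraph.deleteVerts_verts, Set.sdiff_singleton_eq_self hv]

theorem deleteVerts_sup (H₁ H₂ : G.Subgraph) (s : Set V) :
    (H₁ ⊔ H₂).deleteVerts s = H₁.deleteVerts s ⊔ H₂.deleteVerts s := by
  refine SimpleGraph.Subgraph.ext ?_ ?_
  · simp [Set.union_sdiff_distrib]
  · funext x y
    have h1 : H₁.Adj x y → x ∈ H₁.verts ∧ y ∈ H₁.verts := fun h => ⟨h.fst_mem, h.snd_mem⟩
    have h2 : H₂.Adj x y → x ∈ H₂.verts ∧ y ∈ H₂.verts := fun h => ⟨h.fst_mem, h.snd_mem⟩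
    simp only [SimpleGraph.Subgraph.deleteVerts_adj, SimpleGraph.Subgraph.sup_adj,
      SimpleGraph.Subgraph.verts_sup, Set.mem_union, eq_iff_iff]
    tauto

/-- The union of two-connected subgraphs sharing two vertices is two-connected. -/
theorem IsTwoConnected.sup {H₁ H₂ : G.Subgraph} (h₁ : IsTwoConnected H₁) (h₂ : IsTwoConnected H₂)
    {x y : V} (hxy : x ≠ y) (hx₁ : x ∈ H₁.verts) (hy₁ : y ∈ H₁.verts) (hx₂ : x ∈ H₂.verts)
    (hy₂ : y ∈ H₂.verts) : IsTwoConnected (H₁ ⊔ H₂) := by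
  refine ⟨⟨x, Or.inl hx₁, y, Or.inl hy₁, hxy⟩, ?_, fun v _ => ?_⟩
  · exact SimpleGraph.Subgraph.connected_sup h₁.2.1.preconnected h₂.2.1.preconnected
      ⟨x, hx₁, hx₂⟩
  · rw [deleteVerts_sup]
    refine SimpleGraph.Subgraph.connected_sup (IsTwoConnected.connected_deleteVerts h₁ v).preconnected
      (IsTwoConnected.connected_deleteVerts h₂ v).preconnected ?_
    -- Removing one vertex leaves at least one of the shared vertices `x`, `y`, at which the
    -- remainders are still joined.
    by_cases h : x = v
    · exact ⟨y, ⟨hy₁, fun h' => hxy (h.trans h'.symm)⟩, ⟨hy₂, fun h' => hxy (h.trans h'.symm)⟩⟩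
    · exact ⟨x, ⟨hx₁, h⟩, ⟨hx₂, h⟩⟩

variable [Finite V]

/-- A simple cycle is two-connected. -/
theorem isTwoConnected_of_isSimpleCycle {C : G.Subgraph} (hC : IsSimpleCycle C) :
    IsTwoConnected C := by
  have key : ∀ v ∈ C.verts, (C.deleteVerts {v}).Connected ∧ C.verts.Nontrivial := by
    intro v hv
    obtain ⟨p, hp, rfl⟩ := exists_walk_of_isSimpleCycle hC hv
    -- Take the closed walk based at `v` and drop both of its ends: what is left is a path through
    -- all the other vertices.
    have hnil : ¬ p.tail.Nil := by
      rw [SimpleGraph.Walk.not_nil_iff_lt_length, SimpleGraph.Walk.length_tail]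
      have := hp.three_le_length
      omega
    have hpt := hp.isPath_tail
    have hsupp : p.tail.dropLast.support ++ [v] = p.tail.support :=
      SimpleGraph.Walk.support_dropLast_concat hnil
    have hsupp2 : v :: p.tail.support = p.support :=
      SimpleGraph.Walk.cons_support_tail hp.not_nil
    have hnd := hpt.support_nodup
    rw [← hsupp, List.nodup_append] at hnd
    have hv' : v ∉ p.tail.dropLast.support := fun h => hnd.2.2 v h v (by simp) rfl
    refine ⟨(p.tail.dropLast.toSubgraph_connected).mono ⟨?_, ?_⟩ ?_, ?_⟩
    · intro x hx
      rw [SimpleGraph.Walk.mem_verts_toSubgraph] at hx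
      refine ⟨?_, fun h => hv' (h ▸ hx)⟩
      rw [SimpleGraph.Walk.mem_verts_toSubgraph, ← hsupp2, ← hsupp]
      simp [hx]
    · intro x y hxy
      have hx := hxy.fst_mem
      have hy := hxy.snd_mem
      rw [SimpleGraph.Walk.mem_verts_toSubgraph] at hx hy
      have hadj : p.toSubgraph.Adj x y := by
        rw [← SimpleGraph.Subgraph.mem_edgeSet, SimpleGraph.Walk.mem_edges_toSubgraph] at hxy ⊢
        rw [SimpleGraph.Walk.edges_dropLast, SimpleGraph.Walk.edges_tail] at hxy
        exact List.mem_of_mem_tail (List.mem_of_mem_dropLast hxy)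
      rw [SimpleGraph.Subgraph.deleteVerts_adj]
      exact ⟨hadj.fst_mem, fun h => hv' (h ▸ hx), hadj.snd_mem, fun h => hv' (h ▸ hy), hadj⟩
    · ext x
      rw [SimpleGraph.Subgraph.deleteVerts_verts, SimpleGraph.Walk.mem_verts_toSubgraph,
        Set.mem_sdiff, SimpleGraph.Walk.mem_verts_toSubgraph, ← hsupp2, ← hsupp]
      simp only [List.mem_cons, List.mem_append, Set.mem_singleton_iff]
      constructor
      · exact fun h => ⟨Or.inr (Or.inl h), fun h' => hv' (h' ▸ h)⟩
      · rintro ⟨h | h | h | h, h'⟩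
        · exact absurd h h'
        · exact h
        · exact absurd h h'
        · exact absurd h (by simp)
    · refine ⟨v, by simp, p.snd, by simp, ?_⟩
      exact (p.adj_snd hp.not_nil).ne
  obtain ⟨u, hu⟩ := hC.1.nonempty
  exact ⟨(key u hu).2, hC.1, fun v hv => (key v hv).1⟩

/-- Every two-connected subgraph lies in a block. -/
theorem IsTwoConnected.exists_isBlock {C : G.Subgraph} (hC : IsTwoConnected C) :
    ∃ H, C ≤ H ∧ IsBlock H :=
  Finite.exists_le_maximal hC

/-- A simple cycle sharing an edge with a block lies in it. -/
theorem IsBlock.le_of_isSimpleCycle {H C : G.Subgraph} (hH : IsBlock H) (hC : IsSimpleCycle C)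
    {x y : V} (h₁ : H.Adj x y) (h₂ : C.Adj x y) : C ≤ H :=
  le_sup_right.trans (hH.2 (IsTwoConnected.sup hH.1 (isTwoConnected_of_isSimpleCycle hC) (H.adj_sub h₁).ne
    h₁.fst_mem h₁.snd_mem h₂.fst_mem h₂.snd_mem) le_sup_left)

end Blocks


/-! ### Potentials realized by pairs of paths, and ears -/

section Potential

variable {V : Type*} {Γ : SimpleGraph V} {l m : Sym2 V → ZMod 2} {t : ZMod 2}

/-- The sum of edge labels along a walk. -/
def walkSum (l : Sym2 V → ZMod 2) {u v : V} (p : Γ.Walk u v) : ZMod 2 := (p.edges.map l).sum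

@[simp]
theorem walkSum_nil (u : V) : walkSum l (SimpleGraph.Walk.nil : Γ.Walk u u) = 0 := rfl

@[simp]
theorem walkSum_cons {u v w : V} (h : Γ.Adj u v) (p : Γ.Walk v w) :
    walkSum l (SimpleGraph.Walk.cons h p) = l s(u, v) + walkSum l p := by
  simp [walkSum]

@[simp]
theorem walkSum_append {u v w : V} (p : Γ.Walk u v) (q : Γ.Walk v w) :
    walkSum l (p.append q) = walkSum l p + walkSum l q := by
  simp [walkSum]

@[simp]
theorem walkSum_reverse {u v : V} (p : Γ.Walk u v) : walkSum l p.reverse = walkSum l p := by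
  simp [walkSum]

theorem isPath_append {u v w : V} {p : Γ.Walk u v} {q : Γ.Walk v w} (hp : p.IsPath)
    (hq : q.IsPath) (h : ∀ z ∈ p.support, z ∈ q.support → z = v) : (p.append q).IsPath := by
  have hq' := hq.support_nodup
  rw [SimpleGraph.Walk.isPath_def, SimpleGraph.Walk.support_append, List.nodup_append']
  refine ⟨hp.support_nodup, hq'.tail, fun z hz hz' => ?_⟩
  obtain rfl := h z hz (List.mem_of_mem_tail hz')
  rw [← SimpleGraph.Walk.cons_tail_support] at hq'
  exact (List.nodup_cons.1 hq').1 hz'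

theorem exists_append_append {u v x y : V} {R : Γ.Walk u v} (hx : x ∈ R.support)
    (hy : y ∈ R.support) :
    (∃ (R₁ : Γ.Walk u x) (R₂ : Γ.Walk x y) (R₃ : Γ.Walk y v), R = R₁.append (R₂.append R₃)) ∨
      ∃ (R₁ : Γ.Walk u y) (R₂ : Γ.Walk y x) (R₃ : Γ.Walk x v), R = R₁.append (R₂.append R₃) := by
  obtain ⟨A, B, rfl⟩ := SimpleGraph.Walk.mem_support_iff_exists_append.1 hx
  rcases (SimpleGraph.Walk.mem_support_append_iff A B).1 hy with h | h
  · obtain ⟨R₁, R₂, rfl⟩ := SimpleGraph.Walk.mem_support_iff_exists_append.1 h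
    exact Or.inr ⟨R₁, R₂, B, (SimpleGraph.Walk.append_assoc _ _ _).symm⟩
  · obtain ⟨R₂, R₃, rfl⟩ := SimpleGraph.Walk.mem_support_iff_exists_append.1 h
    exact Or.inl ⟨A, R₂, R₃, rfl⟩

theorem disjoint_support_of_append_append {u v x y : V} {R₁ : Γ.Walk u x} {R₂ : Γ.Walk x y}
    {R₃ : Γ.Walk y v} (h : (R₁.append (R₂.append R₃)).IsPath) (hxy : x ≠ y) :
    R₁.support.Disjoint R₃.support := by
  intro z h1 h3
  by_cases hz : z = x
  · subst hz
    exact h.of_append_right.ne_of_mem_support_of_append hxy R₂.start_mem_support h3 rfl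
  · exact h.ne_of_mem_support_of_append hz h1
      ((SimpleGraph.Walk.mem_support_append_iff _ _).2 (Or.inr h3)) rfl

theorem walkSum_eq_of_append_eq {u v x : V} {R₁ R₁' : Γ.Walk u x} {R₂ R₂' : Γ.Walk x v}
    (hR : (R₁.append R₂).IsPath) (h : R₁.append R₂ = R₁'.append R₂') :
    walkSum l R₂ = walkSum l R₂' := by
  have hlen : R₁.length = R₁'.length := by
    have h1 : (R₁.append R₂).getVert R₁.length = x := by
      simp [SimpleGraph.Walk.getVert_append]
    have h2 : (R₁.append R₂).getVert R₁'.length = x := by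
      rw [h]; simp [SimpleGraph.Walk.getVert_append]
    refine hR.getVert_injOn ?_ ?_ (h1.trans h2.symm)
    · simp
    · rw [h]; simp
  have he := congrArg SimpleGraph.Walk.edges h
  rw [SimpleGraph.Walk.edges_append, SimpleGraph.Walk.edges_append] at he
  rw [walkSum, walkSum, (List.append_inj he (by simpa using hlen)).2]

/-- The labels of the final segments of a path define a function on its vertices. -/
theorem exists_potential_of_isPath {u v : V} {R : Γ.Walk u v} (hR : R.IsPath) (c : ZMod 2) :
    ∃ p : V → ZMod 2, ∀ x (R₁ : Γ.Walk u x) (R₂ : Γ.Walk x v), R = R₁.append R₂ →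
      p x = c + walkSum l R₂ := by
  classical
  refine ⟨fun x => if h : ∃ (R₁ : Γ.Walk u x) (R₂ : Γ.Walk x v), R = R₁.append R₂ then
    c + walkSum l h.choose_spec.choose else 0, fun x R₁ R₂ h => ?_⟩
  have hex : ∃ (R₁ : Γ.Walk u x) (R₂ : Γ.Walk x v), R = R₁.append R₂ := ⟨R₁, R₂, h⟩
  simp only [dif_pos hex]
  have := hex.choose_spec.choose_spec
  rw [walkSum_eq_of_append_eq (this ▸ hR) (this.symm.trans h)]

/-- Two paths in `U` from `u` to `v` whose `l`-sum is `c` and whose `m`-sums differ by `t`. -/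
def HasPathPair (Γ : SimpleGraph V) (l m : Sym2 V → ZMod 2) (t : ZMod 2) (U : Set V) (c : ZMod 2)
    (u v : V) : Prop :=
  ∃ Q Q' : Γ.Walk u v, Q.IsPath ∧ Q'.IsPath ∧ (∀ z ∈ Q.support, z ∈ U) ∧
    (∀ z ∈ Q'.support, z ∈ U) ∧ walkSum l Q = c ∧ walkSum l Q' = c ∧
    walkSum m Q' = walkSum m Q + t

theorem HasPathPair.symm {U : Set V} {c : ZMod 2} {u v : V} (h : HasPathPair Γ l m t U c u v) :
    HasPathPair Γ l m t U c v u := by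
  obtain ⟨Q, Q', h1, h2, h3, h4, h5, h6, h7⟩ := h
  exact ⟨Q.reverse, Q'.reverse, h1.reverse, h2.reverse, by simpa using h3, by simpa using h4,
    by simpa using h5, by simpa using h6, by simpa using h7⟩

theorem HasPathPair.extend {U U' : Set V} {c : ZMod 2} {a b x y : V}
    (h : HasPathPair Γ l m t U c a b) (hU : U ⊆ U') {A : Γ.Walk x a} {B : Γ.Walk b y}
    (hA : A.IsPath) (hB : B.IsPath) (hAU : ∀ z ∈ A.support, z ∈ U → z = a)
    (hBU : ∀ z ∈ B.support, z ∈ U → z = b) (hAB : A.support.Disjoint B.support)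
    (hA' : ∀ z ∈ A.support, z ∈ U') (hB' : ∀ z ∈ B.support, z ∈ U') :
    HasPathPair Γ l m t U' (walkSum l A + c + walkSum l B) x y := by
  have key : ∀ Q : Γ.Walk a b, Q.IsPath → (∀ z ∈ Q.support, z ∈ U) →
      (A.append (Q.append B)).IsPath ∧ ∀ z ∈ (A.append (Q.append B)).support, z ∈ U' := by
    intro Q hQ hQU
    refine ⟨isPath_append hA (isPath_append hQ hB fun z h1 h2 => hBU z h2 (hQU z h1)) ?_, ?_⟩
    · intro z h1 h2
      rcases (SimpleGraph.Walk.mem_support_append_iff _ _).1 h2 with h2 | h2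
      · exact hAU z h1 (hQU z h2)
      · exact absurd h2 (hAB h1)
    · intro z hz
      simp only [SimpleGraph.Walk.mem_support_append_iff] at hz
      rcases hz with h | h | h
      exacts [hA' z h, hU (hQU z h), hB' z h]
  obtain ⟨Q, Q', h1, h2, h3, h4, h5, h6, h7⟩ := h
  refine ⟨_, _, (key Q h1 h3).1, (key Q' h2 h4).1, (key Q h1 h3).2, (key Q' h2 h4).2, ?_, ?_, ?_⟩
  · rw [walkSum_append, walkSum_append, h5, add_assoc]
  · rw [walkSum_append, walkSum_append, h6, add_assoc]
  · rw [walkSum_append, walkSum_append, walkSum_append, walkSum_append, h7]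
    ring

/-- `p` is a potential on `U` realized by pairs of paths. -/
def IsPathPotential (Γ : SimpleGraph V) (l m : Sym2 V → ZMod 2) (t : ZMod 2) (U : Set V)
    (p : V → ZMod 2) : Prop :=
  ∀ u ∈ U, ∀ v ∈ U, u ≠ v → HasPathPair Γ l m t U (p u + p v) u v

/-- Cycles with the same `l`-sum and `m`-sums differing by `t` have trivial `l`-sum. -/
def CyclePairsTrivial (Γ : SimpleGraph V) (l m : Sym2 V → ZMod 2) (t : ZMod 2) : Prop :=
  ∀ (u : V) (Z Z' : Γ.Walk u u), Z.IsCycle → Z'.IsCycle → walkSum l Z = walkSum l Z' →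
    walkSum m Z' = walkSum m Z + t → walkSum l Z = 0

/-- Closing `R` by either path of the pair gives two cycles with equal `l`-sums and with `m`-sums
differing by `t`, so the common `l`-sum is zero. A length above one ensures that these are genuine
cycles and not a doubled edge. -/
theorem HasPathPair.walkSum_eq (hcyc : CyclePairsTrivial Γ l m t) {U : Set V} {c : ZMod 2}
    {u v : V} (h : HasPathPair Γ l m t U c v u) {R : Γ.Walk u v} (hR : R.IsPath)
    (hRU : ∀ z ∈ R.support, z ∈ U → z = u ∨ z = v) (hlen : 1 < R.length) : walkSum l R = c := by
  obtain ⟨Q, Q', h1, h2, h3, h4, h5, h6, h7⟩ := h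
  have key : ∀ Q : Γ.Walk v u, Q.IsPath → (∀ z ∈ Q.support, z ∈ U) → (R.append Q).IsCycle := by
    intro Q hQ hQU
    refine hR.isCycle_append hQ (fun z hz hz' => ?_) (Or.inl hlen)
    have hRn := hR.support_nodup
    have hQn := hQ.support_nodup
    rw [← SimpleGraph.Walk.cons_tail_support, List.nodup_cons] at hRn hQn
    rcases hRU z (List.mem_of_mem_tail hz) (hQU z (List.mem_of_mem_tail hz')) with rfl | rfl
    · exact hRn.1 hz
    · exact hQn.1 hz'
  have := hcyc u (R.append Q) (R.append Q') (key Q h1 h3) (key Q' h2 h4) (by simp [h5, h6])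
    (by simp [h7, add_assoc])
  rw [walkSum_append, h5] at this
  exact CharTwo.add_eq_zero.1 this

/-- A path potential extends along an ear. -/
theorem IsPathPotential.exists_ear (hcyc : CyclePairsTrivial Γ l m t) {U : Set V}
    {p : V → ZMod 2} (hp : IsPathPotential Γ l m t U p) {u v : V} (hu : u ∈ U) (hv : v ∈ U)
    (huv : u ≠ v) {R : Γ.Walk u v} (hR : R.IsPath)
    (hRU : ∀ z ∈ R.support, z ∈ U → z = u ∨ z = v) (hlen : 1 < R.length) :
    ∃ p', IsPathPotential Γ l m t (U ∪ {z | z ∈ R.support}) p' := by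
  classical
  have h2 : (2 : ZMod 2) = 0 := rfl
  obtain ⟨p₀, hp₀⟩ := exists_potential_of_isPath (l := l) hR (p v)
  have hRsum : walkSum l R = p v + p u := (hp v hv u hu huv.symm).walkSum_eq hcyc hR hRU hlen
  -- On the ear, the potential is the value at `v` plus the label of the final segment. It fits at
  -- `u` because of `hRsum`.
  let p' : V → ZMod 2 := fun z => if z ∈ U then p z else p₀ z
  have hpU : ∀ z ∈ U, p' z = p z := fun z hz => if_pos hz
  have hpR : ∀ x, x ∉ U → ∀ (R₁ : Γ.Walk u x) (R₂ : Γ.Walk x v), R = R₁.append R₂ →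
      p' x = p v + walkSum l R₂ := fun x hx R₁ R₂ h => by
    simp only [p', if_neg hx]; exact hp₀ x R₁ R₂ h
  have hleft : ∀ x, x ∉ U → ∀ (R₁ : Γ.Walk u x) (R₂ : Γ.Walk x v), R = R₁.append R₂ →
      ∀ z ∈ R₁.support, z ∈ U → z = u := by
    intro x hx R₁ R₂ h z hz hzU
    refine (hRU z (by rw [h, SimpleGraph.Walk.mem_support_append_iff]; exact Or.inl hz) hzU).resolve_right ?_
    rintro rfl
    refine (h ▸ hR).ne_of_mem_support_of_append ?_ hz R₂.end_mem_support rfl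
    rintro rfl; exact hx hv
  have hright : ∀ x, x ∉ U → ∀ (R₁ : Γ.Walk u x) (R₂ : Γ.Walk x v), R = R₁.append R₂ →
      ∀ z ∈ R₂.support, z ∈ U → z = v := by
    intro x hx R₁ R₂ h z hz hzU
    refine (hRU z (by rw [h, SimpleGraph.Walk.mem_support_append_iff]; exact Or.inr hz) hzU).resolve_left ?_
    rintro rfl
    refine (h ▸ hR).ne_of_mem_support_of_append ?_ R₁.start_mem_support hz rfl
    rintro rfl; exact hx hu
  have hone : ∀ x ∈ R.support, x ∉ U → ∀ y ∈ U,
      HasPathPair Γ l m t (U ∪ {z | z ∈ R.support}) (p' x + p' y) x y := by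
    intro x hx hxU y hy
    obtain ⟨R₁, R₂, h⟩ := SimpleGraph.Walk.mem_support_iff_exists_append.1 hx
    have hP₁ : R₁.IsPath := (h ▸ hR).of_append_left
    have hP₂ : R₂.IsPath := (h ▸ hR).of_append_right
    have hs₁ : ∀ z ∈ R₁.support, z ∈ R.support := fun z hz => by
      rw [h, SimpleGraph.Walk.mem_support_append_iff]; exact Or.inl hz
    have hs₂ : ∀ z ∈ R₂.support, z ∈ R.support := fun z hz => by
      rw [h, SimpleGraph.Walk.mem_support_append_iff]; exact Or.inr hz
    rw [hpU y hy, hpR x hxU R₁ R₂ h]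
    -- From a new vertex one follows the ear to an end different from `y` and continues with an old
    -- pair. The end `v` serves unless `y = v`, and then `u` does.
    by_cases hyv : y = v
    · subst hyv
      convert (hp u hu y hv huv).extend (Set.subset_union_left (t := {z | z ∈ R.support}))
        (A := R₁.reverse) (B := SimpleGraph.Walk.nil) hP₁.reverse SimpleGraph.Walk.IsPath.nil ?_
        ?_ ?_ ?_ ?_ using 1
      · rw [h, walkSum_append] at hRsum
        rw [walkSum_reverse, walkSum_nil]
        linear_combination hRsum + (p y - walkSum l R₁) * h2
      · intro z hz; exact hleft x hxU R₁ R₂ h z (by simpa using hz)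
      · intro z hz _; simpa using hz
      · intro z hz hz'
        obtain rfl : z = y := by simpa using hz'
        exact huv.symm (hleft x hxU R₁ R₂ h z (by simpa using hz) hv)
      · intro z hz; exact Or.inr (hs₁ z (by simpa using hz))
      · intro z hz; left; obtain rfl : z = y := by simpa using hz
        exact hv
    · convert (hp v hv y hy (Ne.symm hyv)).extend
        (Set.subset_union_left (t := {z | z ∈ R.support}))
        (A := R₂) (B := SimpleGraph.Walk.nil) hP₂ SimpleGraph.Walk.IsPath.nil ?_
        ?_ ?_ ?_ ?_ using 1
      · rw [walkSum_nil]; ring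
      · exact hright x hxU R₁ R₂ h
      · intro z hz _; simpa using hz
      · intro z hz hz'
        obtain rfl : z = y := by simpa using hz'
        exact hyv (hright x hxU R₁ R₂ h z hz hy)
      · intro z hz; exact Or.inr (hs₂ z hz)
      · intro z hz; left; obtain rfl : z = y := by simpa using hz
        exact hy
  -- For two new vertices, the pair runs outwards to both ends of the ear and uses the old pair from
  -- `u` to `v`, avoiding the segment of the ear between them.
  have htwo : ∀ x y, x ∉ U → y ∉ U → x ≠ y → ∀ (R₁ : Γ.Walk u x) (R₂ : Γ.Walk x y)
      (R₃ : Γ.Walk y v), R = R₁.append (R₂.append R₃) →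
      HasPathPair Γ l m t (U ∪ {z | z ∈ R.support}) (p' x + p' y) x y := by
    intro x y hxU hyU hxy R₁ R₂ R₃ h
    have h' : R = (R₁.append R₂).append R₃ := h.trans (SimpleGraph.Walk.append_assoc _ _ _)
    have hP₁ : R₁.IsPath := (h ▸ hR).of_append_left
    have hP₃ : R₃.IsPath := (h' ▸ hR).of_append_right
    rw [hpR x hxU _ _ h, hpR y hyU _ _ h']
    convert (hp u hu v hv huv).extend (Set.subset_union_left (t := {z | z ∈ R.support}))
        (A := R₁.reverse) (B := R₃.reverse) hP₁.reverse hP₃.reverse ?_ ?_ ?_ ?_ ?_ using 1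
    · rw [h, walkSum_append, walkSum_append] at hRsum
      rw [walkSum_reverse, walkSum_reverse, walkSum_append]
      linear_combination hRsum + (p v - walkSum l R₁) * h2
    · intro z hz; exact hleft x hxU _ _ h z (by simpa using hz)
    · intro z hz; exact hright y hyU _ _ h' z (by simpa using hz)
    · intro z hz hz'
      exact disjoint_support_of_append_append (h ▸ hR) hxy (by simpa using hz) (by simpa using hz')
    · intro z hz; right
      rw [h]; simp only [Set.mem_ofPred_eq, SimpleGraph.Walk.mem_support_append_iff]
      exact Or.inl (by simpa using hz)
    · intro z hz; right
      rw [h]; simp only [Set.mem_ofPred_eq, SimpleGraph.Walk.mem_support_append_iff]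
      exact Or.inr (Or.inr (by simpa using hz))
  refine ⟨p', fun x hx y hy hxy => ?_⟩
  by_cases hxU : x ∈ U <;> by_cases hyU : y ∈ U
  · obtain ⟨Q, Q', h1, h2, h3, h4, h5⟩ := hp x hxU y hyU hxy
    rw [hpU x hxU, hpU y hyU]
    exact ⟨Q, Q', h1, h2, fun z hz => Or.inl (h3 z hz), fun z hz => Or.inl (h4 z hz), h5⟩
  · rw [add_comm]
    exact (hone y (hy.resolve_left hyU) hyU x hxU).symm
  · exact hone x (hx.resolve_left hxU) hxU y hyU
  · rcases exists_append_append (hx.resolve_left hxU) (hy.resolve_left hyU) with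
      ⟨R₁, R₂, R₃, h⟩ | ⟨R₁, R₂, R₃, h⟩
    · exact htwo x y hxU hyU hxy R₁ R₂ R₃ h
    · rw [add_comm]
      exact (htwo y x hyU hxU hxy.symm R₁ R₂ R₃ h).symm

/-- The starting point for `t = 0`, where both paths of a pair may be the same. -/
theorem isPathPotential_edge {u v : V} (h : Γ.Adj u v) :
    ∃ p, IsPathPotential Γ l m 0 {u, v} p := by
  classical
  have key : HasPathPair Γ l m 0 {u, v} (l s(u, v)) u v :=
    ⟨h.toWalk, h.toWalk, .of_adj h, .of_adj h, by simp, by simp, by simp, by simp, by simp⟩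
  refine ⟨fun z => if z = v then l s(u, v) else 0, ?_⟩
  rintro x (rfl | rfl) y (rfl | rfl) hxy
  · exact absurd rfl hxy
  · simpa [hxy] using key
  · simpa [hxy, h.ne] using key.symm
  · exact absurd rfl hxy

/-- The pair consists of the two arcs of the cycle. Their `l`-sums agree since the total is zero,
and their `m`-sums differ by the total `t`. -/
theorem isPathPotential_cycle {x w : V} {h : Γ.Adj x w} {q : Γ.Walk w x}
    (hq : (SimpleGraph.Walk.cons h q).IsCycle) (hl : walkSum l (SimpleGraph.Walk.cons h q) = 0)
    (hm : walkSum m (SimpleGraph.Walk.cons h q) = t) :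
    ∃ p, IsPathPotential Γ l m t {z | z ∈ q.support} p := by
  have h2 : (2 : ZMod 2) = 0 := rfl
  have hqp : q.IsPath := ((SimpleGraph.Walk.cons_isCycle_iff q h).1 hq).1
  obtain ⟨p, hp⟩ := exists_potential_of_isPath (l := l) hqp 0
  have htwo : ∀ y z, y ≠ z → ∀ (R₁ : Γ.Walk w y) (R₂ : Γ.Walk y z)
      (R₃ : Γ.Walk z x), q = R₁.append (R₂.append R₃) →
      HasPathPair Γ l m t {z | z ∈ q.support} (p y + p z) y z := by
    intro y z hyz R₁ R₂ R₃ e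
    have e' : q = (R₁.append R₂).append R₃ := e.trans (SimpleGraph.Walk.append_assoc _ _ _)
    have hP₁ : R₁.IsPath := (e ▸ hqp).of_append_left
    have hP₂ : R₂.IsPath := (e ▸ hqp).of_append_right.of_append_left
    have hP₃ : R₃.IsPath := (e' ▸ hqp).of_append_right
    have hdisj := disjoint_support_of_append_append (e ▸ hqp) hyz
    have hs : ∀ a, a ∈ R₁.support ∨ a ∈ R₂.support ∨ a ∈ R₃.support → a ∈ q.support := by
      intro a ha
      rw [e]
      simpa only [SimpleGraph.Walk.mem_support_append_iff] using ha
    rw [hp y _ _ e, hp z _ _ e']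
    rw [walkSum_cons, e, walkSum_append, walkSum_append] at hl hm
    refine ⟨R₂, R₁.reverse.append (SimpleGraph.Walk.cons h.symm R₃.reverse), hP₂,
      isPath_append hP₁.reverse ?_ ?_, fun a ha => hs a (Or.inr (Or.inl ha)), ?_, ?_, ?_, ?_⟩
    · refine hP₃.reverse.cons fun hw => ?_
      exact hdisj R₁.start_mem_support (by simpa using hw)
    · intro a ha ha'
      rw [SimpleGraph.Walk.support_cons, List.mem_cons] at ha'
      rcases ha' with ha' | ha'
      · exact ha'
      · exact absurd (by simpa using ha') (hdisj (by simpa using ha))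
    · intro a ha
      simp only [SimpleGraph.Walk.mem_support_append_iff, SimpleGraph.Walk.support_reverse,
        List.mem_reverse, SimpleGraph.Walk.support_cons, List.mem_cons] at ha
      rcases ha with ha | rfl | ha
      · exact hs a (Or.inl ha)
      · exact hs _ (Or.inl R₁.start_mem_support)
      · exact hs a (Or.inr (Or.inr ha))
    · rw [walkSum_append]
      linear_combination -walkSum l R₃ * h2
    · rw [walkSum_append, walkSum_reverse, walkSum_cons, walkSum_reverse, Sym2.eq_swap,
        walkSum_append]
      linear_combination hl - (walkSum l R₂ + walkSum l R₃) * h2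
    · rw [walkSum_append, walkSum_reverse, walkSum_cons, walkSum_reverse, Sym2.eq_swap]
      linear_combination hm - walkSum m R₂ * h2
  refine ⟨p, fun y hy z hz hyz => ?_⟩
  rcases exists_append_append hy hz with ⟨R₁, R₂, R₃, e⟩ | ⟨R₁, R₂, R₃, e⟩
  · exact htwo y z hyz R₁ R₂ R₃ e
  · rw [add_comm]
    exact (htwo z y hyz.symm R₁ R₂ R₃ e).symm

end Potential


/-! ### Growing a potential over a two-connected graph -/

section Growth

variable {V : Type*} {Γ : SimpleGraph V} {l m : Sym2 V → ZMod 2} {t : ZMod 2}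

/-- Any two vertices of `W` are joined by a walk avoiding any given third vertex. -/
def IsRobust (Γ : SimpleGraph V) (W : Set V) : Prop :=
  ∀ a, ∀ x ∈ W, ∀ y ∈ W, x ≠ a → y ≠ a → ∃ p : Γ.Walk x y, a ∉ p.support

variable [Finite V]

/-- Leave `U` along an edge from `u` to `w`, walk from `w` to another vertex of `U` while avoiding
`u`, and stop at the first vertex of `U` that is met. -/
theorem exists_ear {W U : Set V} (hW : IsRobust Γ W) (hΓ : ∀ x y, Γ.Adj x y → x ∈ W) (hUW : U ⊆ W)
    (hU : U.Nontrivial) {y : V} (hy : y ∈ W) (hyU : y ∉ U) :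
    ∃ u ∈ U, ∃ v ∈ U, u ≠ v ∧ ∃ R : Γ.Walk u v, R.IsPath ∧
      (∀ z ∈ R.support, z ∈ U → z = u ∨ z = v) ∧ 1 < R.length ∧ ∃ z ∈ R.support, z ∉ U := by
  classical
  obtain ⟨a, ha, b, hb, hab⟩ := hU
  obtain ⟨p, -⟩ := hW b a (hUW ha) y hy hab (fun h => hyU (h ▸ hb))
  obtain ⟨d, -, hdU, hdU'⟩ := p.exists_boundary_dart U ha hyU
  obtain ⟨⟨u, w⟩, huw⟩ := d
  dsimp only at hdU hdU' huw
  obtain ⟨c, hc, hcu⟩ : ∃ c ∈ U, c ≠ u := by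
    by_cases h : a = u
    · exact ⟨b, hb, fun h' => hab (h.trans h'.symm)⟩
    · exact ⟨a, ha, h⟩
  obtain ⟨q, hq⟩ := hW u w (hΓ w u huw.symm) c (hUW hc) huw.ne.symm hcu
  have hqb : u ∉ q.bypass.support := fun h => hq (q.support_bypass_subset_support h)
  obtain ⟨v, hvU, hv, hfirst⟩ := q.bypass.exists_mem_support_forall_mem_support_imp_eq
    U.toFinite.toFinset ⟨c, by simp [hc]⟩
  have hvU : v ∈ U := by simpa using hvU
  have hsub : ∀ z ∈ (q.bypass.takeUntil v hv).support, z ∈ q.bypass.support :=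
    fun z hz => q.bypass.support_takeUntil_subset_support hv hz
  have hu' : u ∉ (q.bypass.takeUntil v hv).support := fun h => hqb (hsub _ h)
  refine ⟨u, hdU, v, hvU, fun h => hqb (h ▸ hv),
    SimpleGraph.Walk.cons huw (q.bypass.takeUntil v hv),
    (q.bypass_isPath.takeUntil hv).cons hu', ?_, ?_, w, by simp, hdU'⟩
  · intro z hz hzU
    rw [SimpleGraph.Walk.support_cons, List.mem_cons] at hz
    exact hz.imp id fun h => hfirst z (by simpa using hzU) h
  · rw [SimpleGraph.Walk.length_cons]
    have : (q.bypass.takeUntil v hv).length ≠ 0 := fun h =>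
      hdU' (SimpleGraph.Walk.eq_of_length_eq_zero h ▸ hvU)
    omega

/-- A maximal set carrying a path potential must be all of `W`, since otherwise an ear would enlarge
it. -/
theorem exists_isPathPotential {W U₀ : Set V} (hW : IsRobust Γ W)
    (hΓ : ∀ x y, Γ.Adj x y → x ∈ W) (hcyc : CyclePairsTrivial Γ l m t) (hU₀W : U₀ ⊆ W)
    (hU₀ : U₀.Nontrivial) (h₀ : ∃ p, IsPathPotential Γ l m t U₀ p) :
    ∃ p, IsPathPotential Γ l m t W p := by
  obtain ⟨U, hU₀U, hU⟩ := Finite.exists_le_maximal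
    (p := fun U : Set V => U ⊆ W ∧ ∃ p, IsPathPotential Γ l m t U p) ⟨hU₀W, h₀⟩
  obtain ⟨⟨hUW, p, hp⟩, hmax⟩ := hU
  by_cases h : W ⊆ U
  · exact ⟨p, Set.Subset.antisymm hUW h ▸ hp⟩
  · obtain ⟨y, hy, hyU⟩ := Set.not_subset.1 h
    obtain ⟨u, hu, v, hv, huv, R, hR, hRU, hlen, z, hz, hzU⟩ :=
      exists_ear hW hΓ hUW (hU₀.mono hU₀U) hy hyU
    refine absurd (hmax ⟨?_, hp.exists_ear hcyc hu hv huv hR hRU hlen⟩ Set.subset_union_left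
      (Or.inr hz)) hzU
    rintro a (ha | ha)
    · exact hUW ha
    · by_cases hau : a = u
      · exact hau ▸ hUW hu
      · have hn : ¬ R.Nil := fun h => huv h.eq
        by_contra haW
        obtain ⟨A, B, h⟩ := SimpleGraph.Walk.mem_support_iff_exists_append.1 ha
        have hA : ¬ A.Nil := fun h => hau h.eq.symm
        exact haW (hΓ _ _ (A.adj_penultimate hA).symm)

/-- A labelling with a path potential on all vertices is a coboundary. -/
theorem IsPathPotential.label_eq {W : Set V} (hΓ : ∀ x y, Γ.Adj x y → x ∈ W)
    (hcyc : CyclePairsTrivial Γ l m t) {p : V → ZMod 2} (hp : IsPathPotential Γ l m t W p) {x y : V}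
    (h : Γ.Adj x y) : l s(x, y) = p x + p y := by
  obtain ⟨Q, Q', h1, h2, -, -, h5, h6, h7⟩ := hp y (hΓ _ _ h.symm) x (hΓ _ _ h) h.ne.symm
  -- A path joining the ends of the edge either is that edge, and then reads off its label, or
  -- closes with it to a cycle. If both paths of the pair close to cycles, `hcyc` applies.
  have key : ∀ Q : Γ.Walk y x, Q.IsPath → walkSum l Q = p y + p x →
      l s(x, y) = p x + p y ∨ (SimpleGraph.Walk.cons h Q).IsCycle := by
    intro Q hQ hs
    by_cases he : s(x, y) ∈ Q.edges
    · left
      rw [hQ.eq_adj_toWalk_of_mem_edges (Sym2.eq_swap ▸ he)] at hs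
      rw [Sym2.eq_swap, add_comm, ← hs]
      simp [SimpleGraph.Adj.toWalk]
    · exact Or.inr ((SimpleGraph.Walk.cons_isCycle_iff Q h).2 ⟨hQ, he⟩)
  rcases key Q h1 h5 with h8 | h8
  · exact h8
  rcases key Q' h2 h6 with h9 | h9
  · exact h9
  have := hcyc x _ _ h8 h9 (by simp [h5, h6]) (by simp [h7, add_assoc])
  rw [walkSum_cons, h5] at this
  rw [CharTwo.add_eq_zero.1 this, add_comm]

/-- If `f` vanishes on the cycles with trivial `g`-sum, then either `f` or `f + g` is a
coboundary. -/
theorem exists_coboundary {W : Set V} (hW : IsRobust Γ W) (hΓ : ∀ x y, Γ.Adj x y → x ∈ W)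
    {f g : Sym2 V → ZMod 2}
    (hfg : ∀ (u : V) (Z : Γ.Walk u u), Z.IsCycle → walkSum g Z = 0 → walkSum f Z = 0) :
    ∃ c : ZMod 2, ∃ p : V → ZMod 2, ∀ x y, Γ.Adj x y → f s(x, y) + c * g s(x, y) = p x + p y := by
  have hadd : ∀ (u v : V) (Z : Γ.Walk u v),
      walkSum (fun e => f e + g e) Z = walkSum f Z + walkSum g Z := by
    intro u v Z
    simp [walkSum, List.sum_map_add]
  have hz2 : ∀ a : ZMod 2, a ≠ 0 → a = 1 := by decide
  -- If `f` vanishes on all cycles, it is itself the coboundary and a single edge starts the growth.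
  -- Otherwise some cycle has `f`-sum and `g`-sum one, so `f + g` vanishes on it and its two arcs
  -- start the growth with `t = 1`.
  by_cases hall : ∀ (u : V) (Z : Γ.Walk u u), Z.IsCycle → walkSum f Z = 0
  · by_cases hedge : ∃ x y, Γ.Adj x y
    · obtain ⟨x, y, hxy⟩ := hedge
      have hcyc : CyclePairsTrivial Γ f g 0 := fun u Z _ hZ _ _ _ => hall u Z hZ
      obtain ⟨p, hp⟩ := exists_isPathPotential hW hΓ hcyc (U₀ := {x, y})
        (by rintro z (rfl | rfl); exacts [hΓ _ _ hxy, hΓ _ _ hxy.symm])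
        (Set.nontrivial_pair hxy.ne) (isPathPotential_edge hxy)
      exact ⟨0, p, fun a b hab => by rw [zero_mul, add_zero]; exact hp.label_eq hΓ hcyc hab⟩
    · exact ⟨0, 0, fun x y h => absurd ⟨x, y, h⟩ hedge⟩
  · push Not at hall
    obtain ⟨x, Z, hZ, hfZ⟩ := hall
    have hgZ : walkSum g Z = 1 := hz2 _ fun h => hfZ (hfg x Z hZ h)
    replace hfZ := hz2 _ hfZ
    -- Of two cycles with different `g`-sums, one has `g`-sum zero and hence also `f`-sum zero. The
    -- common sum of `f + g` is then zero.
    have hcyc : CyclePairsTrivial Γ (fun e => f e + g e) g 1 := by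
      intro u Z Z' hZ hZ' h1 h2
      by_cases h : walkSum g Z = 0
      · rw [hadd, h, hfg u Z hZ h, add_zero]
      · rw [hz2 _ h] at h2
        have h2 : walkSum g Z' = 0 := h2
        rw [h1, hadd, h2, hfg u Z' hZ' h2, add_zero]
    cases Z with
    | nil => exact absurd hZ (by simp)
    | cons h q =>
      have hsub : {z | z ∈ q.support} ⊆ W := by
        intro a ha
        by_cases hax : a = x
        · exact hax ▸ hΓ _ _ h
        · obtain ⟨A, B, -⟩ := SimpleGraph.Walk.mem_support_iff_exists_append.1 ha
          exact hΓ _ _ (B.adj_snd fun h => hax h.eq)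
      obtain ⟨p, hp⟩ := exists_isPathPotential hW hΓ hcyc hsub
        ⟨_, q.start_mem_support, _, q.end_mem_support, h.ne.symm⟩
        (isPathPotential_cycle hZ (by rw [hadd, hfZ, hgZ]; rfl) hgZ)
      exact ⟨1, p, fun a b hab => by rw [one_mul]; exact hp.label_eq hΓ hcyc hab⟩

end Growth


/-! ### Edge sums, linear functionals and coboundaries -/

section EdgeSum

variable {V : Type*} [Finite V] {G : SimpleGraph V}

/-- The sum of the labels of the edges of a subgraph. -/
noncomputable def edgeSum (f : Sym2 V → ZMod 2) (C : G.Subgraph) : ZMod 2 :=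
  ∑ e ∈ C.edgeSet.toFinite.toFinset, f e

/-- The sign `±1` corresponding to an element of `GF(2)`. -/
def signOf (z : ZMod 2) : ℤ := if z = 0 then 1 else -1

theorem signOf_add : ∀ a b : ZMod 2, signOf (a + b) = signOf a * signOf b := by decide

theorem signOf_eq_one_iff : ∀ a : ZMod 2, signOf a = 1 ↔ a = 0 := by decide

theorem signOf_sum {ι : Type*} (s : Finset ι) (f : ι → ZMod 2) :
    signOf (∑ i ∈ s, f i) = ∏ i ∈ s, signOf (f i) := by
  classical
  induction s using Finset.induction_on with
  | empty => rfl
  | insert a s ha ih => rw [sum_insert ha, prod_insert ha, signOf_add, ih]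

open Classical in
theorem sum_incidenceVector_mul [Fintype G.edgeSet] (C : G.Subgraph) (f : Sym2 V → ZMod 2) :
    ∑ e : G.edgeSet, incidenceVector C e * f e = edgeSum f C := by
  have h1 : ∀ e : G.edgeSet, incidenceVector C e * f e =
      if (e : Sym2 V) ∈ C.edgeSet then f e else 0 := by
    intro e
    simp [incidenceVector, Set.indicator_apply]
  rw [sum_congr rfl fun e _ => h1 e, ← sum_filter, edgeSum]
  refine sum_nbij (fun e => (e : Sym2 V)) ?_ ?_ ?_ ?_
  · intro e he; simpa using he
  · intro e _ e' _ h; exact Subtype.ext h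
  · intro e he
    have he : e ∈ C.edgeSet := by simpa using he
    exact ⟨⟨e, C.edgeSet_subset he⟩, by simpa using he, rfl⟩
  · intro e _; rfl

open Classical in
/-- The edge labelling given by a linear functional. -/
noncomputable def functionalLabel (φ : (G.edgeSet → ZMod 2) →ₗ[ZMod 2] ZMod 2) (e : Sym2 V) :
    ZMod 2 :=
  if h : e ∈ G.edgeSet then φ (Pi.single ⟨e, h⟩ 1) else 0

theorem functional_incidenceVector (φ : (G.edgeSet → ZMod 2) →ₗ[ZMod 2] ZMod 2) (C : G.Subgraph) :
    φ (incidenceVector C) = edgeSum (functionalLabel φ) C := by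
  classical
  have := Fintype.ofFinite G.edgeSet
  rw [← sum_incidenceVector_mul, φ.pi_apply_eq_sum_univ]
  refine sum_congr rfl fun e _ => ?_
  rw [functionalLabel, dif_pos e.2, smul_eq_mul]
  congr 2
  ext e'
  simp [Pi.single_apply, eq_comm]

open Classical in
theorem edgeSum_mem (C : G.Subgraph) (v : V) :
    edgeSum (fun e => if v ∈ e then 1 else 0) C = ((C.neighborSet v).ncard : ZMod 2) := by
  rw [edgeSum, ← sum_filter, sum_const, nsmul_eq_mul, mul_one]
  congr 1
  rw [← Set.ncard_coe_finset]
  symm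
  refine Set.ncard_congr (fun w _ => s(v, w)) ?_ ?_ ?_
  · intro w hw
    simpa using hw
  · intro a b _ _ h
    exact Sym2.congr_right.1 h
  · intro e he
    simp only [coe_filter, Set.Finite.mem_toFinset, Set.mem_ofPred_eq] at he
    obtain ⟨w, rfl⟩ := Sym2.mem_iff_exists.1 he.2
    exact ⟨w, he.1, rfl⟩

/-- Coboundaries vanish on even subgraphs. -/
theorem edgeSum_eq_zero_of_coboundary {C : G.Subgraph} (hC : IsEvenSubgraph C)
    {f : Sym2 V → ZMod 2} {p : V → ZMod 2} (hf : ∀ x y, C.Adj x y → f s(x, y) = p x + p y) :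
    edgeSum f C = 0 := by
  classical
  have := Fintype.ofFinite V
  -- Double counting: after the sums are exchanged, the potential at `v` is multiplied by the degree
  -- of `v` in `C`, which is even.
  have h1 : edgeSum f C = ∑ e ∈ C.edgeSet.toFinite.toFinset, ∑ v, p v * if v ∈ e then 1 else 0 := by
    refine sum_congr rfl fun e he => ?_
    have he : e ∈ C.edgeSet := by simpa using he
    induction e using Sym2.ind with
    | _ x y =>
      have hxy : x ≠ y := (C.adj_sub he).ne
      have h2 : ∀ v, (p v * if v ∈ s(x, y) then 1 else 0) =
          (if v = x then p v else 0) + if v = y then p v else 0 := by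
        intro v
        by_cases hx : v = x
        · subst hx; simp [hxy]
        · by_cases hy : v = y
          · subst hy; simp [hx]
          · simp [hx, hy]
      rw [hf x y he, sum_congr rfl fun v _ => h2 v, sum_add_distrib]
      simp
  rw [h1, sum_comm]
  refine sum_eq_zero fun v _ => ?_
  rw [← mul_sum]
  have := edgeSum_mem C v
  rw [edgeSum] at this
  rw [this]
  by_cases hv : v ∈ C.verts
  · rw [(ZMod.natCast_eq_zero_iff_even).2 (hC v hv), mul_zero]
  · have : C.neighborSet v = ∅ := by
      ext w
      simp only [SimpleGraph.Subgraph.mem_neighborSet, Set.mem_empty_iff_false, iff_false]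
      exact fun h => hv h.fst_mem
    simp [this]

omit [Finite V] in
theorem isEvenSubgraph_of_isSimpleCycle {C : G.Subgraph} (hC : IsSimpleCycle C) :
    IsEvenSubgraph C := fun v hv => by rw [hC.2 v hv]; exact even_two

/-- A cyclic walk in a subgraph gives a simple cycle in it. -/
theorem exists_isSimpleCycle_of_isCycle {H : G.Subgraph} {u : V} {Z : H.spanningCoe.Walk u u}
    (hZ : Z.IsCycle) :
    ∃ C : G.Subgraph, C ≤ H ∧ IsSimpleCycle C ∧ ∀ f, edgeSum f C = walkSum f Z := by
  classical
  have hZ' : (Z.mapLe H.spanningCoe_le).IsCycle := hZ.mapLe _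
  have hedges : (Z.mapLe H.spanningCoe_le).edges = Z.edges := by simp
  have hE : ∀ e, e ∈ (Z.mapLe H.spanningCoe_le).toSubgraph.edgeSet ↔ e ∈ Z.edges := by
    intro e
    rw [SimpleGraph.Walk.mem_edges_toSubgraph, hedges]
  have hle : ∀ x y, (Z.mapLe H.spanningCoe_le).toSubgraph.Adj x y → H.Adj x y := by
    intro x y h
    exact Z.adj_of_mem_edges ((hE s(x, y)).1 h)
  refine ⟨_, ⟨?_, hle⟩, isSimpleCycle_toSubgraph hZ', fun f => ?_⟩
  · intro v hv
    obtain ⟨w, hw⟩ : ((Z.mapLe H.spanningCoe_le).toSubgraph.neighborSet v).Nonempty := by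
      refine Set.nonempty_of_ncard_ne_zero ?_
      rw [(isSimpleCycle_toSubgraph hZ').2 v hv]
      exact two_ne_zero
    exact (hle v w hw).fst_mem
  · rw [edgeSum, walkSum, ← List.sum_toFinset f hZ.edges_nodup]
    refine sum_congr ?_ fun _ _ => rfl
    ext e
    rw [Set.Finite.mem_toFinset, hE, List.mem_toFinset]

omit [Finite V] in
theorem isRobust_of_isTwoConnected {H : G.Subgraph} (hH : IsTwoConnected H) :
    IsRobust H.spanningCoe H.verts := by
  intro a x hx y hy hxa hya
  obtain ⟨-, h⟩ := (SimpleGraph.Subgraph.connected_iff_forall_exists_walk_subgraph _).1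
    (IsTwoConnected.connected_deleteVerts hH a)
  obtain ⟨p, hp⟩ := h (u := x) (v := y) ⟨hx, hxa⟩ ⟨hy, hya⟩
  have he : ∀ e ∈ p.edges, e ∈ H.spanningCoe.edgeSet := by
    intro e he
    have h1 := SimpleGraph.Subgraph.edgeSet_mono hp ((p.mem_edges_toSubgraph).2 he)
    have h2 := SimpleGraph.Subgraph.edgeSet_mono SimpleGraph.Subgraph.deleteVerts_le h1
    induction e using Sym2.ind with
    | _ x y => exact h2
  refine ⟨p.transfer _ he, fun ha => ?_⟩
  rw [SimpleGraph.Walk.support_transfer, ← SimpleGraph.Walk.mem_verts_toSubgraph] at ha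
  exact (hp.1 ha).2 rfl

end EdgeSum

/-! ### Positive simple cycles span the positive cycle space -/

section CycleSpace

variable {V : Type*} [Finite V] {G : ChargedGraph V}

/-- The charge of an edge as an element of `GF(2)`. -/
def chargeBit (G : ChargedGraph V) (e : Sym2 V) : ZMod 2 := if G.charge e = 1 then 0 else 1

theorem subgraphCharge_eq_one_iff (C : G.graph.Subgraph) :
    G.subgraphCharge C = 1 ↔ edgeSum (chargeBit G) C = 0 := by
  rw [← signOf_eq_one_iff, edgeSum, signOf_sum, subgraphCharge]
  refine Eq.congr_left (prod_congr rfl fun e he => ?_)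
  have he : e ∈ C.edgeSet := by simpa using he
  rw [chargeBit]
  rcases G.charge_eq e (C.edgeSet_subset he) with h | h <;> rw [h] <;> rfl

theorem exists_incidenceVector_eq (H : G.graph.Subgraph) {x : G.graph.edgeSet → ZMod 2}
    (hx : ∀ e : G.graph.edgeSet, (e : Sym2 V) ∉ H.edgeSet → x e = 0) :
    ∃ C ≤ H, x = incidenceVector C := by
  have hz2 : ∀ a : ZMod 2, a ≠ 0 → a = 1 := by decide
  let C : G.graph.Subgraph :=
    { verts := H.verts
      Adj := fun a b => ∃ h : G.graph.Adj a b, x ⟨s(a, b), h⟩ ≠ 0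
      adj_sub := fun h => h.1
      edge_vert := by
        rintro a b ⟨h, hne⟩
        by_contra ha
        exact hne (hx _ fun he => ha (H.edge_vert he))
      symm := ⟨by
        rintro a b ⟨h, hne⟩
        refine ⟨h.symm, ?_⟩
        convert hne using 3
        exact Subtype.ext Sym2.eq_swap⟩ }
  refine ⟨C, ⟨le_rfl, ?_⟩, ?_⟩
  · rintro a b ⟨h, hne⟩
    by_contra hab
    exact hne (hx _ hab)
  · classical
    funext ⟨e, he⟩
    induction e using Sym2.ind with
    | _ a b =>
      rw [incidenceVector, Set.indicator_apply]
      by_cases h : x ⟨s(a, b), he⟩ = 0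
      · rw [if_neg, h]
        rintro ⟨_, h'⟩
        exact h' h
      · rw [if_pos]
        · exact hz2 _ h
        · exact ⟨he, h⟩

theorem zero_mem_positiveCycleSpace (H : G.graph.Subgraph) : 0 ∈ G.positiveCycleSpace H := by
  refine ⟨⊥, bot_le, fun v hv => absurd hv (by simp), ?_, ?_⟩
  · rw [subgraphCharge_eq_one_iff, edgeSum]
    exact sum_eq_zero fun e he => by simp at he
  · funext e
    simp [incidenceVector]

theorem add_mem_positiveCycleSpace {H : G.graph.Subgraph} {x y : G.graph.edgeSet → ZMod 2}
    (hx : x ∈ G.positiveCycleSpace H) (hy : y ∈ G.positiveCycleSpace H) :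
    x + y ∈ G.positiveCycleSpace H := by
  classical
  have := Fintype.ofFinite G.graph.edgeSet
  obtain ⟨C, hCH, hC, hC1, rfl⟩ := hx
  obtain ⟨D, hDH, hD, hD1, rfl⟩ := hy
  obtain ⟨E, hEH, hE⟩ := exists_incidenceVector_eq H
    (x := incidenceVector C + incidenceVector D) fun e he => by
      have h1 : (e : Sym2 V) ∉ C.edgeSet := fun h => he (SimpleGraph.Subgraph.edgeSet_mono hCH h)
      have h2 : (e : Sym2 V) ∉ D.edgeSet := fun h => he (SimpleGraph.Subgraph.edgeSet_mono hDH h)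
      simp [incidenceVector, h1, h2]
  have hsum : ∀ f, edgeSum f E = edgeSum f C + edgeSum f D := by
    intro f
    rw [← sum_incidenceVector_mul, ← sum_incidenceVector_mul, ← sum_incidenceVector_mul,
      ← hE, ← sum_add_distrib]
    exact sum_congr rfl fun e _ => by rw [Pi.add_apply, add_mul]
  have heven : ∀ (C : G.graph.Subgraph), IsEvenSubgraph C → ∀ v,
      ((C.neighborSet v).ncard : ZMod 2) = 0 := by
    intro C hC v
    by_cases hv : v ∈ C.verts
    · exact (ZMod.natCast_eq_zero_iff_even).2 (hC v hv)
    · have : C.neighborSet v = ∅ := by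
        ext w
        simp only [SimpleGraph.Subgraph.mem_neighborSet, Set.mem_empty_iff_false, iff_false]
        exact fun h => hv h.fst_mem
      simp [this]
  refine ⟨E, hEH, fun v _ => ?_, ?_, hE⟩
  · rw [← ZMod.natCast_eq_zero_iff_even, ← edgeSum_mem, hsum, edgeSum_mem, edgeSum_mem,
      heven C hC, heven D hD, add_zero]
  · rw [subgraphCharge_eq_one_iff] at hC1 hD1 ⊢
    rw [hsum, hC1, hD1, add_zero]

/-- The positive cycle space of a two-connected subgraph is spanned by positive simple cycles. -/
theorem span_shortPositiveSimpleCycles {H : G.graph.Subgraph} (hH : IsTwoConnected H) :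
    (Submodule.span (ZMod 2) (G.shortPositiveSimpleCycles H H.edgeSet.ncard) :
      Set (G.graph.edgeSet → ZMod 2)) = G.positiveCycleSpace H := by
  refine Set.Subset.antisymm (fun x hx => ?_) ?_
  · refine Submodule.span_induction (p := fun x _ => x ∈ G.positiveCycleSpace H) ?_
      (zero_mem_positiveCycleSpace H) (fun x y _ _ => add_mem_positiveCycleSpace) ?_ hx
    · rintro x ⟨C, hCH, hC, hC1, -, rfl⟩
      exact ⟨C, hCH, isEvenSubgraph_of_isSimpleCycle hC, hC1, rfl⟩
    · intro a x _ hx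
      have : ∀ a : ZMod 2, a = 0 ∨ a = 1 := by decide
      rcases this a with rfl | rfl
      · rw [zero_smul]; exact zero_mem_positiveCycleSpace H
      · rwa [one_smul]
  · rintro x ⟨C, hCH, hC, hC1, rfl⟩
    by_contra hnot
    -- A separating functional, read as an edge labelling, kills all positive simple cycles of `H`,
    -- so it is a coboundary up to a multiple of the charge. Both of these vanish on a positive even
    -- subgraph. The length bound `H.edgeSet.ncard` restricts nothing.
    obtain ⟨φ, hφ, hker⟩ := Submodule.exists_le_ker_of_notMem hnot
    have hfg : ∀ (u : V) (Z : H.spanningCoe.Walk u u), Z.IsCycle →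
        walkSum (chargeBit G) Z = 0 → walkSum (functionalLabel φ) Z = 0 := by
      intro u Z hZ h0
      obtain ⟨D, hDH, hD, hsum⟩ := exists_isSimpleCycle_of_isCycle hZ
      rw [← hsum] at h0 ⊢
      rw [← functional_incidenceVector]
      exact hker (Submodule.subset_span ⟨D, hDH, hD, (subgraphCharge_eq_one_iff D).2 h0,
        Set.ncard_le_ncard (SimpleGraph.Subgraph.edgeSet_mono hDH), rfl⟩)
    obtain ⟨c, p, hp⟩ := exists_coboundary (isRobust_of_isTwoConnected hH)
      (fun x y h => H.edge_vert h) hfg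
    have h0 := edgeSum_eq_zero_of_coboundary hC
      (f := fun e => functionalLabel φ e + c * chargeBit G e) fun x y h => hp x y (hCH.2 h)
    rw [edgeSum, sum_add_distrib, ← mul_sum] at h0
    change edgeSum _ C + c * edgeSum _ C = 0 at h0
    rw [(subgraphCharge_eq_one_iff C).1 hC1, mul_zero, add_zero, ← functional_incidenceVector] at h0
    exact hφ h0

end CycleSpace


/-! ### Attainment of the sparsity -/

section Sparsity

variable {V : Type*} [Finite V] {G : ChargedGraph V} {H : G.graph.Subgraph}

/-- The infimum runs over a nonempty set, by `span_shortPositiveSimpleCycles`, and is therefore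
attained. -/
theorem span_blockSparsity (hH : IsTwoConnected H) (h2 : H.verts.ncard ≠ 2) :
    (Submodule.span (ZMod 2) (G.shortPositiveSimpleCycles H (G.blockSparsity H)) :
      Set (G.graph.edgeSet → ZMod 2)) = G.positiveCycleSpace H := by
  rw [blockSparsity, if_neg h2]
  exact Nat.sInf_mem (s := {l : ℕ | (Submodule.span (ZMod 2) (G.shortPositiveSimpleCycles H l) :
    Set (G.graph.edgeSet → ZMod 2)) = G.positiveCycleSpace H})
    ⟨_, span_shortPositiveSimpleCycles hH⟩

/-- If every positive simple cycle of the extremal length lay in the span of the shorter ones, the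
sparsity could be lowered by one. The bound three excludes the conventional value of trivial blocks.
-/
theorem exists_longest_positiveSimpleCycle (hH : IsTwoConnected H) (h3 : 3 ≤ G.blockSparsity H) :
    ∃ C ≤ H, IsSimpleCycle C ∧ G.subgraphCharge C = 1 ∧ C.edgeSet.ncard = G.blockSparsity H ∧
      incidenceVector C ∉
        Submodule.span (ZMod 2) (G.shortPositiveSimpleCycles H (G.blockSparsity H - 1)) := by
  have h2 : H.verts.ncard ≠ 2 := by
    intro h
    rw [blockSparsity, if_pos h] at h3
    omega
  have hspan := span_blockSparsity hH h2
  by_contra! hno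
  have hle : Submodule.span (ZMod 2) (G.shortPositiveSimpleCycles H (G.blockSparsity H)) ≤
      Submodule.span (ZMod 2) (G.shortPositiveSimpleCycles H (G.blockSparsity H - 1)) := by
    rw [Submodule.span_le]
    rintro x ⟨C, hCH, hC, hC1, hcard, rfl⟩
    rcases hcard.lt_or_eq with h | h
    · exact Submodule.subset_span ⟨C, hCH, hC, hC1, by omega, rfl⟩
    · exact hno C hCH hC hC1 h
  have hge : Submodule.span (ZMod 2) (G.shortPositiveSimpleCycles H (G.blockSparsity H - 1)) ≤
      Submodule.span (ZMod 2) (G.shortPositiveSimpleCycles H (G.blockSparsity H)) := by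
    refine Submodule.span_mono ?_
    rintro x ⟨C, hCH, hC, hC1, hcard, rfl⟩
    exact ⟨C, hCH, hC, hC1, by omega, rfl⟩
  rw [le_antisymm hle hge] at hspan
  have hmin : G.blockSparsity H ≤ G.blockSparsity H - 1 := by
    conv_lhs => rw [blockSparsity, if_neg h2]
    exact Nat.sInf_le hspan
  omega

theorem bddAbove_blockSparsity (G : ChargedGraph V) :
    BddAbove {n : ℕ | ∃ H : G.graph.Subgraph, IsBlock H ∧ n = G.blockSparsity H} := by
  refine ((Set.toFinite (Set.univ : Set G.graph.Subgraph)).image G.blockSparsity).bddAbove.mono ?_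
  rintro n ⟨H, -, rfl⟩
  exact ⟨H, trivial, rfl⟩

theorem blockSparsity_le (hH : IsBlock H) : G.blockSparsity H ≤ G.simpleCycleSparsity := by
  rw [simpleCycleSparsity, if_pos ⟨H, hH⟩]
  exact le_csSup (bddAbove_blockSparsity G) ⟨H, hH, rfl⟩

theorem exists_isBlock_blockSparsity_eq (h3 : 3 ≤ G.simpleCycleSparsity) :
    ∃ H : G.graph.Subgraph, IsBlock H ∧ G.blockSparsity H = G.simpleCycleSparsity := by
  rw [simpleCycleSparsity] at h3 ⊢
  split_ifs at h3 ⊢ with h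
  · obtain ⟨H, hH⟩ := h
    obtain ⟨H', hH', h'⟩ := Nat.sSup_mem (s := {n : ℕ | ∃ H : G.graph.Subgraph, IsBlock H ∧
      n = G.blockSparsity H}) ⟨_, H, hH, rfl⟩ (bddAbove_blockSparsity G)
    exact ⟨H', hH', h'.symm⟩
  · omega

end Sparsity

/-! ### Sign changes dual to short positive cycles -/

section Switching

variable {N : ℕ} {G : ChargedGraph (Fin N)}

theorem three_le_ncard_verts {H C : G.graph.Subgraph} (hCH : C ≤ H) (hC : IsSimpleCycle C) :
    3 ≤ H.verts.ncard := by
  have h1 := (card_verts_of_isSimpleCycle hC (S := C.verts.toFinite.toFinset) (by simp)).2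
  rw [← Set.ncard_eq_toFinset_card] at h1
  exact h1.trans (Set.ncard_le_ncard hCH.1)

theorem edgeProd_signOf (f : Sym2 (Fin N) → ZMod 2) (C : G.graph.Subgraph) :
    edgeProd (fun e => (signOf (f e) : ℝ)) C = (signOf (edgeSum f C) : ℝ) := by
  rw [edgeProd, edgeSum, signOf_sum, Int.cast_prod]

theorem edgeProd_signOf_eq_one_iff (f : Sym2 (Fin N) → ZMod 2) (C : G.graph.Subgraph) :
    edgeProd (fun e => (signOf (f e) : ℝ)) C = 1 ↔ edgeSum f C = 0 := by
  rw [edgeProd_signOf, ← signOf_eq_one_iff]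
  norm_cast

/-- Signs trivial on the positive simple cycles with at most `ℓ₊` edges are trivial on all positive
simple cycles. -/
theorem edgeProd_eq_one_of_short {t : Sym2 (Fin N) → ℝ} (ht : ∀ e, t e = 1 ∨ t e = -1)
    (hshort : ∀ C : G.graph.Subgraph, IsSimpleCycle C → G.subgraphCharge C = 1 →
      C.edgeSet.ncard ≤ G.simpleCycleSparsity → edgeProd t C = 1)
    {C : G.graph.Subgraph} (hC : IsSimpleCycle C) (hC1 : G.subgraphCharge C = 1) :
    edgeProd t C = 1 := by
  classical
  obtain ⟨f, rfl⟩ : ∃ f : Sym2 (Fin N) → ZMod 2, t = fun e => (signOf (f e) : ℝ) := by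
    refine ⟨fun e => if t e = 1 then 0 else 1, funext fun e => ?_⟩
    rcases ht e with h | h <;> norm_num [signOf, h]
  have := Fintype.ofFinite G.graph.edgeSet
  -- The cycle lies in some block, whose positive cycle space is spanned by positive simple cycles
  -- with at most ℓ₊ edges. The signs define a functional that vanishes on all of those.
  obtain ⟨H, hCH, hH⟩ := IsTwoConnected.exists_isBlock (isTwoConnected_of_isSimpleCycle hC)
  let φ : (G.graph.edgeSet → ZMod 2) →ₗ[ZMod 2] ZMod 2 :=
    ∑ e : G.graph.edgeSet, f e • LinearMap.proj e
  have hφ : ∀ D : G.graph.Subgraph, φ (incidenceVector D) = edgeSum f D := by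
    intro D
    rw [← sum_incidenceVector_mul]
    simp [φ, mul_comm]
  have hspan := span_blockSparsity hH.1
    (by have := three_le_ncard_verts hCH hC; omega)
  have hmem : incidenceVector C ∈ (Submodule.span (ZMod 2)
      (G.shortPositiveSimpleCycles H (G.blockSparsity H)) : Set (G.graph.edgeSet → ZMod 2)) := by
    rw [hspan]
    exact ⟨C, hCH, isEvenSubgraph_of_isSimpleCycle hC, hC1, rfl⟩
  have hker : Submodule.span (ZMod 2) (G.shortPositiveSimpleCycles H (G.blockSparsity H)) ≤
      φ.ker := by
    rw [Submodule.span_le]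
    rintro x ⟨D, -, hD, hD1, hcard, rfl⟩
    rw [SetLike.mem_coe, LinearMap.mem_ker, hφ, ← edgeProd_signOf_eq_one_iff]
    exact hshort D hD hD1 (hcard.trans (blockSparsity_le hH))
  rw [edgeProd_signOf_eq_one_iff, ← hφ]
  exact hker hmem

/-- There are signs trivial on the positive simple cycles with fewer than `ℓ₊` edges, but not on
some positive simple cycle with `ℓ₊` edges. -/
theorem exists_sign_short (h3 : 3 ≤ G.simpleCycleSparsity) :
    ∃ t : Sym2 (Fin N) → ℝ, (∀ e, t e = 1 ∨ t e = -1) ∧ (∀ x, t s(x, x) = 1) ∧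
      (∀ C : G.graph.Subgraph, IsSimpleCycle C → G.subgraphCharge C = 1 →
        C.edgeSet.ncard < G.simpleCycleSparsity → edgeProd t C = 1) ∧
      ∃ C : G.graph.Subgraph, IsSimpleCycle C ∧ G.subgraphCharge C = 1 ∧
        C.edgeSet.ncard = G.simpleCycleSparsity ∧ edgeProd t C ≠ 1 := by
  classical
  obtain ⟨H, hH, hl⟩ := exists_isBlock_blockSparsity_eq h3
  rw [← hl] at h3 ⊢
  obtain ⟨C, hCH, hC, hC1, hcard, hnot⟩ := exists_longest_positiveSimpleCycle hH.1 h3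
  obtain ⟨φ, hφ, hker⟩ := Submodule.exists_le_ker_of_notMem hnot
  -- The labelling is cut off outside the block. A simple cycle that shares an edge with the block
  -- lies inside it; any other meets only trivial labels.
  let f : Sym2 (Fin N) → ZMod 2 := fun e => if e ∈ H.edgeSet then functionalLabel φ e else 0
  have hf : ∀ D ≤ H, edgeSum f D = φ (incidenceVector D) := by
    intro D hD
    rw [functional_incidenceVector]
    refine sum_congr rfl fun e he => if_pos ?_
    exact SimpleGraph.Subgraph.edgeSet_mono hD (by simpa using he)
  refine ⟨fun e => (signOf (f e) : ℝ), fun e => ?_, fun x => ?_, fun D hD hD1 hDl => ?_,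
    C, hC, hC1, hcard, ?_⟩
  · dsimp only [signOf]; split_ifs <;> simp
  · have : s(x, x) ∉ H.edgeSet := fun h => (H.adj_sub h).ne rfl
    simp [f, this, signOf]
  · rw [edgeProd_signOf_eq_one_iff]
    by_cases hsh : ∃ x y, H.Adj x y ∧ D.Adj x y
    · obtain ⟨x, y, h1, h2⟩ := hsh
      have hDH := IsBlock.le_of_isSimpleCycle hH hD h1 h2
      rw [hf D hDH]
      exact hker (Submodule.subset_span ⟨D, hDH, hD, hD1, by omega, rfl⟩)
    · refine sum_eq_zero fun e he => if_neg fun he' => hsh ?_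
      have he : e ∈ D.edgeSet := by simpa using he
      induction e using Sym2.ind with
      | _ x y => exact ⟨x, y, he', he⟩
  · rw [Ne, edgeProd_signOf_eq_one_iff, hf C hCH]
    exact hφ

end Switching

end MagnitudeSymmetric

/-! ### The main theorem -/

open MagnitudeSymmetric ChargedGraph in
theorem mainTheorem1 (N : ℕ) (K : Matrix (Fin N) (Fin N) ℝ)
    (hK : K ∈ genericMagnitudeSymmetric N)
    (l : ℕ) (hl : l = (chargedSparsityGraph K hK.1).simpleCycleSparsity) (hl3 : 3 ≤ l) :
    (∀ K' ∈ genericMagnitudeSymmetric N,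
      (∀ S : Finset (Fin N), S.card ≤ l → principalMinor K S = principalMinor K' S) →
        ∀ S : Finset (Fin N), principalMinor K S = principalMinor K' S) ∧
    ∃ Khat ∈ genericMagnitudeSymmetric N,
      (∀ S : Finset (Fin N), S.card < l → principalMinor Khat S = principalMinor K S) ∧
      ∃ S : Finset (Fin N), S.card = l ∧ principalMinor Khat S ≠ principalMinor K S := by
  subst hl
  constructor
  · intro K' hK' hminor S
    obtain ⟨t, ht⟩ := exists_isSwitching hK.1 hK'.1 fun S hS => hminor S (by omega)
    refine ht.principalMinor_eq_of_simpleCycles hK.1 fun C hC hC1 _ =>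
      edgeProd_eq_one_of_short ht.eq_or ?_ hC hC1
    -- Strong induction on the length: the triviality of `t` on shorter positive cycles is what lets
    -- the minor on the vertices of `C` detect the sign of `C`.
    have key : ∀ n, ∀ C : (chargedSparsityGraph K hK.1).graph.Subgraph, IsSimpleCycle C →
        (chargedSparsityGraph K hK.1).subgraphCharge C = 1 → C.edgeSet.ncard = n →
        n ≤ (chargedSparsityGraph K hK.1).simpleCycleSparsity → edgeProd t C = 1 := by
      intro n
      induction n using Nat.strong_induction_on with
      | _ n ih =>
        rintro C hC hC1 rfl hn
        have hS : ((C.verts.toFinite.toFinset : Finset (Fin N)) : Set (Fin N)) = C.verts := by simp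
        refine ht.edgeProd_eq_one hK hC hC1 (fun D hD hD1 hlt =>
          ih _ hlt D hD hD1 rfl (hlt.le.trans hn)) hS (hminor _ ?_)
        rwa [(card_verts_of_isSimpleCycle hC hS).1]
    exact fun C hC hC1 hn => key _ C hC hC1 rfl hn
  · obtain ⟨t, ht, hdiag, hshort, C, hC, hC1, hcard, hne⟩ := exists_sign_short hl3
    -- The second matrix is the switching of `K` by the dual signs. Were the minor on the vertices
    -- of the cycle `C` unchanged, the sign of `C` would have to be one.
    have hsw : IsSwitching t K (Matrix.of fun x y => t s(x, y) * K x y) :=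
      ⟨ht, hdiag, fun _ _ => rfl⟩
    have hS : ((C.verts.toFinite.toFinset : Finset (Fin N)) : Set (Fin N)) = C.verts := by simp
    refine ⟨_, hsw.mem_genericMagnitudeSymmetric hK, fun S hS => ?_, C.verts.toFinite.toFinset,
      (card_verts_of_isSimpleCycle hC hS).1.trans hcard, fun h => hne ?_⟩
    · exact (hsw.principalMinor_eq_of_simpleCycles hK.1 fun D hD hD1 hn =>
        hshort D hD hD1 (hn.trans_lt hS)).symm
    · exact hsw.edgeProd_eq_one hK hC hC1 (fun D hD hD1 hn => hshort D hD hD1 (hcard ▸ hn)) hS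
        h.symm
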